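/- Let $\Bbbk$ be a field of characteristic $0$. Let $\mathtt{Per}$ be the operadic category whose objects are the surjections $\alpha:\{1,\dots,n\}\twoheadrightarrow\{1,\dots,k\}$, $n\ge k\ge 1$ (write $|\alpha|=k$), whose morphisms $f:\alpha\to\beta$ are the order-preserving maps $\gamma:\{1,\dots,|\alpha|\}\to\{1,\dots,|\beta|\}$ with $\gamma\alpha=\beta$ (same $n$), and in which the $i$-th fiber $f_i$ of $f$ is the surjection $(\gamma\alpha)^{-1}(i)\twoheadrightarrow\gamma^{-1}(i)$, renumbered increasingly. A $\mathtt{Per}$-operad $P$ consists of vector spaces $P(\alpha)$, structure maps $m_f:P(\beta)\otimes P(f_1)\otimes\cdots\otimes P(f_{|\beta|})\to P(\alpha)$ for $f:\alpha\to\beta$, and units in $P(\alpha)$, $|\alpha|=1$, subject to associativity and unitality. The terminal $\mathtt{Per}$-operad $\mathsf 1_{\mathtt{Per}}$ has $\mathsf 1_{\mathtt{Per}}(\alpha)=\Bbbk$ for all $\alpha$, with the canonical identifications $\Bbbk\otimes\cdots\otimes\Bbbk\cong\Bbbk$ as structure maps. A $\mathtt{Per}$-operad $P$ is binary quadratic if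 $P\cong\mathbb F(E)/(R)$, where $\mathbb F(E)$ is the free $\mathtt{Per}$-operad on a collection $E$ with $E(\alpha)=0$ for $|\alpha|\neq 2$, and $(R)$ is the ideal generated by a subcollection $R$ of the part $\mathbb F^2(E)$ spanned by composites of two generators. Its Koszul dual is $P^!=\mathbb F({\uparrow}E^*)/(R^\perp)$, where $R^\perp\subset\mathbb F^2({\uparrow}E^*)$ is the annihilator of $R$. Its dual dg operad is $\mathbb D(P^!)=(\mathbb F({\downarrow}\,\overline{(P^!)^*}),\partial)$, where $\overline{(P^!)^*}$ consists of the components of the linear dual with $|\alpha|\ge 2$ and $\partial$ is the derivation extending the desuspended dual of the partial compositions of $P^!$. Assume that $E$ and $P^!$ are component-wise finite-dimensional. Then $P$ is Koszul if the canonical map $\mathbb D(P^!)\to(P,0)$, i.e. the operad morphism extending ${\downarrow}(P^!)^*\to E\to P$, is a component-wise homology isomorphism. Theorem. The terminal $\mathtt{Per}$-operad $\mathsf 1_{\mathtt{Per}}$ is (binary quadratic) Koszul: the canonical map $\mathbb D(\mathsf 1_{\mathtt{Per}}^!)\to(\mathsf 1_{\mathtt{Per}},0)$ is a component-wise homology isomorphism.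 -/

import Mathlib

open CategoryTheory TensorProduct

universe u

/-- Objects of the operadic category `Per`: surjections `n ↠ k` with `n ≥ k ≥ 1`. -/
structure Per where
  n : ℕ
  k : ℕ
  pos : 0 < k
  map : Fin n → Fin k
  surj : Function.Surjective map

namespace Per

/-- Morphisms of `Per`: the identity on `n` on top, an order-preserving map `γ` at the bottom,
with `γ ∘ α = β`. -/
@[ext]
structure Hom (α β : Per) where
  hn : α.n = β.n
  γ : Fin α.k →o Fin β.k
  comm : ∀ u, γ (α.map u) = β.map (Fin.cast hn u)

instance : Category Per where
  Hom := Hom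
  id α := ⟨rfl, OrderHom.id, fun _ => rfl⟩
  comp f g := ⟨f.hn.trans g.hn, g.γ.comp f.γ, fun u => by
    rw [OrderHom.comp_coe, Function.comp_apply, f.comm, g.comm]; rfl⟩

theorem Hom.surjective {α β : Per} (f : α ⟶ β) : Function.Surjective f.γ := by
  intro i
  obtain ⟨u, rfl⟩ := β.surj i
  refine ⟨α.map (Fin.cast f.hn.symm u), ?_⟩
  rw [f.comm]; rfl

/-- The positions in `n` lying over a subset `K` of `k`. -/
def above (α : Per) (K : Finset (Fin α.k)) : Finset (Fin α.n) :=
  Finset.univ.filter fun u => α.map u ∈ K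

theorem mem_above {α : Per} {K : Finset (Fin α.k)} {u : Fin α.n} :
    u ∈ α.above K ↔ α.map u ∈ K := by simp [above]

/-- The surjection `α⁻¹(K) ↠ K`, with both ordered sets renumbered increasingly. -/
def restrict (α : Per) (K : Finset (Fin α.k)) (hK : K.Nonempty) : Per where
  n := (α.above K).card
  k := K.card
  pos := hK.card_pos
  map u := (K.orderIsoOfFin rfl).symm
    ⟨α.map ((α.above K).orderEmbOfFin rfl u),
      mem_above.1 (Finset.orderEmbOfFin_mem (α.above K) rfl u)⟩
  surj j := by
    obtain ⟨u, hu⟩ := α.surj (K.orderEmbOfFin rfl j)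
    have hu' : u ∈ (α.above K : Set (Fin α.n)) := by
      rw [Finset.mem_coe, mem_above, hu]; exact Finset.orderEmbOfFin_mem K rfl j
    rw [← Finset.range_orderEmbOfFin _ rfl] at hu'
    obtain ⟨v, rfl⟩ := hu'
    refine ⟨v, ?_⟩
    rw [OrderIso.symm_apply_eq]
    ext1
    exact hu

/-- The inclusion of the lower set of a restriction. -/
def incK (α : Per) (K : Finset (Fin α.k)) (hK : K.Nonempty) :
    Fin (α.restrict K hK).k ↪o Fin α.k := K.orderEmbOfFin rfl

/-- The inclusion of the upper set of a restriction. -/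
def incN (α : Per) (K : Finset (Fin α.k)) (hK : K.Nonempty) :
    Fin (α.restrict K hK).n ↪o Fin α.n := (α.above K).orderEmbOfFin rfl

theorem range_incK (α : Per) (K : Finset (Fin α.k)) (hK : K.Nonempty) :
    Set.range (α.incK K hK) = K := Finset.range_orderEmbOfFin K rfl

theorem range_incN (α : Per) (K : Finset (Fin α.k)) (hK : K.Nonempty) :
    Set.range (α.incN K hK) = α.above K := Finset.range_orderEmbOfFin (α.above K) rfl

theorem incK_map (α : Per) (K : Finset (Fin α.k)) (hK : K.Nonempty)
    (u : Fin (α.restrict K hK).n) :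
    α.incK K hK ((α.restrict K hK).map u) = α.map (α.incN K hK u) := by
  change (((K.orderIsoOfFin rfl) ((K.orderIsoOfFin rfl).symm _) : K) : Fin α.k) = _
  rw [OrderIso.apply_symm_apply]
  rfl

/-- `Per` is skeletal: order embeddings of the two levels with the same images, compatible with
the surjections, force equality. -/
theorem eq_of_range {α β δ : Per} (p : Fin α.n ↪o Fin δ.n) (q : Fin β.n ↪o Fin δ.n)
    (p' : Fin α.k ↪o Fin δ.k) (q' : Fin β.k ↪o Fin δ.k)
    (h : Set.range p = Set.range q) (h' : Set.range p' = Set.range q')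
    (hp : ∀ u, p' (α.map u) = δ.map (p u)) (hq : ∀ u, q' (β.map u) = δ.map (q u)) : α = β := by
  obtain ⟨n, k, _, m, _⟩ := α
  obtain ⟨n', k', _, m', _⟩ := β
  dsimp only at p q p' q' h h' hp hq
  have hn : n = n' := by
    have h1 := Set.card_range_of_injective p.injective
    have h2 := Set.card_range_of_injective q.injective
    simp only [← Nat.card_eq_fintype_card] at h1 h2
    rw [h] at h1
    simpa using h1.symm.trans h2
  have hk : k = k' := by
    have h1 := Set.card_range_of_injective p'.injective
    have h2 := Set.card_range_of_injective q'.injective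
    simp only [← Nat.card_eq_fintype_card] at h1 h2
    rw [h'] at h1
    simpa using h1.symm.trans h2
  subst hn hk
  obtain rfl : p = q := (OrderEmbedding.range_inj).1 h
  obtain rfl : p' = q' := (OrderEmbedding.range_inj).1 h'
  obtain rfl : m = m' := funext fun u => p'.injective ((hp u).trans (hq u).symm)
  rfl

/-- The set `γ⁻¹(i)`. -/
def block {α β : Per} (f : α ⟶ β) (i : Fin β.k) : Finset (Fin α.k) :=
  Finset.univ.filter fun j => f.γ j = i

theorem block_nonempty {α β : Per} (f : α ⟶ β) (i : Fin β.k) : (block f i).Nonempty := by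
  obtain ⟨j, hj⟩ := Hom.surjective f i
  exact ⟨j, by simp [block, hj]⟩

/-- The `i`-th fiber of `f`: the surjection `(γα)⁻¹(i) ↠ γ⁻¹(i)`. -/
def fib {α β : Per} (f : α ⟶ β) (i : Fin β.k) : Per :=
  α.restrict (block f i) (block_nonempty f i)

/-- The `j`-th element of `γ⁻¹(i)`. -/
def emb {α β : Per} (f : α ⟶ β) (i : Fin β.k) : Fin (fib f i).k ↪o Fin α.k :=
  α.incK (block f i) (block_nonempty f i)

/-- The `u`-th element of `(γα)⁻¹(i)`. -/
def embN {α β : Per} (f : α ⟶ β) (i : Fin β.k) : Fin (fib f i).n ↪o Fin α.n :=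
  α.incN (block f i) (block_nonempty f i)

theorem mem_range_emb {α β : Per} (f : α ⟶ β) (i : Fin β.k) (j : Fin α.k) :
    j ∈ Set.range (emb f i) ↔ f.γ j = i := by
  have h : Set.range (emb f i) = block f i := range_incK _ _ _
  rw [h]; simp [block]

theorem mem_range_embN {α β : Per} (f : α ⟶ β) (i : Fin β.k) (u : Fin α.n) :
    u ∈ Set.range (embN f i) ↔ f.γ (α.map u) = i := by
  have h : Set.range (embN f i) = α.above (block f i) := range_incN _ _ _
  rw [h]; simp [block, above]

theorem γ_emb {α β : Per} (f : α ⟶ β) (i : Fin β.k) (j : Fin (fib f i).k) :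
    f.γ (emb f i j) = i := (mem_range_emb f i _).1 ⟨j, rfl⟩

theorem γ_embN {α β : Per} (f : α ⟶ β) (i : Fin β.k) (u : Fin (fib f i).n) :
    f.γ (α.map (embN f i u)) = i := (mem_range_embN f i _).1 ⟨u, rfl⟩

theorem exists_emb {α β : Per} (f : α ⟶ β) (j : Fin α.k) :
    ∃ l : Fin (fib f (f.γ j)).k, emb f (f.γ j) l = j := (mem_range_emb f (f.γ j) j).2 rfl

theorem emb_map {α β : Per} (f : α ⟶ β) (i : Fin β.k) (u : Fin (fib f i).n) :
    emb f i ((fib f i).map u) = α.map (embN f i u) := incK_map _ _ _ _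

theorem fib_of_trivial {α β : Per} (f : α ⟶ β) (hβ : β.k = 1) (i : Fin β.k) :
    fib f i = α := by
  have : Subsingleton (Fin β.k) := by rw [hβ]; infer_instance
  refine eq_of_range (δ := α) (embN f i) (OrderIso.refl _).toOrderEmbedding (emb f i)
    (OrderIso.refl _).toOrderEmbedding ?_ ?_ (emb_map f i) (fun _ => rfl)
  · ext u
    rw [mem_range_embN]
    exact ⟨fun _ => ⟨u, rfl⟩, fun _ => Subsingleton.elim _ _⟩
  · ext u
    rw [mem_range_emb]
    exact ⟨fun _ => ⟨u, rfl⟩, fun _ => Subsingleton.elim _ _⟩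

theorem fib_id (α : Per) (i : Fin α.k) : (fib (𝟙 α) i).k = 1 := by
  change (block (𝟙 α) i).card = 1
  rw [Finset.card_eq_one]
  refine ⟨i, ?_⟩
  ext j
  simp only [block, Finset.mem_filter, Finset.mem_univ, true_and, Finset.mem_singleton]
  exact Iff.rfl

theorem comp_γ {α β δ : Per} (f : α ⟶ β) (g : β ⟶ δ) (j : Fin α.k) :
    (f ≫ g).γ j = g.γ (f.γ j) := rfl

/-- `f` maps the `j`-th fiber of `gf` onto the `j`-th fiber of `g`: upper level. -/
theorem card_fib_comp {α β δ : Per} (f : α ⟶ β) (g : β ⟶ δ) (j : Fin δ.k) :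
    (fib (f ≫ g) j).n = (fib g j).n := by
  have h : Fin.cast f.hn '' Set.range (embN (f ≫ g) j) = Set.range (embN g j) := by
    ext v
    constructor
    · rintro ⟨u, hu, rfl⟩
      rw [mem_range_embN] at hu ⊢
      rw [← f.comm]; exact hu
    · intro hv
      refine ⟨Fin.cast f.hn.symm v, ?_, by simp⟩
      rw [mem_range_embN] at hv ⊢
      rw [comp_γ, f.comm]; exact hv
  have h1 := Set.ncard_image_of_injective (Set.range (embN (f ≫ g) j))
    (Fin.cast_injective f.hn)
  rw [h, ← Set.image_univ, ← Set.image_univ, Set.ncard_image_of_injective _ (embN _ _).injective,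
    Set.ncard_image_of_injective _ (embN _ _).injective] at h1
  simpa using h1.symm

theorem embN_comp {α β δ : Per} (f : α ⟶ β) (g : β ⟶ δ) (j : Fin δ.k)
    (u : Fin (fib (f ≫ g) j).n) :
    Fin.cast f.hn (embN (f ≫ g) j u) = embN g j (Fin.cast (card_fib_comp f g j) u) := by
  let p : Fin (fib (f ≫ g) j).n ↪o Fin β.n :=
    (embN (f ≫ g) j).trans (Fin.castOrderIso f.hn).toOrderEmbedding
  let q : Fin (fib (f ≫ g) j).n ↪o Fin β.n :=
    (Fin.castOrderIso (card_fib_comp f g j)).toOrderEmbedding.trans (embN g j)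
  have h : p = q := by
    refine OrderEmbedding.range_inj.1 ?_
    ext v
    have hq : v ∈ Set.range q ↔ v ∈ Set.range (embN g j) := by
      constructor
      · rintro ⟨w, rfl⟩; exact ⟨_, rfl⟩
      · rintro ⟨w, rfl⟩; exact ⟨Fin.cast (card_fib_comp f g j).symm w, rfl⟩
    rw [hq, mem_range_embN]
    constructor
    · rintro ⟨w, rfl⟩
      have := γ_embN (f ≫ g) j w
      rw [comp_γ, f.comm] at this
      exact this
    · intro hv
      have : Fin.cast f.hn.symm v ∈ Set.range (embN (f ≫ g) j) := by
        rw [mem_range_embN, comp_γ, f.comm]; exact hv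
      obtain ⟨w, hw⟩ := this
      refine ⟨w, ?_⟩
      change Fin.cast f.hn (embN (f ≫ g) j w) = v
      rw [hw]; rfl
  exact congrArg (fun e : Fin (fib (f ≫ g) j).n ↪o Fin β.n => e u) h

theorem γ_emb_mem {α β δ : Per} (f : α ⟶ β) (g : β ⟶ δ) (j : Fin δ.k)
    (l : Fin (fib (f ≫ g) j).k) : f.γ (emb (f ≫ g) j l) ∈ block g j := by
  have h : g.γ (f.γ (emb (f ≫ g) j l)) = j := γ_emb (f ≫ g) j l
  simp [block, h]

/-- The bottom part of the map `(gf)⁻¹(j) → g⁻¹(j)` induced by `f`. -/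
def fibMapγ {α β δ : Per} (f : α ⟶ β) (g : β ⟶ δ) (j : Fin δ.k) :
    Fin (fib (f ≫ g) j).k →o Fin (fib g j).k where
  toFun l := ((block g j).orderIsoOfFin rfl).symm ⟨f.γ (emb (f ≫ g) j l), γ_emb_mem f g j l⟩
  monotone' := fun l l' h => by
    refine (OrderIso.le_iff_le _).2 ?_
    exact f.γ.monotone ((emb (f ≫ g) j).monotone h)

theorem emb_fibMapγ {α β δ : Per} (f : α ⟶ β) (g : β ⟶ δ) (j : Fin δ.k)
    (l : Fin (fib (f ≫ g) j).k) :
    emb g j (fibMapγ f g j l) = f.γ (emb (f ≫ g) j l) := by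
  change ((((block g j).orderIsoOfFin rfl)
    (((block g j).orderIsoOfFin rfl).symm _) : block g j) : Fin β.k) = _
  rw [OrderIso.apply_symm_apply]

/-- The morphism `(gf)⁻¹(j) → g⁻¹(j)` induced by `f` between the `j`-th fibers of `gf` and `g`. -/
def fibMap {α β δ : Per} (f : α ⟶ β) (g : β ⟶ δ) (j : Fin δ.k) :
    fib (f ≫ g) j ⟶ fib g j where
  hn := card_fib_comp f g j
  γ := fibMapγ f g j
  comm u := by
    refine (emb g j).injective ?_
    rw [emb_fibMapγ, emb_map, emb_map, f.comm, embN_comp]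

theorem emb_fibMap {α β δ : Per} (f : α ⟶ β) (g : β ⟶ δ) (j : Fin δ.k)
    (l : Fin (fib (f ≫ g) j).k) :
    emb g j ((fibMap f g j).γ l) = f.γ (emb (f ≫ g) j l) := emb_fibMapγ f g j l

/-- The fibers of the induced morphisms between fibers are the fibers of `f`. -/
theorem fib_fibMap {α β δ : Per} (f : α ⟶ β) (g : β ⟶ δ) (j : Fin δ.k)
    (i : Fin (fib g j).k) : fib f (emb g j i) = fib (fibMap f g j) i := by
  refine eq_of_range (δ := α) (embN f _)
    ((embN (fibMap f g j) i).trans (embN (f ≫ g) j)) (emb f _)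
    ((emb (fibMap f g j) i).trans (emb (f ≫ g) j)) ?_ ?_ (emb_map f _) ?_
  · ext u
    rw [mem_range_embN]
    constructor
    · intro h
      have hu : u ∈ Set.range (embN (f ≫ g) j) := by
        rw [mem_range_embN, comp_γ, h, γ_emb]
      obtain ⟨v, rfl⟩ := hu
      have hv : v ∈ Set.range (embN (fibMap f g j) i) := by
        rw [mem_range_embN]
        refine (emb g j).injective ?_
        rw [emb_fibMap, emb_map, h]
      obtain ⟨w, rfl⟩ := hv
      exact ⟨w, rfl⟩
    · rintro ⟨w, rfl⟩
      have := γ_embN (fibMap f g j) i w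
      refine Eq.trans ?_ (congrArg (emb g j) this)
      rw [emb_fibMap, emb_map]
      rfl
  · ext u
    rw [mem_range_emb]
    constructor
    · intro h
      have hu : u ∈ Set.range (emb (f ≫ g) j) := by
        rw [mem_range_emb, comp_γ, h, γ_emb]
      obtain ⟨v, rfl⟩ := hu
      have hv : v ∈ Set.range (emb (fibMap f g j) i) := by
        rw [mem_range_emb]
        refine (emb g j).injective ?_
        rw [emb_fibMap, h]
      obtain ⟨w, rfl⟩ := hv
      exact ⟨w, rfl⟩
    · rintro ⟨w, rfl⟩
      have := γ_emb (fibMap f g j) i w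
      refine Eq.trans ?_ (congrArg (emb g j) this)
      rw [emb_fibMap]
      rfl
  · intro u
    change emb (f ≫ g) j (emb (fibMap f g j) i _) = α.map (embN (f ≫ g) j (embN (fibMap f g j) i u))
    rw [emb_map, emb_map]

/-- A morphism out of `α` is determined by its bottom part, its target included. -/
instance (α : Per) : Finite (Σ β : Per, α ⟶ β) := by
  let φ : (Σ β : Per, α ⟶ β) → Σ m : Fin (α.k + 1), (Fin α.k → Fin m) := fun p =>
    ⟨⟨p.1.k, Nat.lt_succ_of_le (by
      simpa using Fintype.card_le_of_surjective _ (Hom.surjective p.2))⟩, p.2.γ⟩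
  refine Finite.of_injective φ ?_
  rintro ⟨⟨n, k, _, m, _⟩, ⟨hn, γ, hc⟩⟩ ⟨⟨n', k', _, m', _⟩, ⟨hn', γ', hc'⟩⟩ h
  dsimp only at hn hn' γ γ'
  subst hn hn'
  simp only [φ, Sigma.mk.injEq, Fin.mk.injEq] at h
  obtain ⟨rfl, h⟩ := h
  obtain rfl : γ = γ' := DFunLike.coe_injective (eq_of_heq h)
  obtain rfl : m = m' := funext fun u => (hc u).symm.trans (hc' u)
  rfl

end Per

section Operads

variable (𝕜 : Type u) [Field 𝕜]

/-- Transport along an equality of objects of `Per`. -/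
def castL (O : Per → Type u) [∀ α, AddCommGroup (O α)] [∀ α, Module 𝕜 (O α)] {α β : Per}
    (h : α = β) : O α →ₗ[𝕜] O β := h ▸ LinearMap.id

/-- `Per`-operads in vector spaces (i.e. concentrated in degree `0`): a collection with units
`η`, structure maps `m_f : P(β) ⊗ P(f₁) ⊗ ⋯ ⊗ P(f_k) → P(α)` for each `f : α ⟶ β`, with
associativity and the two unit axioms. -/
structure PerOperad where
  obj : Per → Type u
  [grp : ∀ α, AddCommGroup (obj α)]
  [mod : ∀ α, Module 𝕜 (obj α)]
  one : ∀ α : Per, α.k = 1 → obj α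
  comp : ∀ {α β : Per} (f : α ⟶ β),
    obj β →ₗ[𝕜] MultilinearMap 𝕜 (fun i => obj (Per.fib f i)) (obj α)
  assoc : ∀ {α β δ : Per} (f : α ⟶ β) (g : β ⟶ δ) (c : obj δ)
    (b : ∀ j, obj (Per.fib g j)) (a : ∀ i, obj (Per.fib f i)),
    comp (f ≫ g) c (fun j => comp (Per.fibMap f g j) (b j)
      fun i => castL 𝕜 obj (Per.fib_fibMap f g j i) (a (Per.emb g j i))) =
      comp f (comp g c b) a
  comp_id : ∀ (α : Per) (x : obj α),
    comp (𝟙 α) x (fun i => one _ (Per.fib_id α i)) = x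
  comp_terminal : ∀ {α β : Per} (f : α ⟶ β) (hβ : β.k = 1) (x : ∀ i, obj (Per.fib f i)),
    comp f (one β hβ) x = castL 𝕜 obj (Per.fib_of_trivial f hβ ⟨0, β.pos⟩) (x ⟨0, β.pos⟩)

attribute [instance] PerOperad.grp PerOperad.mod

theorem castL_const {V : Type u} [AddCommGroup V] [Module 𝕜 V] {α β : Per} (h : α = β) (x : V) :
    castL 𝕜 (fun _ => V) h x = x := by
  subst h; rfl

theorem prod_emb {α β : Per} (g : α ⟶ β) (a : Fin α.k → 𝕜) :
    ∏ j, ∏ i, a (Per.emb g j i) = ∏ i, a i := by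
  classical
  rw [← Finset.prod_fiberwise Finset.univ g.γ a]
  refine Finset.prod_congr rfl fun j _ => ?_
  refine Finset.prod_nbij (Per.emb g j) ?_ ?_ ?_ (fun _ _ => rfl)
  · intro i _
    simp [Per.γ_emb]
  · exact (Per.emb g j).injective.injOn
  · intro i hi
    have := (Per.mem_range_emb g j i).2 (by simpa using hi)
    simpa using this

/-- The terminal `Per`-operad: `𝕜` in each component, all structure maps being the canonical
identifications `𝕜 ⊗ 𝕜 ⊗ ⋯ ⊗ 𝕜 ≅ 𝕜`, and identity units. -/
def onePer : PerOperad 𝕜 where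
  obj _ := 𝕜
  one _ _ := 1
  comp f := LinearMap.toSpanSingleton 𝕜 _ (MultilinearMap.mkPiAlgebra 𝕜 _ 𝕜)
  assoc f g c b a := by
    simp [castL_const, Finset.prod_mul_distrib, prod_emb, mul_assoc]
  comp_id α x := by simp
  comp_terminal {α β} f hβ x := by
    have : Subsingleton (Fin β.k) := by rw [hβ]; infer_instance
    simp [castL_const, Fintype.prod_subsingleton _ (⟨0, β.pos⟩ : Fin β.k)]

/-- Planar rooted trees, all of whose vertices have at least two inputs, with leaves labelled by
the lower set of `α`, together with the `Per`-objects `α_v` labelling the vertices: the root vertex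
of `node f t` is labelled by the target `β` of `f : α ⟶ β`, and the subtree growing from its
`i`-th input is a tree over the `i`-th fiber of `f`. The tree without vertices lives over the
objects `n ↠ 1`. -/
inductive PTree : Per → Type
  | leaf {α : Per} (h : α.k = 1) : PTree α
  | node {α β : Per} (f : α ⟶ β) (h : 2 ≤ β.k) (t : ∀ i, PTree (Per.fib f i)) : PTree α

noncomputable instance (α : Per) : DecidableEq (PTree α) := Classical.decEq _

/-- The sum of `d (α_v)` over the vertices `v` of a tree. -/
def PTree.deg (d : Per → ℤ) : ∀ {α : Per}, PTree α → ℤ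
  | _, .leaf _ => 0
  | _, .node (β := β) _ _ t => d β + ∑ i, (t i).deg d

/-- The number of vertices. -/
def PTree.weight {α : Per} (t : PTree α) : ℤ := t.deg fun _ => 1

/-- Graded `Per`-collections with each component `E(α)` concentrated in a single degree, `deg α`.
Only the components with `2 ≤ |α|` will matter. -/
structure PerColl where
  obj : Per → Type u
  [grp : ∀ α, AddCommGroup (obj α)]
  [mod : ∀ α, Module 𝕜 (obj α)]
  deg : Per → ℤ

attribute [instance] PerColl.grp PerColl.mod

variable {𝕜}

namespace PerColl

variable (E : PerColl 𝕜)

/-- The tensor product `⨂_v E(α_v)` over the vertices of a tree, the vertices being ordered with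
the root first, followed by the subtrees of the root from left to right. -/
noncomputable def T : ∀ {α : Per}, PTree α → ModuleCat.{u} 𝕜
  | _, .leaf _ => ModuleCat.of 𝕜 𝕜
  | _, .node (β := β) _ _ t => ModuleCat.of 𝕜 (E.obj β ⊗[𝕜] (⨂[𝕜] i, T (t i)))

/-- The free `Per`-operad on `E`: the direct sum over trees of `⨂_v E(α_v)`. -/
abbrev F (α : Per) : Type u := Π₀ t : PTree α, E.T t

/-- The inclusion of the summand of a tree. -/
noncomputable def of {α : Per} (t : PTree α) : E.T t →ₗ[𝕜] E.F α :=
  DFinsupp.lsingle (R := 𝕜) (M := fun t => E.T t) t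

/-- Linear maps out of the free operad are given on the summands. -/
noncomputable def lift {α : Per} {V : Type u} [AddCommGroup V] [Module 𝕜 V]
    (φ : ∀ t : PTree α, E.T t →ₗ[𝕜] V) : E.F α →ₗ[𝕜] V :=
  DFinsupp.lsum ℕ (M := fun t => E.T t) φ

/-- The weight-`s` part: the sum over the trees with `s` vertices. -/
noncomputable def weightPart (s : ℤ) (α : Per) : Submodule 𝕜 (E.F α) :=
  ⨆ t : {t : PTree α // t.weight = s}, LinearMap.range (E.of t.1)

/-- The unit of the free operad. -/
noncomputable def one {α : Per} (h : α.k = 1) : E.F α := E.of (.leaf h) (1 : 𝕜)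

/-- Linear maps out of the tensor product attached to `node f t`. -/
noncomputable def liftNode {α β : Per} (f : α ⟶ β) (h : 2 ≤ β.k)
    (t : ∀ i, PTree (Per.fib f i)) {V : Type u} [AddCommGroup V] [Module 𝕜 V]
    (φ : E.obj β →ₗ[𝕜] MultilinearMap 𝕜 (fun i => E.T (t i)) V) : E.T (.node f h t) →ₗ[𝕜] V :=
  TensorProduct.lift (M := E.obj β) (N := ⨂[𝕜] i, E.T (t i))
    ((PiTensorProduct.lift (R := 𝕜) (s := fun i => E.T (t i)) (E := V)).toLinearMap ∘ₗ φ)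

/-- Attaching elements of the summands of trees to a root vertex. -/
noncomputable def nodeT {α β : Per} (f : α ⟶ β) (h : 2 ≤ β.k) (t : ∀ i, PTree (Per.fib f i)) :
    E.obj β →ₗ[𝕜] MultilinearMap 𝕜 (fun i => E.T (t i)) (E.T (.node f h t)) where
  toFun e := (TensorProduct.mk 𝕜 (E.obj β) (⨂[𝕜] i, E.T (t i)) e).compMultilinearMap
    (PiTensorProduct.tprod 𝕜)
  map_add' e e' := MultilinearMap.ext fun _ => TensorProduct.add_tmul e e' _
  map_smul' c e := MultilinearMap.ext fun _ => (TensorProduct.smul_tmul' c e _).symm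

/-- Attaching elements of the free operad to a root vertex, extended multilinearly. -/
noncomputable def node {α β : Per} (f : α ⟶ β) (h : 2 ≤ β.k) :
    E.obj β →ₗ[𝕜] MultilinearMap 𝕜 (fun i => E.F (Per.fib f i)) (E.F α) :=
  (MultilinearMap.fromDFinsuppEquiv (fun i => PTree (Per.fib f i)) 𝕜
    (M := fun _ t => E.T t) (N := E.F α)).toLinearMap ∘ₗ
  LinearMap.pi fun t => LinearMap.compMultilinearMapₗ 𝕜 (E.of (.node f h t)) ∘ₗ E.nodeT f h t

/-- The operator multiplying elements of degree `d` by `(-1)^(p d)`. -/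
noncomputable def twist (p : ℤ) (α : Per) : E.F α →ₗ[𝕜] E.F α :=
  E.lift fun t => ((p * t.deg E.deg).negOnePow : ℤˣ) • E.of t

section Graft

variable {α β δ : Per} (f : α ⟶ β) (g : β ⟶ δ) {V : Fin δ.k → Type u}
  [∀ j, AddCommGroup (V j)] [∀ j, Module 𝕜 (V j)]
  (A : ∀ j, V j →ₗ[𝕜] MultilinearMap 𝕜 (fun i => E.F (Per.fib (Per.fibMap f g j) i))
    (E.F (Per.fib (f ≫ g) j)))
  (p : Fin δ.k → ℤ)

/-- The arguments belonging to the `j`-th fiber of `g`, twisted by `p j`. -/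
noncomputable def args (j : Fin δ.k) (y : ∀ i, E.F (Per.fib f i)) (i : Fin (Per.fib g j).k) :
    E.F (Per.fib (Per.fibMap f g j) i) :=
  castL 𝕜 E.F (Per.fib_fibMap f g j i) (E.twist (p j) _ (y (Per.emb g j i)))

theorem args_update [DecidableEq (Fin β.k)] (j : Fin δ.k) (l : Fin (Per.fib g j).k)
    (y : ∀ i, E.F (Per.fib f i)) (v : E.F (Per.fib f (Per.emb g j l))) :
    E.args f g p j (Function.update y (Per.emb g j l) v) =
      Function.update (E.args f g p j y) l
        (castL 𝕜 E.F (Per.fib_fibMap f g j l) (E.twist (p j) _ v)) := by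
  funext i
  by_cases h : i = l
  · subst h; simp [args]
  · have h' : Per.emb g j i ≠ Per.emb g j l := fun e => h ((Per.emb g j).injective e)
    simp [args, h, h']

theorem args_update_of_ne [DecidableEq (Fin β.k)] {j j' : Fin δ.k} (hj : j' ≠ j)
    (l : Fin (Per.fib g j).k) (y : ∀ i, E.F (Per.fib f i)) (v : E.F (Per.fib f (Per.emb g j l))) :
    E.args f g p j' (Function.update y (Per.emb g j l) v) = E.args f g p j' y := by
  funext i
  have h' : Per.emb g j' i ≠ Per.emb g j l := fun e => hj (by
    rw [← Per.γ_emb g j' i, e, Per.γ_emb])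
  simp [args, h']

theorem apply_args_update [DecidableEq (Fin β.k)] (x : ∀ j, V j) (j : Fin δ.k)
    (l : Fin (Per.fib g j).k) (y : ∀ i, E.F (Per.fib f i))
    (v : E.F (Per.fib f (Per.emb g j l))) :
    (fun j' => A j' (x j') (E.args f g p j' (Function.update y (Per.emb g j l) v))) =
      Function.update (fun j' => A j' (x j') (E.args f g p j' y)) j
        (A j (x j) (Function.update (E.args f g p j y) l
          (castL 𝕜 E.F (Per.fib_fibMap f g j l) (E.twist (p j) _ v)))) := by
  funext j'
  by_cases h : j' = j
  · subst h; simp [args_update]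
  · simp [h, args_update_of_ne]

/-- Grafting: `x, y ↦ N(A₁(x₁; y_{(1)}), …, A_r(x_r; y_{(r)}))`, where `y_{(j)}` is the part of
`y` which belongs to the `j`-th fiber of `g`, twisted by `p j`. -/
noncomputable def graft :
    MultilinearMap 𝕜 (fun j => E.F (Per.fib (f ≫ g) j)) (E.F α) →ₗ[𝕜]
      MultilinearMap 𝕜 V (MultilinearMap 𝕜 (fun i => E.F (Per.fib f i)) (E.F α)) where
  toFun N :=
    { toFun x :=
        { toFun y := N fun j => A j (x j) (E.args f g p j y)
          map_update_add' y i v w := by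
            obtain ⟨l, hl⟩ := Per.exists_emb g i
            generalize g.γ i = j at l hl
            subst hl
            simp only [apply_args_update, map_add, MultilinearMap.map_update_add]
          map_update_smul' y i c v := by
            obtain ⟨l, hl⟩ := Per.exists_emb g i
            generalize g.γ i = j at l hl
            subst hl
            simp only [apply_args_update, map_smul, MultilinearMap.map_update_smul] }
      map_update_add' x j v w := by
        have h (z : V j) (y) : (fun j' => A j' (Function.update x j z j') (E.args f g p j' y)) =
            Function.update (fun j' => A j' (x j') (E.args f g p j' y)) j
              (A j z (E.args f g p j y)) := by
          funext j'
          by_cases h : j' = j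
          · subst h; simp
          · simp [h]
        refine MultilinearMap.ext fun y => ?_
        change N _ = N _ + N _
        simp only [h, map_add, add_apply, MultilinearMap.map_update_add]
      map_update_smul' x j c v := by
        have h (z : V j) (y) : (fun j' => A j' (Function.update x j z j') (E.args f g p j' y)) =
            Function.update (fun j' => A j' (x j') (E.args f g p j' y)) j
              (A j z (E.args f g p j y)) := by
          funext j'
          by_cases h : j' = j
          · subst h; simp
          · simp [h]
        refine MultilinearMap.ext fun y => ?_
        change N _ = c • N _
        simp only [h, map_smul, smul_apply, MultilinearMap.map_update_smul] }
  map_add' _ _ := rfl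
  map_smul' _ _ := rfl

end Graft

/-- The multilinear map in one variable `y ↦ c • y` attached to `f : α ⟶ β` with `|β| = 1`. -/
noncomputable def compLeaf {α β : Per} (f : α ⟶ β) (hβ : β.k = 1) :
    𝕜 →ₗ[𝕜] MultilinearMap 𝕜 (fun i => E.F (Per.fib f i)) (E.F α) :=
  LinearMap.toSpanSingleton 𝕜 _
    { toFun y := castL 𝕜 E.F (Per.fib_of_trivial f hβ ⟨0, β.pos⟩) (y ⟨0, β.pos⟩)
      map_update_add' y i v w := by
        have : Subsingleton (Fin β.k) := by rw [hβ]; infer_instance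
        obtain rfl : i = ⟨0, β.pos⟩ := Subsingleton.elim _ _
        simp
      map_update_smul' y i c v := by
        have : Subsingleton (Fin β.k) := by rw [hβ]; infer_instance
        obtain rfl : i = ⟨0, β.pos⟩ := Subsingleton.elim _ _
        simp }

/-- The structure maps of the free operad, on the summand of a tree over `β`: grafting of trees at
the leaves. Moving the arguments `y_i` to their positions behind the subtrees `x_j` of the root
produces the Koszul sign `(-1)^(|y_i| |x_j|)` whenever `j > g(i)`. -/
noncomputable def compT : ∀ {β : Per} (t : PTree β) {α : Per} (f : α ⟶ β),
    E.T t →ₗ[𝕜] MultilinearMap 𝕜 (fun i => E.F (Per.fib f i)) (E.F α)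
  | _, .leaf hβ, _, f => E.compLeaf f hβ
  | _, .node (β := δ) g h t, _, f =>
    E.liftNode g h t
      (E.graft f g (fun j => compT (t j) (Per.fibMap f g j))
        (fun j => ∑ j' : Fin δ.k with j < j', (t j').deg E.deg) ∘ₗ E.node (f ≫ g) h)

/-- The structure maps `m_f` of the free operad. -/
noncomputable def comp {α β : Per} (f : α ⟶ β) :
    E.F β →ₗ[𝕜] MultilinearMap 𝕜 (fun i => E.F (Per.fib f i)) (E.F α) :=
  E.lift fun t => E.compT t f

/-- The unit of the component `α` if `|α| = 1`, and `0` otherwise. -/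
noncomputable def oneOrZero (α : Per) : E.F α := if h : α.k = 1 then E.one h else 0

/-- The inclusion of the generators, the component `α` being sent to the tree with one vertex
labelled by `α`. -/
noncomputable def gen (α : Per) : E.obj α →ₗ[𝕜] E.F α :=
  if h : 2 ≤ α.k then
    { toFun e := E.node (𝟙 α) h e fun i => E.one (Per.fib_id α i)
      map_add' e e' := by simp
      map_smul' c e := by simp }
  else 0

/-- The partial composition `x ∘_f y` for `f : α ⟶ β` and `y` in the `i`-th fiber of `f`, all the
other fibers being filled with units. -/
noncomputable def circ {α β : Per} (f : α ⟶ β) (i : Fin β.k) :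
    E.F β →ₗ[𝕜] E.F (Per.fib f i) →ₗ[𝕜] E.F α :=
  LinearMap.mk₂ 𝕜 (fun x y => E.comp f x (Function.update (fun j => E.oneOrZero (Per.fib f j)) i y))
    (by intros; simp) (by intros; simp) (by intros; simp) (by intros; simp)

/-- The derivation of degree `-1` of the free operad extending a degree `-1` linear map `ζ` on the
generators, on the summand of a tree: `ζ` is applied to each vertex label in turn, and passing over
an element of degree `d` costs the sign `(-1)^d`. -/
noncomputable def derT (ζ : ∀ α, E.obj α →ₗ[𝕜] E.F α) :
    ∀ {α : Per} (t : PTree α), E.T t →ₗ[𝕜] E.F α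
  | _, .leaf _ => 0
  | _, .node (β := β) f h t =>
    E.liftNode f h t
      (MultilinearMap.compLinearMapₗ (fun i => E.of (t i)) ∘ₗ E.comp f ∘ₗ ζ β +
        ∑ i : Fin β.k, ((E.deg β + ∑ j : Fin β.k with j < i, (t j).deg E.deg).negOnePow : ℤˣ) •
          MultilinearMap.compLinearMapₗ
            (fun j => if j = i then derT ζ (t j) else E.of (t j)) ∘ₗ E.node f h)

/-- The derivation extending `ζ`. -/
noncomputable def der (ζ : ∀ α, E.obj α →ₗ[𝕜] E.F α) (α : Per) : E.F α →ₗ[𝕜] E.F α :=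
  E.lift fun t => E.derT ζ t

/-- The operad morphism from the free operad to `P` extending `κ`, on the summand of a tree. -/
noncomputable def evT (P : PerOperad 𝕜) (κ : ∀ α, E.obj α →ₗ[𝕜] P.obj α) :
    ∀ {α : Per} (t : PTree α), E.T t →ₗ[𝕜] P.obj α
  | α, .leaf h => (LinearMap.toSpanSingleton 𝕜 (P.obj α) (P.one α h) : 𝕜 →ₗ[𝕜] P.obj α)
  | _, .node (β := β) f h t =>
    E.liftNode f h t
      (MultilinearMap.compLinearMapₗ (fun i => evT P κ (t i)) ∘ₗ P.comp f ∘ₗ κ β)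

/-- The operad morphism from the free operad on `E` to `P` extending `κ`. -/
noncomputable def ev (P : PerOperad 𝕜) (κ : ∀ α, E.obj α →ₗ[𝕜] P.obj α) (α : Per) :
    E.F α →ₗ[𝕜] P.obj α :=
  E.lift fun t => E.evT P κ t

/-- Operadic ideals of the free operad. -/
structure IsIdeal (I : ∀ α, Submodule 𝕜 (E.F α)) : Prop where
  left : ∀ {α β : Per} (f : α ⟶ β) (x : E.F β) (y : ∀ i, E.F (Per.fib f i)),
    x ∈ I β → E.comp f x y ∈ I α
  right : ∀ {α β : Per} (f : α ⟶ β) (x : E.F β) (y : ∀ i, E.F (Per.fib f i)) (i : Fin β.k),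
    y i ∈ I (Per.fib f i) → E.comp f x y ∈ I α

/-- The ideal generated by a subcollection `R`. -/
noncomputable def ideal (R : ∀ α, Submodule 𝕜 (E.F α)) (α : Per) : Submodule 𝕜 (E.F α) :=
  ⨅ I : {I : ∀ α, Submodule 𝕜 (E.F α) // E.IsIdeal I ∧ ∀ α, R α ≤ I α}, I.1 α

theorem ideal_isIdeal (R : ∀ α, Submodule 𝕜 (E.F α)) : E.IsIdeal (E.ideal R) where
  left f x y h := by
    rw [ideal, Submodule.mem_iInf] at h ⊢
    exact fun I => I.2.1.left f x y (h I)
  right f x y i h := by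
    rw [ideal, Submodule.mem_iInf] at h ⊢
    exact fun I => I.2.1.right f x y i (h I)

/-- The suspension `↑E^*` of the component-wise linear dual of a collection `E` in degree `0`;
its components are in degree `1`. -/
def susDual : PerColl 𝕜 where
  obj α := Module.Dual 𝕜 (E.obj α)
  deg _ := 1

/-- The pairing of `⨂_v E(α_v)^*` with `⨂_v E(α_v)`. -/
noncomputable def pairT : ∀ {α : Per} (t : PTree α),
    E.susDual.T t →ₗ[𝕜] Module.Dual 𝕜 (E.T t)
  | _, .leaf _ => (LinearMap.mul 𝕜 𝕜 : 𝕜 →ₗ[𝕜] 𝕜 →ₗ[𝕜] 𝕜)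
  | _, .node (β := β) _ _ t =>
    (TensorProduct.dualDistrib 𝕜 (E.obj β) (⨂[𝕜] i, E.T (t i)) ∘ₗ
      TensorProduct.map LinearMap.id
        (PiTensorProduct.dualDistrib ∘ₗ PiTensorProduct.map fun i => pairT (t i)) :
      Module.Dual 𝕜 (E.obj β) ⊗[𝕜] (⨂[𝕜] i, E.susDual.T (t i)) →ₗ[𝕜]
        Module.Dual 𝕜 (E.obj β ⊗[𝕜] (⨂[𝕜] i, E.T (t i))))

/-- The pairing of the free operads on `↑E^*` and on `E`, different trees being orthogonal. -/
noncomputable def pair (α : Per) : E.susDual.F α →ₗ[𝕜] Module.Dual 𝕜 (E.F α) :=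
  E.susDual.lift fun t =>
    (DFinsupp.lapply (R := 𝕜) (M := fun t => E.T t) t).dualMap ∘ₗ E.pairT t

/-- The annihilator `R^⊥` of `R` in the weight-`2` part of the free operad on `↑E^*`. -/
noncomputable def perp (R : ∀ α, Submodule 𝕜 (E.F α)) (α : Per) : Submodule 𝕜 (E.susDual.F α) :=
  E.susDual.weightPart 2 α ⊓ (R α).dualAnnihilator.comap (E.pair α)

/-- The underlying collection of the Koszul dual `P^! = F(↑E^*)/(R^⊥)` of `P = F(E)/(R)`; if `E` is
binary, its component `α` is in degree `|α| - 1`. -/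
abbrev KDual (R : ∀ α, Submodule 𝕜 (E.F α)) (α : Per) : Type u :=
  E.susDual.F α ⧸ E.susDual.ideal (E.perp R) α

variable (R : ∀ α, Submodule 𝕜 (E.F α))

/-- The projection `F(↑E^*) → P^!`. -/
noncomputable def toKDual (α : Per) : E.susDual.F α →ₗ[𝕜] E.KDual R α :=
  (E.susDual.ideal (E.perp R) α).mkQ

/-- The partial compositions of the Koszul dual, induced by those of the free operad. -/
noncomputable def kcirc {α β : Per} (f : α ⟶ β) (i : Fin β.k) :
    E.KDual R β →ₗ[𝕜] E.KDual R (Per.fib f i) →ₗ[𝕜] E.KDual R α :=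
  Submodule.liftQ (E.susDual.ideal (E.perp R) β)
    (LinearMap.flip (Submodule.liftQ (E.susDual.ideal (E.perp R) (Per.fib f i))
      (((E.susDual.circ f i).compr₂ (E.toKDual R α)).flip) (by
        intro y hy
        rw [LinearMap.mem_ker]
        refine LinearMap.ext fun x => ?_
        refine (Submodule.Quotient.mk_eq_zero _).2 ?_
        exact (E.susDual.ideal_isIdeal _).right f x _ i (by simpa using hy))))
    (by
      intro x hx
      rw [LinearMap.mem_ker]
      refine LinearMap.ext fun y => ?_
      obtain ⟨y, rfl⟩ := Submodule.Quotient.mk_surjective _ y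
      refine (Submodule.Quotient.mk_eq_zero _).2 ?_
      exact (E.susDual.ideal_isIdeal _).left f x _ hx)

/-- The collection `↓(P^!)^*` generating the dual dg operad `D(P^!)`; its component `α` is in
degree `|α| - 2`. -/
noncomputable def cobarColl : PerColl 𝕜 where
  obj α := Module.Dual 𝕜 (E.KDual R α)
  deg α := α.k - 2

end PerColl

/-- Elementary morphisms out of `α` with target of cardinality at least two: exactly one fiber,
the `i`-th one, is nontrivial. -/
structure Per.Elem (α : Per) where
  tgt : Σ β : Per, α ⟶ β
  i : Fin tgt.1.k
  two_le : 2 ≤ tgt.1.k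
  nontriv : (Per.fib tgt.2 i).k ≠ 1
  triv : ∀ j, j ≠ i → (Per.fib tgt.2 j).k = 1

instance (α : Per) : Finite α.Elem :=
  Finite.of_injective (β := Σ p : (Σ β : Per, α ⟶ β), Fin p.1.k) (fun p => ⟨p.tgt, p.i⟩) (by
    rintro ⟨t, i, _, _, _⟩ ⟨t', i', _, _, _⟩ h
    obtain ⟨rfl, h⟩ := Sigma.mk.inj_iff.1 h
    obtain rfl := eq_of_heq h
    rfl)

noncomputable instance (α : Per) : Fintype α.Elem := Fintype.ofFinite _

namespace PerColl

variable (E : PerColl 𝕜) (R : ∀ α, Submodule 𝕜 (E.F α))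

/-- The structure operation `Δ_f : (P^!)^*(α) → (P^!)^*(β) ⊗ (P^!)^*(F)` of the dual cooperad: the
dual of the partial composition. -/
noncomputable def coop [∀ α, Module.Finite 𝕜 (E.KDual R α)] {α β : Per} (f : α ⟶ β) (i : Fin β.k) :
    Module.Dual 𝕜 (E.KDual R α) →ₗ[𝕜]
      Module.Dual 𝕜 (E.KDual R β) ⊗[𝕜] Module.Dual 𝕜 (E.KDual R (Per.fib f i)) :=
  (TensorProduct.dualDistribEquiv 𝕜 (E.KDual R β) (E.KDual R (Per.fib f i))).symm.toLinearMap ∘ₗ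
    (TensorProduct.lift (E.kcirc R f i)).dualMap

/-- The map `↓(P^!)^* → F²(↓(P^!)^*)` given by the structure operations of the cooperad `(P^!)^*`;
the sign comes from the identification of `↓a ⊗ ↓b` with `↓²(a ⊗ b)`, which is `(-1)^|a|`. -/
noncomputable def zeta [∀ α, Module.Finite 𝕜 (E.KDual R α)] (α : Per) :
    (E.cobarColl R).obj α →ₗ[𝕜] (E.cobarColl R).F α :=
  ∑ p : α.Elem, (((p.tgt.1.k : ℤ) - 1).negOnePow : ℤˣ) •
    TensorProduct.lift (((E.cobarColl R).circ p.tgt.2 p.i).compl₁₂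
      ((E.cobarColl R).gen p.tgt.1) ((E.cobarColl R).gen (Per.fib p.tgt.2 p.i))) ∘ₗ
    E.coop R p.tgt.2 p.i

/-- The differential of `D(P^!) = (F(↓(P^!)^*), ∂)`. -/
noncomputable def cobarD [∀ α, Module.Finite 𝕜 (E.KDual R α)] (α : Per) :
    (E.cobarColl R).F α →ₗ[𝕜] (E.cobarColl R).F α :=
  (E.cobarColl R).der (E.zeta R) α

end PerColl

/-- A binary quadratic presentation `P ≅ F(E)/(R)` of a `Per`-operad (in degree `0`):
generators `E` in degree `0` with `E(α) = 0` unless `|α| = 2`, relations `R` in the weight-`2` part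
of `F(E)`, and a surjective operad morphism `F(E) → P` with kernel the ideal `(R)`. -/
structure BinaryQuadratic (P : PerOperad 𝕜) where
  E : PerColl 𝕜
  deg_eq : ∀ α, E.deg α = 0
  binary : ∀ α, α.k ≠ 2 → Subsingleton (E.obj α)
  R : ∀ α, Submodule 𝕜 (E.F α)
  quadratic : ∀ α, R α ≤ E.weightPart 2 α
  proj : ∀ α, E.F α →ₗ[𝕜] P.obj α
  proj_one : ∀ α (h : α.k = 1), proj α (E.one h) = P.one α h
  proj_comp : ∀ {α β : Per} (f : α ⟶ β) (x : E.F β) (y : ∀ i, E.F (Per.fib f i)),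
    proj α (E.comp f x y) = P.comp f (proj β x) fun i => proj _ (y i)
  surj : ∀ α, Function.Surjective (proj α)
  ker : ∀ α, LinearMap.ker (proj α) = E.ideal R α

namespace BinaryQuadratic

variable {P : PerOperad 𝕜} (Q : BinaryQuadratic P)

/-- The twisting morphism `↓(P^!)^* → E → P`: the dual `(P^!)^* → E^** ≅ E` of
`E^* → F(↑E^*) → P^!`, followed by `E → F(E) → P`. -/
noncomputable def twisting [∀ α, Module.Finite 𝕜 (Q.E.obj α)] (α : Per) :
    (Q.E.cobarColl Q.R).obj α →ₗ[𝕜] P.obj α :=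
  Q.proj α ∘ₗ Q.E.gen α ∘ₗ (Module.evalEquiv 𝕜 (Q.E.obj α)).symm.toLinearMap ∘ₗ
    (Q.E.toKDual Q.R α ∘ₗ Q.E.susDual.gen α).dualMap

/-- The canonical map `D(P^!) → P`. -/
noncomputable def can [∀ α, Module.Finite 𝕜 (Q.E.obj α)] (α : Per) :
    (Q.E.cobarColl Q.R).F α →ₗ[𝕜] P.obj α :=
  (Q.E.cobarColl Q.R).ev P Q.twisting α

end BinaryQuadratic

/-- `φ` is a homology isomorphism from `(V, d)` to `(W, 0)`: `d` is a differential, `φ` is a chain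
map, and the map induced from `ker d / im d` to `W` is injective and surjective. (All the complexes
here are direct sums of their homogeneous parts and all the maps are homogeneous, so that this is
an isomorphism in every degree.) -/
structure IsHomologyIso {V W : Type u} [AddCommGroup V] [Module 𝕜 V] [AddCommGroup W] [Module 𝕜 W]
    (d : V →ₗ[𝕜] V) (φ : V →ₗ[𝕜] W) : Prop where
  d_comp_d : d ∘ₗ d = 0
  φ_comp_d : φ ∘ₗ d = 0
  injective : ∀ x : V, d x = 0 → φ x = 0 → x ∈ LinearMap.range d
  surjective : ∀ w : W, ∃ x, d x = 0 ∧ φ x = w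

/-- A `Per`-operad `P` is Koszul if it has a binary quadratic presentation (with the finiteness
needed to form the duals) such that the canonical map `D(P^!) → P` is a component-wise homology
isomorphism. -/
def IsKoszul (P : PerOperad 𝕜) : Prop :=
  ∃ (Q : BinaryQuadratic P) (_ : ∀ α, Module.Finite 𝕜 (Q.E.obj α))
    (_ : ∀ α, Module.Finite 𝕜 (Q.E.KDual Q.R α)),
    ∀ α, IsHomologyIso (Q.E.cobarD Q.R α) (Q.can α)

end Operads

/-!
# Koszulness of the terminal operad over `Per`

A morphism out of `α` is the same thing as a composition of the integer `|α|`, the sequence of the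
sizes of its fibers (`Per.exists_hom`, `Per.sigma_ext_of_card`). Therefore the trees indexing the
component over `α` of a free operad are the reduced planar trees with `|α|` leaves
(`PTree.shape_injective`, `PTree.exists_shape`), and over each `α` one meets the combinatorics of
nonsymmetric operads, the terminal operad playing the role of the operad of associative algebras.

* *Presentation.* The terminal operad is generated by one operation over each object of cardinality
  two. Over an object of cardinality three there are two composites, and the relations identify
  them. Any two binary trees are connected by such reassociations, so that the quotient is at most
  one-dimensional over each object (`PerColl.ker_phi_le`); it is exactly one-dimensional because the
  functional `PerColl.phi`, the product of the labels of the vertices, vanishes on the ideal.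
* *Koszul dual.* In the free operad on the suspended dual generators, the annihilator of the
  relations is spanned by the sum of the two composites. The same argument applies to the functional
  `PerColl.phi` with the signs of the operadic suspension, whose cocycle property is
  `Per.susp_comp`. So the Koszul dual is one-dimensional over each object, and its partial
  compositions are known up to the basis and the suspension signs (`PerColl.coop_kosPhi`).
* *Dual dg operad.* Consequently the dual dg operad of the Koszul dual has over `α` a basis indexed
  by reduced planar trees with `|α|` leaves. Up to signs, its differential sums over all ways of
  expanding a vertex by grafting several consecutive, but not all inputs to a new vertex
  (`PerColl.Sh_der`): this is the cellular chain complex of an associahedron.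
* *Differential on planar trees.* The differential `ForestAlg.d` is defined by recursion so that the
  coderivation `b` of the deconcatenation coalgebra of planar forests, whose corestriction `M`
  grafts forests to a new root and is the differential on trees, satisfies `M b = 0`. Hence
  `b b = 0`, which contains `d d = 0` (`ForestAlg.d_dTree`).
* *Acyclicity.* Match the tree with root inputs `t, s₁, …, sᵣ`, `r ≥ 2`, with the tree whose root has
  the inputs `t` and the vertex with inputs `s₁, …, sᵣ`, and extend this recursively along the left
  edge when the right input of a binary root is a leaf. Only the left comb remains unmatched. In the
  differential of an upper tree, all the lower trees other than its partner have a higher rank, so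
  that the homology is one-dimensional and detected on binary trees (`ForestAlg.exists_d_eq`). The
  canonical map to the terminal operad is this augmentation (`PerColl.ev_eq_augL`).
-/

/-! ### Morphisms of `Per` and the sizes of their fibers -/

namespace Per

/-- A morphism out of `α`, together with its target, is determined by its bottom part. -/
theorem sigma_ext {α β β' : Per} (f : α ⟶ β) (f' : α ⟶ β') (hk : β.k = β'.k)
    (h : ∀ j, (f.γ j : ℕ) = f'.γ j) : (⟨β, f⟩ : Σ β : Per, α ⟶ β) = ⟨β', f'⟩ := by
  obtain ⟨n, k, _, m, _⟩ := β
  obtain ⟨n', k', _, m', _⟩ := β'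
  obtain ⟨hn, γ, hc⟩ := f
  obtain ⟨hn', γ', hc'⟩ := f'
  dsimp only at hn hn' γ γ' hk h
  subst hn hn' hk
  obtain rfl : γ = γ' := by
    ext j; exact h j
  obtain rfl : m = m' := funext fun u => (hc u).symm.trans (hc' u)
  rfl

theorem fib_k {α β : Per} (f : α ⟶ β) (i : Fin β.k) : (fib f i).k = (block f i).card := rfl

theorem card_lt {α β : Per} (f : α ⟶ β) (i : Fin β.k) :
    (Finset.univ.filter fun j => f.γ j < i).card = ∑ i' with i' < i, (fib f i').k := by
  rw [Finset.card_eq_sum_card_fiberwise (f := f.γ) (t := Finset.univ.filter (· < i))]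
  · refine Finset.sum_congr rfl fun i' hi' => ?_
    rw [fib_k, block, Finset.filter_filter]
    congr 1
    ext j
    simp only [Finset.mem_filter, Finset.mem_univ, true_and] at hi' ⊢
    constructor
    · exact fun h => h.2
    · rintro rfl; exact ⟨hi', rfl⟩
  · intro j hj
    simpa using hj

/-- The fibers of a morphism are consecutive intervals. -/
theorem emb_val {α β : Per} (f : α ⟶ β) (i : Fin β.k) (l : Fin (fib f i).k) :
    (emb f i l : ℕ) = ∑ i' with i' < i, (fib f i').k + l := by
  rw [← card_lt, ← Fin.card_Iio (emb f i l)]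
  have h : Finset.Iio (emb f i l) =
      (Finset.univ.filter fun j => f.γ j < i) ∪ (Finset.Iio l).map (emb f i).toEmbedding := by
    ext j
    simp only [Finset.mem_Iio, Finset.mem_union, Finset.mem_filter, Finset.mem_univ, true_and,
      Finset.mem_map, RelEmbedding.coe_toEmbedding]
    constructor
    · intro hj
      have h1 : f.γ j ≤ i := (f.γ.monotone hj.le).trans_eq (γ_emb f i l)
      rcases h1.lt_or_eq with h1 | h1
      · exact Or.inl h1
      · obtain ⟨l', rfl⟩ := (mem_range_emb f i j).2 h1
        exact Or.inr ⟨l', (emb f i).lt_iff_lt.1 hj, rfl⟩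
    · rintro (hj | ⟨l', hl', rfl⟩)
      · by_contra hj'
        have := f.γ.monotone (not_lt.1 hj')
        rw [γ_emb] at this
        exact absurd hj (not_lt.2 this)
      · exact (emb f i).lt_iff_lt.2 hl'
  rw [h, Finset.card_union_of_disjoint, Finset.card_map, Fin.card_Iio]
  rw [Finset.disjoint_left]
  intro j hj hj'
  simp only [Finset.mem_filter, Finset.mem_univ, true_and,
      Finset.mem_map, RelEmbedding.coe_toEmbedding] at hj hj'
  obtain ⟨l', _, rfl⟩ := hj'
  rw [γ_emb] at hj
  exact lt_irrefl _ hj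

theorem sum_fib {α β : Per} (f : α ⟶ β) : ∑ i, (fib f i).k = α.k := by
  have := Finset.card_eq_sum_card_fiberwise (f := f.γ) (s := Finset.univ) (t := Finset.univ)
    (fun _ _ => Finset.mem_coe.2 (Finset.mem_univ _))
  rw [Finset.card_univ, Fintype.card_fin] at this
  exact this.symm

theorem fib_k_pos {α β : Per} (f : α ⟶ β) (i : Fin β.k) : 0 < (fib f i).k := (fib f i).pos

theorem k_le {α β : Per} (f : α ⟶ β) : β.k ≤ α.k := by
  simpa using Fintype.card_le_of_surjective _ (Hom.surjective f)

/-- A morphism out of `α`, together with its target, is determined by the sizes of its fibers. -/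
theorem sigma_ext_of_card {α β β' : Per} (f : α ⟶ β) (f' : α ⟶ β') (hk : β.k = β'.k)
    (h : ∀ i, (fib f i).k = (fib f' (Fin.cast hk i)).k) :
    (⟨β, f⟩ : Σ β : Per, α ⟶ β) = ⟨β', f'⟩ := by
  refine sigma_ext f f' hk fun j => ?_
  obtain ⟨l, hl⟩ := exists_emb f j
  generalize hi : f.γ j = i at l hl
  have h1 : emb f' (Fin.cast hk i) (Fin.cast (h i) l) = j := by
    rw [← hl]
    ext
    rw [emb_val, emb_val]
    congr 1
    refine (Finset.sum_equiv (finCongr hk) ?_ ?_).symm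
    · intro i'; simp only [Finset.mem_filter, Finset.mem_univ, true_and]; exact Iff.rfl
    · intro i' _; exact h i'
  rw [← h1, γ_emb]
  rfl

/-- Every composition of `|α|` is the sequence of the sizes of the fibers of a morphism. -/
theorem exists_hom (α : Per) {r : ℕ} (c : Fin r → ℕ) (hc : ∀ i, 0 < c i) (hs : ∑ i, c i = α.k) :
    ∃ (β : Per) (f : α ⟶ β) (hk : β.k = r), ∀ i, (fib f i).k = c (Fin.cast hk i) := by
  let e : Fin α.k ≃ (i : Fin r) × Fin (c i) := (finCongr hs.symm).trans finSigmaFinEquiv.symm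
  have hval : ∀ x : (i : Fin r) × Fin (c i), ((e.symm x : Fin α.k) : ℕ) =
      ∑ i with i < x.1, c i + x.2 := by
    intro x
    change ((finSigmaFinEquiv x : Fin _) : ℕ) = _
    rw [finSigmaFinEquiv_apply]
    congr 1
    refine Finset.sum_bij (fun i _ => Fin.castLE x.1.2.le i) ?_ ?_ ?_ ?_
    · intro i _; exact Finset.mem_filter.2 ⟨Finset.mem_univ _, i.2⟩
    · intro i _ j _ h; simpa using h
    · intro i hi
      refine ⟨⟨i, (Finset.mem_filter.1 hi).2⟩, Finset.mem_univ _, rfl⟩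
    · intro i _; rfl
  have hmono : Monotone fun j => (e j).1 := by
    intro j j' hjj
    by_contra hlt
    rw [not_le] at hlt
    have h1 := hval (e j)
    have h2 := hval (e j')
    rw [Equiv.symm_apply_apply] at h1 h2
    have h3 : ∑ i with i < (e j').1, c i + c (e j').1 ≤ ∑ i with i < (e j).1, c i := by
      rw [add_comm, ← Finset.sum_insert (by simp)]
      refine Finset.sum_le_sum_of_subset ?_
      intro i hi
      simp only [Finset.mem_insert, Finset.mem_filter, Finset.mem_univ, true_and] at hi ⊢
      rcases hi with rfl | hi
      · exact hlt
      · exact hi.trans hlt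
    have h4 := (e j').2.2
    have h5 : (j : ℕ) ≤ j' := hjj
    omega
  have hsurj : Function.Surjective fun j => (e j).1 := fun i =>
    ⟨e.symm ⟨i, ⟨0, hc i⟩⟩, by simp⟩
  have hr : 0 < r := (e ⟨0, α.pos⟩).1.pos
  let β : Per := ⟨α.n, r, hr, fun u => (e (α.map u)).1, hsurj.comp α.surj⟩
  let f : α ⟶ β := ⟨rfl, ⟨fun j => (e j).1, hmono⟩, fun _ => rfl⟩
  refine ⟨β, f, rfl, fun i => ?_⟩
  change (Finset.univ.filter fun j => (e j).1 = i).card = c i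
  refine (Finset.card_bij' (t := (Finset.univ : Finset (Fin (c i))))
    (fun j _ => if h : (e j).1 = i then h ▸ (e j).2 else ⟨0, hc i⟩) (fun l _ => e.symm ⟨i, l⟩)
    (fun _ _ => Finset.mem_univ _) (fun l _ => by simp) (fun j hj => ?_)
    (fun l _ => ?_)).trans (by simp)
  · obtain rfl : (e j).1 = i := by simpa using hj
    simp
  · rw [Equiv.apply_symm_apply, dif_pos rfl]

/-- The only morphism between objects of the same cardinality is the identity. -/
theorem eq_id_of_fib {α β : Per} (f : α ⟶ β) (h : β.k = α.k) :
    (⟨β, f⟩ : Σ β : Per, α ⟶ β) = ⟨α, 𝟙 α⟩ := by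
  refine sigma_ext_of_card f (𝟙 α) h fun i => ?_
  rw [fib_id]
  have h1 := sum_fib f
  have h2 : ∑ i : Fin β.k, 1 = ∑ i, (fib f i).k := by rw [h1, ← h]; simp
  exact ((Finset.sum_eq_sum_iff_of_le fun i _ => fib_k_pos f i).1 h2 i (Finset.mem_univ _)).symm

end Per

namespace Per.Elem

variable {α : Per} (p : α.Elem)

/-- The size of the nontrivial fiber. -/
abbrev size : ℕ := (fib p.tgt.2 p.i).k

theorem fib_k_eq (j : Fin p.tgt.1.k) :
    (fib p.tgt.2 j).k = if j = p.i then p.size else 1 := by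
  split_ifs with h
  · subst h; rfl
  · exact p.triv j h

theorem two_le_size : 2 ≤ p.size := by
  have := fib_k_pos p.tgt.2 p.i
  have := p.nontriv
  unfold size
  omega

theorem card : p.tgt.1.k + p.size = α.k + 1 := by
  have h := sum_fib p.tgt.2
  have h' := p.two_le
  rw [← Finset.sum_erase_add _ _ (Finset.mem_univ p.i),
    Finset.sum_congr rfl fun j hj => p.triv j (Finset.ne_of_mem_erase hj), Finset.sum_const,
    Finset.card_erase_of_mem (Finset.mem_univ _), Finset.card_univ, Fintype.card_fin] at h
  simp only [smul_eq_mul, mul_one] at h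
  unfold size
  omega

theorem sum_lt (j : Fin p.tgt.1.k) :
    ∑ j' with j' < j, (fib p.tgt.2 j').k = if p.i < j then j + p.size - 1 else (j : ℕ) := by
  have hc : (Finset.univ.filter (· < j)).card = j := by
    rw [← Fin.card_Iio j]; congr 1; ext; simp
  split_ifs with h
  · rw [← Finset.sum_erase_add _ _ (by simpa using h : p.i ∈ Finset.univ.filter (· < j)),
      Finset.sum_congr rfl fun j' hj => p.triv j' (Finset.ne_of_mem_erase hj), Finset.sum_const,
      Finset.card_erase_of_mem (by simpa using h), hc]
    have : 0 < (j : ℕ) := lt_of_le_of_lt (Nat.zero_le _) h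
    simp only [smul_eq_mul, mul_one, size]
    omega
  · rw [Finset.sum_congr rfl fun j' hj => p.triv j' ?_, Finset.sum_const, hc]
    · simp
    · rintro rfl
      exact h (by simpa using hj)

theorem emb_self (l : Fin p.size) : (emb p.tgt.2 p.i l : ℕ) = p.i + l := by
  rw [emb_val, sum_lt, if_neg (lt_irrefl _)]

theorem emb_of_lt {j : Fin p.tgt.1.k} (h : j < p.i) (l : Fin (fib p.tgt.2 j).k) :
    (emb p.tgt.2 j l : ℕ) = j := by
  have : (l : ℕ) = 0 := by have h1 := l.2; have h2 := p.triv j h.ne; omega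
  rw [emb_val, sum_lt, if_neg (not_lt.2 h.le), this, add_zero]

theorem emb_of_gt {j : Fin p.tgt.1.k} (h : p.i < j) (l : Fin (fib p.tgt.2 j).k) :
    (emb p.tgt.2 j l : ℕ) = j + p.size - 1 := by
  have : (l : ℕ) = 0 := by have h1 := l.2; have h2 := p.triv j h.ne'; omega
  rw [emb_val, sum_lt, if_pos h, this, add_zero]

theorem i_add_size_le : p.i + p.size ≤ α.k := by
  have := p.card
  have := p.i.2
  omega

theorem size_lt : p.size < α.k := by
  have := p.card
  have := p.two_le
  omega

/-- The starting point and the length of the interval contracted by an elementary morphism. -/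
def interval : ℕ × ℕ := (p.i, p.size)

theorem interval_injective : Function.Injective (interval (α := α)) := by
  intro p q h
  have h1 : (p.i : ℕ) = q.i := congrArg Prod.fst h
  have h2 : p.size = q.size := congrArg Prod.snd h
  have hk : p.tgt.1.k = q.tgt.1.k := by
    have := p.card; have := q.card; omega
  have ht : p.tgt = q.tgt := by
    refine sigma_ext_of_card p.tgt.2 q.tgt.2 hk fun i => ?_
    rw [p.fib_k_eq, q.fib_k_eq, h2]
    simp only [Fin.ext_iff, h1, Fin.val_cast]
  obtain ⟨t, i, _, _, _⟩ := p
  obtain ⟨t', i', _, _, _⟩ := q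
  dsimp only at ht h1
  subst ht
  obtain rfl := Fin.ext h1
  rfl

/-- The intervals which can be contracted in a corolla with `k` inputs. -/
def intervals (k : ℕ) : Finset (ℕ × ℕ) :=
  (Finset.range k ×ˢ Finset.range k).filter fun x => 2 ≤ x.2 ∧ x.1 + x.2 ≤ k

theorem exists_interval {x : ℕ × ℕ} (hx : x ∈ intervals α.k) : ∃ p : α.Elem, p.interval = x := by
  obtain ⟨a, b⟩ := x
  simp only [intervals, Finset.mem_filter, Finset.mem_product, Finset.mem_range] at hx
  obtain ⟨⟨ha, hb⟩, hb2, hab⟩ := hx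
  let r := α.k + 1 - b
  have har : a < r := by omega
  let c : Fin r → ℕ := fun i => if i = ⟨a, har⟩ then b else 1
  obtain ⟨β, f, hk, hf⟩ := exists_hom α c (fun i => by dsimp only [c]; split_ifs <;> omega) (by
    rw [← Finset.sum_erase_add _ _ (Finset.mem_univ (⟨a, har⟩ : Fin r)),
      Finset.sum_congr rfl fun j hj => if_neg (Finset.ne_of_mem_erase hj), Finset.sum_const,
      Finset.card_erase_of_mem (Finset.mem_univ _), Finset.card_univ, Fintype.card_fin]
    simp [c, r]; omega)
  have hi : (fib f ⟨a, by omega⟩).k = b := by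
    rw [hf]; exact if_pos rfl
  refine ⟨⟨⟨β, f⟩, ⟨a, hk.symm ▸ har⟩, (by change 2 ≤ β.k; omega),
    fun h => (by have h' := hi.symm.trans h; omega), fun j hj => ?_⟩, ?_⟩
  · dsimp only
    rw [hf]
    refine if_neg fun h => hj ?_
    have h' := congrArg Fin.val h
    exact Fin.ext h'
  · exact Prod.ext rfl hi

theorem interval_mem : p.interval ∈ intervals α.k := by
  have h1 := p.i_add_size_le
  have h2 := p.two_le_size
  have h3 := p.size_lt
  simp only [intervals, interval, Finset.mem_filter, Finset.mem_product, Finset.mem_range]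
  omega

theorem sum_elem {M : Type*} [AddCommMonoid M] (F : ℕ × ℕ → M) :
    ∑ p : α.Elem, F p.interval = ∑ x ∈ intervals α.k, F x :=
  Finset.sum_bij (fun p _ => p.interval) (fun p _ => p.interval_mem)
    (fun _ _ _ _ h => interval_injective h)
    (fun _ hx => (exists_interval hx).imp fun _ h => ⟨Finset.mem_univ _, h⟩) fun _ _ => rfl

end Per.Elem

/-! ### Planar trees and forests -/

/-- Planar rooted trees: a tree is the list of the subtrees growing from its root; the tree
without vertices is `node []`. -/
inductive Tr where
  | node : List Tr → Tr

namespace Tr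

theorem ind {p : Tr → Prop} (h : ∀ l, (∀ t ∈ l, p t) → p (.node l)) : ∀ t, p t
  | .node l => h l fun t _ => ind h t

/-- The tree without vertices. -/
def leaf : Tr := .node []

section Sign
variable (𝕜 : Type u) [Field 𝕜]

mutual
/-- The sign `(-1)^(|t| + 1)`, where `|t|` is the degree of a tree, a vertex with `r` inputs having
degree `r - 2`. -/
def sg : Tr → 𝕜
  | .node l => - sgL l
/-- The product of the signs of the trees of a forest. -/
def sgL : List Tr → 𝕜
  | [] => 1
  | t :: l => sg t * sgL l
end

@[simp] theorem sg_node (l : List Tr) : sg 𝕜 (.node l) = - sgL 𝕜 l := by rw [sg]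
@[simp] theorem sgL_nil : sgL 𝕜 [] = 1 := by rw [sgL]
@[simp] theorem sgL_cons (t : Tr) (l : List Tr) : sgL 𝕜 (t :: l) = sg 𝕜 t * sgL 𝕜 l := by rw [sgL]

theorem sgL_append (l l' : List Tr) : sgL 𝕜 (l ++ l') = sgL 𝕜 l * sgL 𝕜 l' := by
  induction l with
  | nil => simp
  | cons t l ih => simp [ih, mul_assoc]

theorem sg_mul_self (t : Tr) : sg 𝕜 t * sg 𝕜 t = 1 := by
  induction t using ind with
  | h l ih =>
    rw [sg_node, neg_mul_neg]
    induction l with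
    | nil => simp
    | cons t l ih' =>
      rw [sgL_cons, mul_mul_mul_comm, ih t (by simp), ih' fun s hs => ih s (by simp [hs]), one_mul]

end Sign

mutual
/-- The number of leaves. -/
def leaves : Tr → ℕ
  | .node [] => 1
  | .node (t :: l) => leaves t + leavesL l
/-- The number of leaves of a forest. -/
def leavesL : List Tr → ℕ
  | [] => 0
  | t :: l => leaves t + leavesL l
end

@[simp] theorem leavesL_nil : leavesL [] = 0 := by rw [leavesL]
@[simp] theorem leavesL_cons (t : Tr) (l : List Tr) : leavesL (t :: l) = leaves t + leavesL l := by
  rw [leavesL]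
@[simp] theorem leaves_leaf : leaves leaf = 1 := by rw [leaf, leaves]

theorem leaves_node {l : List Tr} (h : l ≠ []) : leaves (.node l) = leavesL l := by
  cases l with
  | nil => exact absurd rfl h
  | cons t l => rw [leaves, leavesL_cons]

theorem leavesL_append (l l' : List Tr) : leavesL (l ++ l') = leavesL l + leavesL l' := by
  induction l with
  | nil => simp
  | cons t l ih => simp [ih, add_assoc]

theorem leaves_pos (t : Tr) : 0 < leaves t := by
  induction t using ind with
  | h l ih =>
    cases l with
    | nil => rw [leaves]; exact one_pos
    | cons t l => rw [leaves]; exact Nat.add_pos_left (ih t (by simp)) _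

theorem leavesL_pos {l : List Tr} (h : l ≠ []) : 0 < leavesL l := by
  rw [← leaves_node h]; exact leaves_pos _

mutual
/-- Reduced trees: all vertices have at least two inputs. -/
def Red : Tr → Prop
  | .node l => l.length ≠ 1 ∧ RedL l
/-- Forests of reduced trees. -/
def RedL : List Tr → Prop
  | [] => True
  | t :: l => Red t ∧ RedL l
end

theorem red_node {l : List Tr} : Red (.node l) ↔ l.length ≠ 1 ∧ RedL l := by rw [Red]
@[simp] theorem redL_nil : RedL [] := by rw [RedL]; trivial
@[simp] theorem redL_cons {t : Tr} {l : List Tr} : RedL (t :: l) ↔ Red t ∧ RedL l := by rw [RedL]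
theorem red_leaf : Red leaf := by simp [leaf, red_node]

theorem redL_iff {l : List Tr} : RedL l ↔ ∀ t ∈ l, Red t := by
  induction l with
  | nil => simp
  | cons t l ih => simp [ih]

theorem redL_append {l l' : List Tr} : RedL (l ++ l') ↔ RedL l ∧ RedL l' := by
  simp only [redL_iff, List.mem_append, or_imp, forall_and]

end Tr

/-- The free associative algebra on planar trees: the linear combinations of planar forests,
multiplied by juxtaposition. -/
abbrev ForestAlg (𝕜 : Type u) [Field 𝕜] : Type u := MonoidAlgebra 𝕜 (FreeMonoid Tr)

namespace ForestAlg

variable {𝕜 : Type u} [Field 𝕜]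

/-- The basis element attached to a forest. -/
noncomputable def w (l : List Tr) : ForestAlg 𝕜 := MonoidAlgebra.of 𝕜 _ (FreeMonoid.ofList l)

theorem w_append (l l' : List Tr) : (w (l ++ l') : ForestAlg 𝕜) = w l * w l' := by
  rw [w, FreeMonoid.ofList_append, map_mul]; rfl

theorem w_cons (t : Tr) (l : List Tr) : (w (t :: l) : ForestAlg 𝕜) = w [t] * w l :=
  w_append [t] l

@[simp] theorem w_nil : (w [] : ForestAlg 𝕜) = 1 := map_one _

section Lin
variable {W : Type*} [AddCommGroup W] [Module 𝕜 W]

theorem ext_w {f g : ForestAlg 𝕜 →ₗ[𝕜] W} (h : ∀ l, f (w l) = g (w l)) : f = g := by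
  refine MonoidAlgebra.lhom_ext' fun l => LinearMap.ext_ring ?_
  exact h (FreeMonoid.toList l)

/-- The linear map with prescribed values on forests. -/
noncomputable def lin (φ : List Tr → W) : ForestAlg 𝕜 →ₗ[𝕜] W :=
  Finsupp.lsum 𝕜 (fun l => LinearMap.toSpanSingleton 𝕜 W (φ (FreeMonoid.toList l))) ∘ₗ
    (MonoidAlgebra.coeffLinearEquiv 𝕜).toLinearMap

@[simp] theorem lin_w (φ : List Tr → W) (l : List Tr) : lin (𝕜 := 𝕜) φ (w l) = φ l := by
  simp [lin, w]

end Lin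
end ForestAlg

/-! ### The deconcatenation coproduct and coderivations -/

namespace ForestAlg

variable {𝕜 : Type u} [Field 𝕜]

theorem rTensor_rTensor (f g : ForestAlg 𝕜 →ₗ[𝕜] ForestAlg 𝕜) (z : ForestAlg 𝕜 ⊗[𝕜] ForestAlg 𝕜) :
    f.rTensor (ForestAlg 𝕜) (g.rTensor _ z) = (f ∘ₗ g).rTensor _ z := by
  rw [LinearMap.rTensor_comp, LinearMap.comp_apply]

/-- Left multiplication by a tree. -/
noncomputable abbrev L (t : Tr) : ForestAlg 𝕜 →ₗ[𝕜] ForestAlg 𝕜 := LinearMap.mulLeft 𝕜 (w [t])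

/-- The values of the deconcatenation coproduct. -/
noncomputable def deconcat : List Tr → ForestAlg 𝕜 ⊗[𝕜] ForestAlg 𝕜
  | [] => 1 ⊗ₜ 1
  | t :: l => 1 ⊗ₜ w (t :: l) + (L t).rTensor _ (deconcat l)

/-- The deconcatenation coproduct, the sum of `v ⊗ w` over the decompositions `l = v ++ w`. -/
noncomputable def Δ : ForestAlg 𝕜 →ₗ[𝕜] ForestAlg 𝕜 ⊗[𝕜] ForestAlg 𝕜 := lin deconcat

theorem Δ_one : Δ (1 : ForestAlg 𝕜) = 1 ⊗ₜ 1 := by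
  rw [← w_nil, Δ, lin_w, deconcat, w_nil]

theorem Δ_mul (t : Tr) (x : ForestAlg 𝕜) :
    Δ (w [t] * x) = 1 ⊗ₜ (w [t] * x) + (L t).rTensor _ (Δ x) := by
  suffices h : Δ ∘ₗ L (𝕜 := 𝕜) t = TensorProduct.mk 𝕜 _ _ 1 ∘ₗ L t + (L t).rTensor _ ∘ₗ Δ from
    LinearMap.congr_fun h x
  refine ext_w fun l => ?_
  simp only [LinearMap.comp_apply, LinearMap.add_apply, LinearMap.mulLeft_apply, ← w_cons, Δ,
    lin_w, deconcat, TensorProduct.mk_apply]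

/-- The span of the trees. -/
noncomputable def trees : Submodule 𝕜 (ForestAlg 𝕜) := Submodule.span 𝕜 (Set.range fun t => w [t])

theorem w_mem_trees (t : Tr) : (w [t] : ForestAlg 𝕜) ∈ trees := Submodule.subset_span ⟨t, rfl⟩

theorem Δ_mul_of_mem {y : ForestAlg 𝕜} (hy : y ∈ trees) (x : ForestAlg 𝕜) :
    Δ (y * x) = 1 ⊗ₜ (y * x) + (LinearMap.mulLeft 𝕜 y).rTensor _ (Δ x) := by
  induction hy using Submodule.span_induction with
  | mem y h => obtain ⟨t, rfl⟩ := h; exact Δ_mul t x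
  | zero => simp
  | add y z _ _ hy hz =>
    have : LinearMap.mulLeft 𝕜 (y + z) = LinearMap.mulLeft 𝕜 y + LinearMap.mulLeft 𝕜 z :=
      LinearMap.ext fun v => add_mul y z v
    rw [add_mul, map_add, hy, hz, tmul_add, this, LinearMap.rTensor_add, LinearMap.add_apply]
    abel
  | smul c y _ hy =>
    have : LinearMap.mulLeft 𝕜 (c • y) = c • LinearMap.mulLeft 𝕜 y :=
      LinearMap.ext fun v => smul_mul_assoc c y v
    rw [smul_mul_assoc, map_smul, hy, this, LinearMap.rTensor_smul, LinearMap.smul_apply, tmul_smul,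
      smul_add]

/-- The operator `v ↦ M v` applied to an initial segment: the sum of `M(v) w` over the
decompositions `l = v ++ w`. -/
noncomputable def P (M : ForestAlg 𝕜 →ₗ[𝕜] ForestAlg 𝕜) : ForestAlg 𝕜 →ₗ[𝕜] ForestAlg 𝕜 :=
  LinearMap.mul' 𝕜 _ ∘ₗ M.rTensor _ ∘ₗ Δ

variable (M N : ForestAlg 𝕜 →ₗ[𝕜] ForestAlg 𝕜)

theorem P_one : P M 1 = M 1 := by simp [P, Δ_one]

theorem P_mul (t : Tr) (x : ForestAlg 𝕜) :
    P M (w [t] * x) = M 1 * (w [t] * x) + P (M ∘ₗ L t) x := by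
  simp only [P, LinearMap.comp_apply, Δ_mul, map_add, LinearMap.rTensor_tmul, LinearMap.mul'_apply]
  rw [← LinearMap.comp_apply (LinearMap.rTensor _ M), ← LinearMap.rTensor_comp]

theorem P_add : P (M + N) = P M + P N := by
  simp only [P, LinearMap.rTensor_add, LinearMap.add_comp, LinearMap.comp_add]

theorem P_zero : P (0 : ForestAlg 𝕜 →ₗ[𝕜] ForestAlg 𝕜) = 0 := by
  simp [P]

theorem P_w (l : List Tr) : P M (w l) =
    ∑ n ∈ Finset.range (l.length + 1), M (w (l.take n)) * w (l.drop n) := by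
  induction l generalizing M with
  | nil => simp [P_one]
  | cons t l ih =>
    rw [w_cons, P_mul, ih, List.length_cons, Finset.sum_range_succ' _ (l.length + 1), add_comm,
      ← w_cons]
    simp only [List.take_succ_cons, List.drop_succ_cons, List.take_zero, List.drop_zero,
      LinearMap.comp_apply, LinearMap.mulLeft_apply, ← w_cons, w_nil]

variable {M}

/-- `Δ P = (P ⊗ 1) Δ + 1 ⊗ P`, by coassociativity. -/
theorem Δ_P (hM : ∀ l, M (w l) ∈ trees) (x : ForestAlg 𝕜) :
    Δ (P M x) = (P M).rTensor _ (Δ x) + 1 ⊗ₜ P M x := by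
  suffices h : Δ ∘ₗ P M = (P M).rTensor _ ∘ₗ Δ + TensorProduct.mk 𝕜 _ _ 1 ∘ₗ P M from
    LinearMap.congr_fun h x
  refine ext_w fun l => ?_
  have h1 : ∀ M : ForestAlg 𝕜 →ₗ[𝕜] ForestAlg 𝕜, (∀ l, M (w l) ∈ trees) → M 1 ∈ trees :=
    fun M hM => by simpa using hM []
  simp only [LinearMap.comp_apply, LinearMap.add_apply, TensorProduct.mk_apply]
  induction l generalizing M with
  | nil =>
    have := Δ_mul_of_mem (h1 M hM) 1
    rw [mul_one] at this
    rw [w_nil, P_one, this, Δ_one, LinearMap.rTensor_tmul, LinearMap.rTensor_tmul, P_one]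
    simp [add_comm]
  | cons t l ih =>
    have hL : ∀ l, (M ∘ₗ L t) (w l) ∈ trees := fun l => by
      rw [LinearMap.comp_apply, LinearMap.mulLeft_apply, ← w_cons]; exact hM _
    have h2 : P M ∘ₗ L t = LinearMap.mulLeft 𝕜 (M 1) ∘ₗ L t + P (M ∘ₗ L t) := by
      refine LinearMap.ext fun x => ?_
      rw [LinearMap.comp_apply, LinearMap.mulLeft_apply, P_mul]; rfl
    rw [w_cons, P_mul, map_add, Δ_mul_of_mem (h1 M hM), ih hL, Δ_mul]
    simp only [map_add, LinearMap.rTensor_tmul, P_one, tmul_add, LinearMap.mulLeft_apply, mul_one,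
      rTensor_rTensor, h2, LinearMap.rTensor_add, LinearMap.add_apply]
    abel

/-- The sign operator: a forest is multiplied by the product of the signs of its trees. -/
noncomputable def σ : ForestAlg 𝕜 →ₗ[𝕜] ForestAlg 𝕜 := lin fun l => Tr.sgL 𝕜 l • w l

theorem σ_w (l : List Tr) : (σ (w l) : ForestAlg 𝕜) = Tr.sgL 𝕜 l • w l := lin_w _ _

theorem σ_one : (σ 1 : ForestAlg 𝕜) = 1 := by rw [← w_nil, σ_w]; simp

theorem σ_mul (t : Tr) (x : ForestAlg 𝕜) : σ (w [t] * x) = Tr.sg 𝕜 t • (w [t] * σ x) := by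
  suffices h : σ ∘ₗ L (𝕜 := 𝕜) t = Tr.sg 𝕜 t • (L t ∘ₗ σ) from LinearMap.congr_fun h x
  refine ext_w fun l => ?_
  simp only [LinearMap.comp_apply, LinearMap.mulLeft_apply, ← w_cons, σ_w, Tr.sgL_cons,
    LinearMap.smul_apply, mul_smul, mul_smul_comm]

variable (M)

/-- The values of the coderivation `b` on forests. -/
noncomputable def bList : List Tr → ForestAlg 𝕜
  | [] => 0
  | t :: l => P M (w (t :: l)) + Tr.sg 𝕜 t • (w [t] * bList l)

/-- The coderivation with corestriction `M`: the signed sum of `u M(v) w` over the decompositions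
`l = u ++ v ++ w` with `v` nonempty. -/
noncomputable def b : ForestAlg 𝕜 →ₗ[𝕜] ForestAlg 𝕜 := lin (bList M)

theorem b_one : b M 1 = 0 := by rw [← w_nil, b, lin_w, bList]

theorem b_mul (t : Tr) (x : ForestAlg 𝕜) :
    b M (w [t] * x) = P M (w [t] * x) + Tr.sg 𝕜 t • (w [t] * b M x) := by
  suffices h : b M ∘ₗ L t = P M ∘ₗ L t + Tr.sg 𝕜 t • (L t ∘ₗ b M) from LinearMap.congr_fun h x
  refine ext_w fun l => ?_
  simp only [LinearMap.comp_apply, LinearMap.add_apply, LinearMap.smul_apply,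
    LinearMap.mulLeft_apply, ← w_cons, b, lin_w, bList]

theorem b_mul_of_mem {y : ForestAlg 𝕜} (hy : y ∈ trees) (x : ForestAlg 𝕜) :
    b M (y * x) = P M (y * x) + σ y * b M x := by
  induction hy using Submodule.span_induction with
  | mem y h => obtain ⟨t, rfl⟩ := h; rw [b_mul, σ_w]; simp
  | zero => simp
  | add y z _ _ hy hz => simp only [add_mul, map_add, hy, hz]; abel
  | smul c y _ hy => simp only [smul_mul_assoc, map_smul, hy, smul_add]

theorem b_add : b (M + N) = b M + b N := by
  refine ext_w fun l => ?_
  rw [LinearMap.add_apply]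
  induction l with
  | nil => simp [b_one]
  | cons t l ih =>
    rw [w_cons, b_mul, b_mul, b_mul, P_add, ih]
    simp only [LinearMap.add_apply, mul_add, smul_add]
    abel

theorem b_w (l : List Tr) : b M (w l) = ∑ i ∈ Finset.range l.length,
    Tr.sgL 𝕜 (l.take i) • (w (l.take i) * P M (w (l.drop i))) := by
  induction l with
  | nil => simp [b_one]
  | cons t l ih =>
    rw [w_cons, b_mul, ih, List.length_cons, Finset.sum_range_succ', add_comm, Finset.mul_sum,
      Finset.smul_sum]
    simp only [List.take_succ_cons, List.drop_succ_cons, List.take_zero, List.drop_zero,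
      Tr.sgL_nil, Tr.sgL_cons, one_smul, w_nil, one_mul, w_cons t (List.take _ _), mul_smul,
      mul_smul_comm, mul_assoc]
    rw [← w_cons]

variable {M}

/-- `b` is a coderivation. -/
theorem Δ_b (hM : ∀ l, M (w l) ∈ trees) (h0 : M 1 = 0) (x : ForestAlg 𝕜) :
    Δ (b M x) = (b M).rTensor _ (Δ x) + TensorProduct.map σ (b M) (Δ x) := by
  suffices h : Δ ∘ₗ b M = (b M).rTensor _ ∘ₗ Δ + TensorProduct.map σ (b M) ∘ₗ Δ from
    LinearMap.congr_fun h x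
  refine ext_w fun l => ?_
  simp only [LinearMap.comp_apply, LinearMap.add_apply]
  induction l with
  | nil => simp [b_one, Δ_one]
  | cons t l ih =>
    have h1 : b M ∘ₗ L t = P M ∘ₗ L t + Tr.sg 𝕜 t • (L t ∘ₗ b M) :=
      LinearMap.ext fun x => b_mul M t x
    have h2 : ∀ z : ForestAlg 𝕜 ⊗[𝕜] ForestAlg 𝕜, TensorProduct.map σ (b M) ((L t).rTensor _ z) =
        Tr.sg 𝕜 t • (L t).rTensor _ (TensorProduct.map σ (b M) z) := by
      intro z
      induction z using TensorProduct.induction_on with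
      | zero => simp
      | tmul x y =>
        simp only [LinearMap.rTensor_tmul, TensorProduct.map_tmul, LinearMap.mulLeft_apply, σ_mul,
          smul_tmul']
      | add y z hy hz => simp only [map_add, hy, hz, smul_add]
    rw [w_cons, b_mul, map_add, Δ_P hM, map_smul, Δ_mul t (b M (w l)), ih, Δ_mul]
    simp only [map_add, LinearMap.rTensor_tmul, P_one, b_one, b_mul, rTensor_rTensor, h1, h2,
      LinearMap.rTensor_add, LinearMap.rTensor_smul, tmul_smul, LinearMap.add_apply,
      LinearMap.smul_apply, TensorProduct.map_tmul, tmul_add, smul_add, σ_one, zero_tmul, zero_add,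
      h0]
    abel

theorem map_mem_trees (hM : ∀ l, M (w l) ∈ trees) (x : ForestAlg 𝕜) : M x ∈ trees := by
  have h : trees.mkQ ∘ₗ M = 0 := ext_w fun l => by simpa using hM l
  simpa using LinearMap.congr_fun h x

/-- Applying `b` after `P`: the second application of `M` either involves the tree produced by the
first one, or it takes place on its right. -/
theorem b_P (hM : ∀ l, M (w l) ∈ trees) (hσ : ∀ x, σ (M x) = - M (σ x)) (x : ForestAlg 𝕜) :
    b M (P M x) = P M (P M x) -
      LinearMap.mul' 𝕜 _ (TensorProduct.map (M ∘ₗ σ) (b M) (Δ x)) := by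
  have h : ∀ z : ForestAlg 𝕜 ⊗[𝕜] ForestAlg 𝕜,
      b M (LinearMap.mul' 𝕜 _ (M.rTensor _ z)) = P M (LinearMap.mul' 𝕜 _ (M.rTensor _ z)) -
        LinearMap.mul' 𝕜 _ (TensorProduct.map (M ∘ₗ σ) (b M) z) := by
    intro z
    induction z using TensorProduct.induction_on with
    | zero => simp
    | tmul x y =>
      rw [LinearMap.rTensor_tmul, LinearMap.mul'_apply, b_mul_of_mem M (map_mem_trees hM x), hσ]
      simp [sub_eq_add_neg]
    | add y z hy hz => simp only [map_add, hy, hz]; abel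
  exact h (Δ x)

theorem rTensor_Δ_eq_zero {l : List Tr} (N : ForestAlg 𝕜 →ₗ[𝕜] ForestAlg 𝕜)
    (h : ∀ v, v <+: l → N (w v) = 0) : N.rTensor (ForestAlg 𝕜) (Δ (w l)) = 0 := by
  induction l generalizing N with
  | nil =>
    have := h [] List.prefix_rfl
    rw [w_nil] at this
    rw [w_nil, Δ_one, LinearMap.rTensor_tmul, this, zero_tmul]
  | cons t l ih =>
    have := h [] (List.nil_prefix)
    rw [w_nil] at this
    rw [w_cons, Δ_mul, map_add, rTensor_rTensor, LinearMap.rTensor_tmul, this, zero_tmul, zero_add]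
    refine ih _ fun v hv => ?_
    rw [LinearMap.comp_apply, LinearMap.mulLeft_apply, ← w_cons]
    exact h _ ((List.prefix_cons_inj t).2 hv)

/-- The square of the coderivation `b` vanishes on a forest if its corestriction `M b` vanishes on
all the infixes: the terms in which the two applications of `M` are disjoint cancel, because `M` is
odd. -/
theorem b_b (hM : ∀ l, M (w l) ∈ trees) (h0 : M 1 = 0)
    (hσ : ∀ x, σ (M x) = - M (σ x)) {l : List Tr}
    (hl : ∀ v, v <:+: l → M (b M (w v)) = 0) : b M (b M (w l)) = 0 := by
  induction l with
  | nil => simp [b_one]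
  | cons t l ih =>
    have h1 : P M (b M (w (t :: l))) =
        LinearMap.mul' 𝕜 _ (TensorProduct.map (M ∘ₗ σ) (b M) (Δ (w (t :: l)))) := by
      rw [P, LinearMap.comp_apply, LinearMap.comp_apply, Δ_b hM h0, map_add, rTensor_rTensor,
        rTensor_Δ_eq_zero _ fun v hv => hl v hv.isInfix, zero_add, LinearMap.rTensor,
        ← LinearMap.comp_apply (TensorProduct.map M _), ← TensorProduct.map_comp,
        LinearMap.id_comp]
    have h2 := b_P hM hσ (w (t :: l))
    rw [← h1] at h2
    have h3 := ih fun v hv => hl v (hv.trans (List.suffix_cons t l).isInfix)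
    have h4 := b_mul M t (w l)
    rw [← w_cons] at h4
    rw [h4, map_add, h2, h4, map_add, map_smul, map_smul, b_mul, h3]
    simp

end ForestAlg

/-! ### The differential on planar trees -/

namespace ForestAlg

variable {𝕜 : Type u} [Field 𝕜]

/-- The span of a set of forests. -/
noncomputable def fs (A : Set (List Tr)) : Submodule 𝕜 (ForestAlg 𝕜) := Submodule.span 𝕜 (w '' A)

theorem w_mem_fs {A : Set (List Tr)} {l : List Tr} (h : l ∈ A) : (w l : ForestAlg 𝕜) ∈ fs A :=
  Submodule.subset_span ⟨l, h, rfl⟩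

theorem fs_mono {A B : Set (List Tr)} (h : A ⊆ B) : (fs A : Submodule 𝕜 (ForestAlg 𝕜)) ≤ fs B :=
  Submodule.span_mono (Set.image_mono h)

theorem map_mem_of_fs {A : Set (List Tr)} {W : Type*} [AddCommGroup W] [Module 𝕜 W]
    (f : ForestAlg 𝕜 →ₗ[𝕜] W) {U : Submodule 𝕜 W} (h : ∀ l ∈ A, f (w l) ∈ U) {x : ForestAlg 𝕜}
    (hx : x ∈ fs A) : f x ∈ U := by
  have : fs A ≤ U.comap f := Submodule.span_le.2 (by rintro _ ⟨l, hl, rfl⟩; exact h l hl)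
  exact this hx

theorem eq_of_fs {A : Set (List Tr)} {W : Type*} [AddCommGroup W] [Module 𝕜 W]
    (f g : ForestAlg 𝕜 →ₗ[𝕜] W) (h : ∀ l ∈ A, f (w l) = g (w l)) {x : ForestAlg 𝕜}
    (hx : x ∈ fs A) : f x = g x := by
  have := map_mem_of_fs (f - g) (U := ⊥) (fun l hl => by simp [h l hl]) hx
  simpa [sub_eq_zero] using this

theorem mul_mem_fs {A B C : Set (List Tr)} (h : ∀ a ∈ A, ∀ b ∈ B, a ++ b ∈ C) {x y : ForestAlg 𝕜}
    (hx : x ∈ fs A) (hy : y ∈ fs B) : x * y ∈ fs C := by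
  have := Submodule.mul_mem_mul hx hy
  rw [fs, fs, Submodule.span_mul_span] at this
  refine Submodule.span_mono ?_ this
  rintro _ ⟨_, ⟨a, ha, rfl⟩, _, ⟨b, hb, rfl⟩, rfl⟩
  exact ⟨a ++ b, h a ha b hb, w_append a b⟩

/-- Grafting the trees of a forest to a new root. -/
noncomputable def nd : ForestAlg 𝕜 →ₗ[𝕜] ForestAlg 𝕜 := lin fun l => w [.node l]

theorem nd_w (l : List Tr) : (nd (w l) : ForestAlg 𝕜) = w [.node l] := lin_w _ _

/-- Grafting the trees of a forest of length at least two to a new root. -/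
noncomputable def nd₂ : ForestAlg 𝕜 →ₗ[𝕜] ForestAlg 𝕜 :=
  lin fun l => if 2 ≤ l.length then w [.node l] else 0

theorem nd₂_w (l : List Tr) :
    (nd₂ (w l) : ForestAlg 𝕜) = if 2 ≤ l.length then w [.node l] else 0 := lin_w _ _

variable (𝕜)

mutual
/-- The values of the differential on trees: minus the signed sum of the trees obtained by grafting
several consecutive, but not all subtrees of the root to a new vertex, or by applying the
differential to a subtree of the root. -/
noncomputable def dTree : Tr → ForestAlg 𝕜
  | .node l => if 2 ≤ l.length then - nd (dList l + (b nd₂ (w l) - nd₂ (w l))) else 0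
/-- The extension of the differential to forests as a derivation. -/
noncomputable def dList : List Tr → ForestAlg 𝕜
  | [] => 0
  | t :: l => dTree t * w l + Tr.sg 𝕜 t • (w [t] * dList l)
end

variable {𝕜}

/-- The differential on trees, extended by zero to the other forests. -/
noncomputable def d : ForestAlg 𝕜 →ₗ[𝕜] ForestAlg 𝕜 :=
  lin fun | [t] => dTree 𝕜 t | _ => 0

theorem d_tree (t : Tr) : d (w [t]) = dTree 𝕜 t := lin_w _ _

theorem d_of_length {l : List Tr} (h : l.length ≠ 1) : d (w l) = (0 : ForestAlg 𝕜) := by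
  rw [d, lin_w]
  match l, h with
  | [], _ => rfl
  | [_], h => exact absurd rfl h
  | _ :: _ :: _, _ => rfl

theorem d_one : d 1 = (0 : ForestAlg 𝕜) := by
  rw [← w_nil]; exact d_of_length (by simp)

theorem P_of_vanish {M : ForestAlg 𝕜 →ₗ[𝕜] ForestAlg 𝕜} (h : ∀ t l, M (w (t :: l)) = 0)
    (x : ForestAlg 𝕜) : P M x = M 1 * x := by
  have : P M = LinearMap.mulLeft 𝕜 (M 1) := by
    refine ext_w fun l => ?_
    cases l with
    | nil => simp [P_one]
    | cons t l =>
      have h0 : M ∘ₗ L t = 0 := ext_w fun l => by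
        rw [LinearMap.comp_apply, LinearMap.mulLeft_apply, ← w_cons, h]; rfl
      rw [w_cons, P_mul, h0, P_zero]; simp
  rw [this]; rfl

theorem dList_eq (l : List Tr) : dList 𝕜 l = b d (w l) := by
  induction l with
  | nil => rw [w_nil, b_one, dList]
  | cons t l ih =>
    rw [dList, w_cons t l, b_mul, ih, P_mul, d_one, zero_mul, zero_add, P_of_vanish]
    · simp [d_tree]
    · intro s l
      rw [LinearMap.comp_apply, LinearMap.mulLeft_apply, ← w_cons]
      exact d_of_length (by simp)

/-- The corestriction of the coderivation `b M` encoding the differential. -/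
noncomputable def M : ForestAlg 𝕜 →ₗ[𝕜] ForestAlg 𝕜 := nd₂ + d

theorem M_tree (t : Tr) : M (w [t]) = dTree 𝕜 t := by
  rw [M, LinearMap.add_apply, nd₂_w, d_tree, if_neg (by simp), zero_add]

theorem M_of_two_le {l : List Tr} (h : 2 ≤ l.length) : (M (w l) : ForestAlg 𝕜) = w [.node l] := by
  rw [M, LinearMap.add_apply, nd₂_w, d_of_length (by omega), if_pos h, add_zero]

theorem M_one : M 1 = (0 : ForestAlg 𝕜) := by
  rw [M, LinearMap.add_apply, d_one, ← w_nil, nd₂_w, if_neg (by simp), add_zero]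

theorem dTree_node {l : List Tr} (h : 2 ≤ l.length) :
    dTree 𝕜 (.node l) = - nd (b M (w l) - M (w l)) := by
  rw [dTree, if_pos h, dList_eq, M, b_add, LinearMap.add_apply, LinearMap.add_apply,
    d_of_length (l := l) (by omega)]
  congr 2
  abel

theorem dTree_leaf : dTree 𝕜 .leaf = 0 := by
  rw [Tr.leaf, dTree, if_neg (by simp)]

/-- The relation between a forest `l` and the forests occurring in `b l`. -/
structure Bd (𝕜 : Type u) [Field 𝕜] (l u : List Tr) : Prop where
  sgL : Tr.sgL 𝕜 u = - Tr.sgL 𝕜 l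
  leavesL : Tr.leavesL u = Tr.leavesL l
  redL : Tr.RedL l → Tr.RedL u

theorem Bd.append {v u : List Tr} (h : Bd 𝕜 v u) (a c : List Tr) :
    Bd 𝕜 (a ++ v ++ c) (a ++ u ++ c) where
  sgL := by simp only [Tr.sgL_append, h.sgL]; ring
  leavesL := by simp only [Tr.leavesL_append, h.leavesL]
  redL := by simp only [Tr.redL_append]; exact fun hr => ⟨⟨hr.1.1, h.redL hr.1.2⟩, hr.2⟩

theorem Bd.node {l : List Tr} (h : 2 ≤ l.length) : Bd 𝕜 l [.node l] where
  sgL := by simp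
  leavesL := by
    rw [Tr.leavesL_cons, Tr.leaves_node (by rintro rfl; simp at h), Tr.leavesL_nil, add_zero]
  redL hr := by
    simp only [Tr.redL_cons, Tr.red_node, Tr.redL_nil, and_true]
    exact ⟨by omega, hr⟩

theorem Bd.node_of {l u : List Tr} (hl : 2 ≤ l.length) (hu : 2 ≤ u.length) (h : Bd 𝕜 l u) :
    Bd 𝕜 [.node l] [.node u] where
  sgL := by simp [h.sgL]
  leavesL := by
    have h1 : l ≠ [] := by rintro rfl; simp at hl
    have h2 : u ≠ [] := by rintro rfl; simp at hu
    simp only [Tr.leavesL_cons, Tr.leaves_node h1, Tr.leaves_node h2, h.leavesL]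
  redL := by
    simp only [Tr.redL_cons, Tr.red_node, Tr.redL_nil, and_true]
    exact fun hr => ⟨by omega, h.redL hr.2⟩

theorem P_sub (N : ForestAlg 𝕜 →ₗ[𝕜] ForestAlg 𝕜) (l : List Tr) : P N (w l) - N (w l) =
    ∑ n ∈ Finset.range l.length, N (w (l.take n)) * w (l.drop n) := by
  rw [P_w, Finset.sum_range_succ]
  simp

/-- `M` maps the infixes of `l` to trees with the expected invariants. -/
def Good (𝕜 : Type u) [Field 𝕜] (l : List Tr) : Prop :=
  ∀ v, v <:+: l → M (w v) ∈ fs (𝕜 := 𝕜) {u | ∃ s, u = [s] ∧ Bd 𝕜 v u}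

theorem Good.infix {l v : List Tr} (h : Good 𝕜 l) (hv : v <:+: l) : Good 𝕜 v :=
  fun _ hu => h _ (hu.trans hv)

/-- The terms of `b l` other than the full contraction are forests of length at least two. -/
theorem b_sub_mem {l : List Tr} (hl : Good 𝕜 l) :
    (b M (w l) - M (w l) : ForestAlg 𝕜) ∈ fs {u | 2 ≤ u.length ∧ Bd 𝕜 l u} := by
  induction l with
  | nil => simp [b_one, M_one]
  | cons t l ih =>
    have hl' : Good 𝕜 l := hl.infix (List.suffix_cons t l).isInfix
    have h1 : (b M (w (t :: l)) - M (w (t :: l)) : ForestAlg 𝕜) =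
        (P M (w (t :: l)) - M (w (t :: l))) + Tr.sg 𝕜 t • (w [t] * b M (w l)) := by
      rw [w_cons t l, b_mul]; abel
    rw [h1]
    refine add_mem ?_ (Submodule.smul_mem _ _ ?_)
    · rw [P_sub]
      refine Submodule.sum_mem _ fun n hn => ?_
      rw [Finset.mem_range] at hn
      rcases n with _ | n
      · rw [List.take_zero, w_nil, M_one, zero_mul]; exact zero_mem _
      · refine mul_mem_fs (B := {(t :: l).drop (n + 1)}) ?_ (hl _ (List.take_prefix _ _).isInfix)
          (w_mem_fs rfl)
        rintro _ ⟨s, rfl, hs⟩ _ rfl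
        refine ⟨?_, ?_⟩
        · simp only [List.length_append, List.length_drop, List.length_cons] at hn ⊢
          simp only [List.length_nil]
          omega
        · have := hs.append [] ((t :: l).drop (n + 1))
          rwa [List.nil_append, List.nil_append, List.take_append_drop] at this
    · cases l with
      | nil => rw [w_nil, b_one, mul_zero]; exact zero_mem _
      | cons t' l =>
        refine mul_mem_fs (A := {[t]}) (B := {u | 1 ≤ u.length ∧ Bd 𝕜 (t' :: l) u}) ?_
          (w_mem_fs rfl) ?_
        · rintro _ rfl u ⟨hu, hu'⟩
          refine ⟨by simpa using hu, ?_⟩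
          simpa using hu'.append [t] []
        · rw [← sub_add_cancel (b M (w (t' :: l))) (M (w (t' :: l)))]
          refine add_mem (fs_mono ?_ (ih hl')) (fs_mono ?_ (hl' _ List.infix_rfl))
          · exact fun u hu => ⟨one_le_two.trans hu.1, hu.2⟩
          · rintro _ ⟨s, rfl, hs⟩
            exact ⟨le_rfl, hs⟩

theorem good_of_forall {l : List Tr}
    (h : ∀ t ∈ l, dTree 𝕜 t ∈ fs (𝕜 := 𝕜) {u | ∃ s, u = [s] ∧ Bd 𝕜 [t] u}) : Good 𝕜 l := by
  intro v hv
  match v, hv with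
  | [], _ => rw [w_nil, M_one]; exact zero_mem _
  | [t], hv => rw [M_tree]; exact h t (hv.subset (by simp))
  | t :: t' :: v, _ =>
    rw [M_of_two_le (by simp)]
    exact w_mem_fs ⟨_, rfl, .node (by simp)⟩

/-- The differential of a tree is a combination of trees of the opposite sign, with the same number
of leaves; it preserves reduced trees. -/
theorem dTree_mem (t : Tr) : dTree 𝕜 t ∈ fs (𝕜 := 𝕜) {u | ∃ s, u = [s] ∧ Bd 𝕜 [t] u} := by
  induction t using Tr.ind with
  | h l ih =>
    by_cases hl : 2 ≤ l.length
    · rw [dTree_node hl]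
      refine neg_mem (map_mem_of_fs nd ?_ (b_sub_mem (good_of_forall ih)))
      rintro u ⟨hu, hb⟩
      rw [nd_w]
      exact w_mem_fs ⟨_, rfl, hb.node_of hl hu⟩
    · rw [dTree, if_neg hl]; exact zero_mem _

theorem good (l : List Tr) : Good 𝕜 l := good_of_forall fun t _ => dTree_mem t

theorem M_mem_trees (l : List Tr) : (M (w l) : ForestAlg 𝕜) ∈ trees := by
  refine map_mem_of_fs LinearMap.id (fun u hu => ?_) (good l l List.infix_rfl)
  obtain ⟨s, rfl, _⟩ := hu
  exact w_mem_trees s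

/-- The operator `M` is odd. -/
theorem σ_M (x : ForestAlg 𝕜) : σ (M x) = - M (σ x) := by
  suffices h : σ ∘ₗ M = - (M ∘ₗ σ (𝕜 := 𝕜)) from LinearMap.congr_fun h x
  refine ext_w fun l => ?_
  have h := eq_of_fs σ (- (Tr.sgL 𝕜 l) • LinearMap.id) (fun u hu => ?_)
    (good (𝕜 := 𝕜) l l List.infix_rfl)
  · rw [LinearMap.comp_apply, h]
    simp [σ_w]
  · obtain ⟨s, rfl, hs⟩ := hu
    rw [σ_w, hs.sgL]
    rfl

/-- The equation `M b = 0`, read on forests of length at least two, is the recursive definition of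
the differential of the tree grafted from the forest. -/
theorem M_b_of_two_le {l : List Tr} (h : 2 ≤ l.length) : M (b M (w l)) = (0 : ForestAlg 𝕜) := by
  have h1 := b_sub_mem (good (𝕜 := 𝕜) l)
  have h2 : M (b M (w l) - M (w l)) = nd (b M (w l) - M (w l) : ForestAlg 𝕜) :=
    eq_of_fs M nd (fun _ hu => by rw [M_of_two_le hu.1, nd_w]) h1
  rw [map_sub, M_of_two_le h, M_tree, dTree_node h, M_of_two_le h, sub_neg_eq_add] at h2
  simpa using h2

theorem M_apply_of_mem_trees {x : ForestAlg 𝕜} (h : x ∈ trees) : M x = d x := by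
  induction h using Submodule.span_induction with
  | mem x h => obtain ⟨t, rfl⟩ := h; rw [M_tree, d_tree]
  | zero => simp
  | add x y _ _ hx hy => rw [map_add, map_add, hx, hy]
  | smul c x _ hx => rw [map_smul, map_smul, hx]

theorem b_apply_of_mem_trees {x : ForestAlg 𝕜} (h : x ∈ trees) : b M x = M x := by
  have := b_mul_of_mem M h 1
  rw [mul_one, b_one, mul_zero, add_zero] at this
  rw [this]
  have h1 := Δ_mul_of_mem h 1
  rw [mul_one, Δ_one, LinearMap.rTensor_tmul, LinearMap.mulLeft_apply, mul_one] at h1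
  simp [P, h1, M_one]

theorem dTree_mem_trees (t : Tr) : dTree 𝕜 t ∈ trees := by
  rw [← M_tree]; exact M_mem_trees _

/-- The differential squares to zero. For the tree with subtrees `l`, this is the equation
`b b = 0` on `l`; it follows from `M b = 0` on the infixes of `l`, which for single trees is the
induction hypothesis. -/
theorem d_dTree (t : Tr) : d (dTree 𝕜 t) = 0 := by
  induction t using Tr.ind with
  | h l ih =>
    by_cases hl : 2 ≤ l.length
    swap
    · rw [dTree, if_neg hl, map_zero]
    have hb : b M (b M (w l)) = (0 : ForestAlg 𝕜) := by
      refine b_b M_mem_trees M_one σ_M fun v hv => ?_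
      match v, hv with
      | [], _ => rw [w_nil, b_one, map_zero]
      | [t], hv =>
        rw [b_apply_of_mem_trees (w_mem_trees t), M_tree,
          M_apply_of_mem_trees (dTree_mem_trees t), ih t (hv.subset (by simp))]
      | t :: t' :: v, _ => exact M_b_of_two_le (by simp)
    have h1 : ∀ x ∈ fs (𝕜 := 𝕜) {u | 2 ≤ u.length ∧ Bd 𝕜 l u}, M (b M x) = 0 := fun _ hx =>
      eq_of_fs (M ∘ₗ b M) 0 (fun _ hu => by
        rw [LinearMap.comp_apply, M_b_of_two_le hu.1, LinearMap.zero_apply]) hx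
    have h2 := h1 _ (b_sub_mem (good l))
    rw [map_sub, hb, zero_sub, map_neg, neg_eq_zero, M_of_two_le hl,
      b_apply_of_mem_trees (w_mem_trees _), M_tree, M_apply_of_mem_trees (dTree_mem_trees _)] at h2
    exact h2

end ForestAlg

/-! ### The augmentation and the matching of planar trees -/

namespace Tr

section
variable (𝕜 : Type u) [Field 𝕜]

/-- The augmentation: it is nonzero exactly on binary trees, where its value is a sign. -/
def aug : Tr → 𝕜
  | .node [] => 1
  | .node [x, y] => - (aug x * aug y)
  | .node _ => 0

theorem aug_leaf : aug 𝕜 leaf = 1 := by rw [leaf, aug]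
theorem aug_two (x y : Tr) : aug 𝕜 (.node [x, y]) = - (aug 𝕜 x * aug 𝕜 y) := by rw [aug]
theorem aug_of_three_le {l : List Tr} (h : 3 ≤ l.length) : aug 𝕜 (.node l) = 0 := by
  match l, h with
  | _ :: _ :: _ :: _, _ => rw [aug] <;> simp

theorem sg_of_aug {t : Tr} (h : aug 𝕜 t ≠ 0) : sg 𝕜 t = -1 := by
  induction t using ind with
  | h l ih =>
    match l, ih, h with
    | [], _, _ => simp
    | [x], _, h => exact absurd (by rw [aug] <;> simp) h
    | [x, y], ih, h =>
      rw [aug_two, neg_ne_zero] at h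
      rw [sg_node, sgL_cons, sgL_cons, ih x (by simp) (left_ne_zero_of_mul h),
        ih y (by simp) (right_ne_zero_of_mul h)]
      simp
    | x :: y :: z :: l, _, h => exact absurd (aug_of_three_le 𝕜 (by simp)) h

end

/-- The trees which are matched with a tree of higher degree: descending along the left edges as
long as the right subtree is trivial, one arrives at a binary vertex with nontrivial right
subtree. -/
def IsLower : Tr → Prop
  | .node [t, .node []] => IsLower t
  | .node [_, .node (_ :: _)] => True
  | .node _ => False

/-- The rank along which the matching is triangular: descending along the left edges as
long as the right subtree is trivial, the sum of the numbers of leaves of the left subtrees. -/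
def rk : Tr → ℕ
  | .node [t, .node []] => leaves t + rk t
  | .node (t :: _) => leaves t
  | .node [] => 0

/-- The left combs. -/
def comb : ℕ → Tr
  | 0 => leaf
  | n + 1 => .node [comb n, leaf]

theorem isLower_leaf_iff (t : Tr) : IsLower (.node [t, leaf]) ↔ IsLower t := by rw [leaf, IsLower]
theorem isLower_cons (t x : Tr) (l : List Tr) : IsLower (.node [t, .node (x :: l)]) := by
  rw [IsLower]; trivial
theorem not_isLower_leaf : ¬ IsLower leaf := by rw [leaf, IsLower] <;> simp
theorem not_isLower_of_three_le {l : List Tr} (h : 3 ≤ l.length) : ¬ IsLower (.node l) := by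
  match l, h with
  | _ :: _ :: _ :: _, _ => rw [IsLower] <;> simp
theorem rk_leaf (t : Tr) : rk (.node [t, leaf]) = leaves t + rk t := by rw [leaf, rk]
theorem rk_cons (t x : Tr) (l : List Tr) : rk (.node [t, .node (x :: l)]) = leaves t := by
  rw [rk]; simp
theorem rk_of_two_le {t : Tr} {l : List Tr} (h : 2 ≤ l.length) :
    rk (.node (t :: l)) = leaves t := by
  match l, h with
  | _ :: _ :: _, _ => rw [rk]; simp

theorem leaves_comb (n : ℕ) : leaves (comb n) = n + 1 := by
  induction n with
  | zero => simp [comb]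
  | succ n ih => rw [comb, leaves_node (by simp)]; simp [ih]

theorem red_comb (n : ℕ) : Red (comb n) := by
  induction n with
  | zero => exact red_leaf
  | succ n ih => rw [comb, red_node]; simp [ih, red_leaf]

theorem leaves_le_rk (t : Tr) {l : List Tr} (h : l ≠ []) : leaves t ≤ rk (.node (t :: l)) := by
  match l, h with
  | [.node []], _ => rw [rk]; omega
  | [.node (x :: r)], _ => rw [rk_cons]
  | _ :: _ :: _, _ => rw [rk_of_two_le (by simp)]

/-- Case analysis on reduced trees. -/
theorem red_cases {p : Tr → Prop} (h0 : p leaf) (h1 : ∀ t, Red t → p t → p (.node [t, leaf]))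
    (h2 : ∀ t l, Red t → RedL l → 2 ≤ l.length → p (.node [t, .node l]))
    (h3 : ∀ t l, Red t → RedL l → 2 ≤ l.length → p (.node (t :: l)))
    {t : Tr} (ht : Red t) : p t := by
  induction t using ind with
  | h l ih =>
    match l, ih, ht with
    | [], _, _ => exact h0
    | [x], _, ht => simp [red_node] at ht
    | [x, .node []], ih, ht =>
      simp only [red_node, redL_cons] at ht
      exact h1 x ht.2.1 (ih x (by simp) ht.2.1)
    | [x, .node [y]], _, ht => simp [red_node] at ht
    | [x, .node (y :: z :: l)], _, ht =>
      simp only [red_node, redL_cons] at ht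
      exact h2 x _ ht.2.1 (by simpa using ht.2.2.1.2) (by simp)
    | x :: y :: z :: l, _, ht =>
      rw [red_node, redL_cons] at ht
      exact h3 x _ ht.2.1 ht.2.2 (by simp)

theorem rk_le {t : Tr} (ht : Red t) : rk t ≤ leaves t ^ 2 := by
  have key : ∀ (t : Tr) (l : List Tr), l ≠ [] → leaves t ≤ leaves (.node (t :: l)) ^ 2 := by
    intro t l h
    rw [leaves_node (by simp), leavesL_cons]
    have := leaves_pos t
    nlinarith [Nat.zero_le (leavesL l), Nat.zero_le (leaves t * leavesL l)]
  refine red_cases (p := fun t => rk t ≤ leaves t ^ 2) ?_ ?_ ?_ ?_ ht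
  · simp [leaf, rk]
  · intro t _ ih
    rw [rk_leaf, leaves_node (by simp)]
    simp only [leavesL_cons, leavesL_nil, leaves_leaf]
    nlinarith
  · intro t l _ _ hl
    match l, hl with
    | x :: l, _ => rw [rk_cons]; exact key _ _ (by simp)
  · intro t l _ _ hl
    rw [rk_of_two_le hl]
    exact key _ _ (by rintro rfl; simp at hl)

end Tr

namespace ForestAlg

open Tr

variable {𝕜 : Type u} [Field 𝕜]

theorem b_sub_cons (t : Tr) (l : List Tr) : (b M (w (t :: l)) - M (w (t :: l)) : ForestAlg 𝕜) =
    ∑ n ∈ Finset.range (l.length + 1), M (w ((t :: l).take n)) * w ((t :: l).drop n) +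
      Tr.sg 𝕜 t • (w [t] * M (w l)) + Tr.sg 𝕜 t • (w [t] * (b M (w l) - M (w l))) := by
  have h := P_sub (𝕜 := 𝕜) M (t :: l)
  rw [List.length_cons] at h
  rw [← h, mul_sub, smul_sub, w_cons t l, b_mul]
  abel

/-- The augmentation, extended by zero to the forests which are not trees. -/
noncomputable def augL : ForestAlg 𝕜 →ₗ[𝕜] 𝕜 := lin fun | [t] => Tr.aug 𝕜 t | _ => 0

theorem augL_tree (t : Tr) : augL (w [t]) = Tr.aug 𝕜 t := lin_w _ _

theorem augL_nd_of_three_le {A : Set (List Tr)} (hA : ∀ u ∈ A, 3 ≤ u.length) {x : ForestAlg 𝕜}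
    (hx : x ∈ fs A) : augL (nd x) = 0 :=
  eq_of_fs (augL ∘ₗ nd) 0 (fun u hu => by
    rw [LinearMap.comp_apply, nd_w, augL_tree, aug_of_three_le 𝕜 (hA u hu),
      LinearMap.zero_apply]) hx

theorem augL_nd_mul {x y : ForestAlg 𝕜} (hx : x ∈ trees) (hy : y ∈ trees) :
    augL (nd (x * y)) = - (augL x * augL y) := by
  induction hx using Submodule.span_induction with
  | mem x h =>
    obtain ⟨t, rfl⟩ := h
    induction hy using Submodule.span_induction with
    | mem y h => obtain ⟨s, rfl⟩ := h; rw [← w_cons, nd_w, augL_tree, aug_two, augL_tree, augL_tree]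
    | zero => simp
    | add y z _ _ hy hz => rw [mul_add, map_add, map_add, hy, hz, map_add]; ring
    | smul c y _ hy =>
      rw [mul_smul_comm, map_smul, map_smul, hy, map_smul]; simp only [smul_eq_mul]; ring
  | zero => simp
  | add y z _ _ hy hz => rw [add_mul, map_add, map_add, hy, hz, map_add]; ring
  | smul c y _ hy =>
    rw [smul_mul_assoc, map_smul, map_smul, hy, map_smul]; simp only [smul_eq_mul]; ring

/-- The augmentation is a chain map. -/
theorem augL_dTree (t : Tr) : augL (dTree 𝕜 t) = 0 := by
  induction t using Tr.ind with
  | h l ih =>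
    by_cases hl : 2 ≤ l.length
    swap
    · rw [dTree, if_neg hl, map_zero]
    rw [dTree_node hl, map_neg, neg_eq_zero]
    have h3 : ∀ {x : ForestAlg 𝕜} {s r : Tr} {l : List Tr}, x ∈ trees →
        augL (nd (x * w (s :: r :: l))) = 0 := by
      intro x s r l hx
      refine augL_nd_of_three_le (A := {u | 3 ≤ u.length}) (fun u hu => hu) ?_
      refine mul_mem_fs (A := Set.range fun t => [t]) (B := {s :: r :: l}) ?_ ?_ (w_mem_fs rfl)
      · rintro _ ⟨t, rfl⟩ _ rfl
        simp
      · rw [fs, ← Set.range_comp]; exact hx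
    have h4 : ∀ (t : Tr) (l : List Tr),
        augL (nd (w [t] * (b M (w l) - M (w l)) : ForestAlg 𝕜)) = 0 := by
      intro t l
      refine augL_nd_of_three_le (A := {u | 3 ≤ u.length}) (fun u hu => hu) ?_
      refine mul_mem_fs (A := {[t]}) ?_ (w_mem_fs rfl) (b_sub_mem (good l))
      rintro _ rfl u hu
      have := hu.1
      simp only [Set.mem_ofPred_eq, List.length_append, List.length_cons, List.length_nil]
      omega
    -- If the root has four or more inputs, all terms keep a vertex with at least three inputs.
    match l, ih, hl with
    | [x, y], ih, _ =>
      have h5 : augL (nd (M (w [x]) * w [y] : ForestAlg 𝕜)) = 0 := by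
        rw [augL_nd_mul (M_mem_trees _) (w_mem_trees _), M_tree, ih x (by simp), zero_mul, neg_zero]
      rw [b_sub_cons, map_add, map_add, map_add, map_add, map_smul, map_smul, map_smul, map_smul,
        h4, augL_nd_mul (w_mem_trees _) (M_mem_trees _), M_tree, ih y (by simp)]
      simp only [List.length_cons, List.length_nil, Finset.sum_range_succ, Finset.sum_range_zero]
      simp [M_one, h5]
    | [x, y, z], ih, _ =>
      have h5 : augL (nd (M (w [x]) * w [y, z] : ForestAlg 𝕜)) = 0 := h3 (M_mem_trees _)
      have h6 : augL (nd (M (w [x, y]) * w [z] : ForestAlg 𝕜)) = aug 𝕜 x * aug 𝕜 y * aug 𝕜 z := by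
        rw [augL_nd_mul (M_mem_trees _) (w_mem_trees _), M_of_two_le (by simp), augL_tree,
          augL_tree, aug_two]
        ring
      rw [b_sub_cons, map_add, map_add, map_add, map_add, map_smul, map_smul, map_smul, map_smul,
        h4, augL_nd_mul (w_mem_trees _) (M_mem_trees _), M_of_two_le (by simp)]
      simp only [List.length_cons, List.length_nil, Finset.sum_range_succ, Finset.sum_range_zero]
      simp only [List.take_succ_cons, List.take_zero, w_nil, M_one, zero_mul, List.drop_zero,
        List.drop_succ_cons, zero_add, map_add, h5, h6, augL_tree, aug_two]
      by_cases hx : aug 𝕜 x = 0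
      · simp [hx]
      · rw [sg_of_aug 𝕜 hx]; simp; ring
    | x :: y :: z :: r :: l, ih, _ =>
      rw [b_sub_cons, map_add, map_add, map_add, map_add, map_smul, map_smul, map_smul, map_smul,
        h4, augL_nd_mul (w_mem_trees _) (M_mem_trees _), M_of_two_le (by simp), augL_tree, augL_tree,
        aug_of_three_le 𝕜 (by simp), map_sum, map_sum, Finset.sum_eq_zero]
      · simp
      intro n hn
      have hlen := List.length_drop (i := n) (l := x :: y :: z :: r :: l)
      have hn' := Finset.mem_range.1 hn
      match hd : (x :: y :: z :: r :: l).drop n with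
      | [] =>
        rw [hd] at hlen
        simp at hlen hn'
        omega
      | [s] =>
        rw [hd] at hlen
        rw [augL_nd_mul (M_mem_trees _) (w_mem_trees _), M_of_two_le, augL_tree, aug_of_three_le,
          zero_mul, neg_zero] <;>
        · rw [List.length_take]
          simp at hlen hn' ⊢
          omega
      | s :: s' :: l' => exact h3 (M_mem_trees _)

end ForestAlg

/-! ### Acyclicity of the complex of planar trees -/

namespace ForestAlg

open Tr

variable {𝕜 : Type u} [Field 𝕜]

variable (𝕜) in
/-- The homotopy on trees: the inverse of the matching, merging the two vertices at the end of the
left edges. -/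
noncomputable def hTree : Tr → ForestAlg 𝕜
  | .node [t, .node []] => - nd (hTree t * w [leaf])
  | .node [t, .node (x :: l)] => - (sg 𝕜 t • w [.node (t :: x :: l)])
  | .node _ => 0

theorem hTree_leaf (t : Tr) : hTree 𝕜 (.node [t, leaf]) = - nd (hTree 𝕜 t * w [leaf]) := by
  rw [leaf, hTree, leaf]

theorem hTree_node (t : Tr) {l : List Tr} (h : 2 ≤ l.length) :
    hTree 𝕜 (.node [t, .node l]) = - (sg 𝕜 t • w [.node (t :: l)]) := by
  match l, h with
  | x :: l, _ => rw [hTree]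

/-- The homotopy, extended by zero to the forests which are not trees. -/
noncomputable def htpy : ForestAlg 𝕜 →ₗ[𝕜] ForestAlg 𝕜 :=
  lin fun | [t] => hTree 𝕜 t | _ => 0

theorem htpy_tree (t : Tr) : htpy (w [t]) = hTree 𝕜 t := lin_w _ _

/-- The trees with a given property, as forests. -/
def single (p : Tr → Prop) : Set (List Tr) := {u | ∃ s, u = [s] ∧ p s}

theorem w_mem_single {p : Tr → Prop} {t : Tr} (h : p t) : (w [t] : ForestAlg 𝕜) ∈ fs (single p) :=
  w_mem_fs ⟨t, rfl, h⟩

theorem single_mono {p q : Tr → Prop} (h : ∀ t, p t → q t) : single p ⊆ single q := by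
  rintro _ ⟨s, rfl, hs⟩; exact ⟨s, rfl, h s hs⟩

/-- The reduced trees with `k` leaves. -/
def Ord (k : ℕ) (t : Tr) : Prop := Red t ∧ leaves t = k

/-- The reduced trees with `k` leaves which are either not lower ends of the matching or of rank
at least `m`. -/
def Low (k m : ℕ) (t : Tr) : Prop := Ord k t ∧ (IsLower t → m ≤ rk t)

/-- The upper ends of the matching of rank at least `m`. -/
def Up (k m : ℕ) (t : Tr) : Prop := Ord k t ∧ ¬ IsLower t ∧ (∀ n, t ≠ comb n) ∧ m ≤ rk t

theorem ord_node {t : Tr} {l : List Tr} (ht : Red t) (hl : RedL l) (h : l ≠ []) :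
    Ord (leaves t + leavesL l) (.node (t :: l)) :=
  ⟨by
    rw [red_node, redL_cons]
    exact ⟨by simpa using h, ht, hl⟩, by rw [leaves_node (by simp), leavesL_cons]⟩

theorem ord_node_node {t : Tr} {l : List Tr} (ht : Red t) (hl : RedL l) (h : 2 ≤ l.length) :
    Ord (leaves t + leavesL l) (.node [t, .node l]) := by
  have h' : l ≠ [] := by rintro rfl; simp at h
  refine ⟨?_, ?_⟩
  · simp only [red_node, redL_cons, redL_nil, and_true]
    exact ⟨by simp, ht, by omega, hl⟩
  · rw [leaves_node (by simp), leavesL_cons, leavesL_cons, leaves_node h', leavesL_nil, add_zero]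

theorem ord_leaf {t : Tr} {k : ℕ} (ht : Ord k t) : Ord (k + 1) (.node [t, leaf]) := by
  have := ord_node ht.1 (l := [leaf]) (by simp [red_leaf]) (by simp)
  rwa [ht.2, leavesL_cons, leaves_leaf, leavesL_nil] at this

theorem up_node {t : Tr} {l : List Tr} (ht : Red t) (hl : RedL l) (h : 2 ≤ l.length) :
    Up (leaves t + leavesL l) (leaves t) (.node (t :: l)) := by
  refine ⟨ord_node ht hl (by rintro rfl; simp at h),
    not_isLower_of_three_le (by simpa using h), ?_, ?_⟩
  · rintro (_ | n) hc
    · simp [comb, leaf] at hc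
    · simp only [comb, node.injEq, List.cons.injEq] at hc
      simp [hc.2] at h
  · rw [rk_of_two_le h]

theorem up_leaf {t : Tr} {k m : ℕ} (ht : Up k m t) : Up (k + 1) (k + m) (.node [t, leaf]) := by
  refine ⟨ord_leaf ht.1, by rw [isLower_leaf_iff]; exact ht.2.1, ?_, ?_⟩
  · rintro (_ | n) hc
    · simp [comb, leaf] at hc
    · simp only [comb, node.injEq, List.cons.injEq] at hc
      exact ht.2.2.1 n hc.1
  · rw [rk_leaf, ht.1.2]; exact Nat.add_le_add_left ht.2.2.2 _

theorem low_leaf {t : Tr} {k m : ℕ} (ht : Low k m t) : Low (k + 1) (k + m) (.node [t, leaf]) := by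
  refine ⟨ord_leaf ht.1, fun hB => ?_⟩
  rw [rk_leaf, ht.1.2]
  exact Nat.add_le_add_left (ht.2 ((isLower_leaf_iff t).1 hB)) _

theorem nd_mul_leaf_mem {p q : Tr → Prop} (hpq : ∀ t, p t → q (.node [t, leaf])) {x : ForestAlg 𝕜}
    (hx : x ∈ fs (single p)) : nd (x * w [leaf]) ∈ fs (𝕜 := 𝕜) (single q) := by
  refine map_mem_of_fs (nd ∘ₗ LinearMap.mulRight 𝕜 (w [leaf])) ?_ hx
  rintro _ ⟨t, rfl, ht⟩
  rw [LinearMap.comp_apply, LinearMap.mulRight_apply, ← w_cons, nd_w]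
  exact w_mem_single (hpq t ht)

theorem single_subset_trees (p : Tr → Prop) : fs (𝕜 := 𝕜) (single p) ≤ trees := by
  refine Submodule.span_le.2 ?_
  rintro _ ⟨_, ⟨s, rfl, _⟩, rfl⟩
  exact w_mem_trees s

theorem eq_on_trees {W : Type*} [AddCommGroup W] [Module 𝕜 W] {f g : ForestAlg 𝕜 →ₗ[𝕜] W}
    (hfg : ∀ t, f (w [t]) = g (w [t])) {x : ForestAlg 𝕜} (hx : x ∈ trees) : f x = g x := by
  refine eq_of_fs (A := single fun _ => True) f g ?_ ?_
  · rintro _ ⟨s, rfl, _⟩; exact hfg s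
  · refine Submodule.span_mono ?_ hx
    rintro _ ⟨t, rfl⟩
    exact ⟨[t], ⟨t, rfl, trivial⟩, rfl⟩

theorem dTree_mul_leaf (t : Tr) :
    dTree 𝕜 (.node [t, leaf]) = - nd (dTree 𝕜 t * w [leaf]) := by
  have hM : M (w [leaf]) = (0 : ForestAlg 𝕜) := by rw [M_tree, dTree_leaf]
  have hb : b M (w [leaf]) = (0 : ForestAlg 𝕜) := by
    rw [b_apply_of_mem_trees (w_mem_trees _), hM]
  rw [dTree_node (by simp), b_sub_cons, hM, hb]
  simp [Finset.sum_range_succ, M_one, M_tree]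

theorem d_nd_mul_leaf {x : ForestAlg 𝕜} (hx : x ∈ trees) :
    d (nd (x * w [leaf])) = - nd (d x * w [leaf]) := by
  refine eq_on_trees (f := d ∘ₗ nd ∘ₗ LinearMap.mulRight 𝕜 (w [leaf]))
    (g := - (nd ∘ₗ LinearMap.mulRight 𝕜 (w [leaf]) ∘ₗ d)) (fun t => ?_) hx
  simp only [LinearMap.comp_apply, LinearMap.mulRight_apply, LinearMap.neg_apply, ← w_cons, nd_w,
    d_tree, dTree_mul_leaf]

theorem htpy_nd_mul_leaf {x : ForestAlg 𝕜} (hx : x ∈ trees) :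
    htpy (nd (x * w [leaf])) = - nd (htpy x * w [leaf]) := by
  refine eq_on_trees (f := htpy ∘ₗ nd ∘ₗ LinearMap.mulRight 𝕜 (w [leaf]))
    (g := - (nd ∘ₗ LinearMap.mulRight 𝕜 (w [leaf]) ∘ₗ htpy)) (fun t => ?_) hx
  simp only [LinearMap.comp_apply, LinearMap.mulRight_apply, LinearMap.neg_apply, ← w_cons, nd_w,
    htpy_tree, hTree_leaf]

/-- The part of the differential of an upper tree which matters for the matching. -/
theorem dTree_add_mem {t : Tr} {l : List Tr} (ht : Red t) (hl : RedL l) (h2 : 2 ≤ l.length) :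
    dTree 𝕜 (.node (t :: l)) + sg 𝕜 t • w [.node [t, .node l]] ∈
      fs (single (Low (leaves t + leavesL l) (leaves t + 1))) := by
  let Q : Set (List Tr) := {u | RedL u ∧ leavesL u = leaves t + leavesL l ∧ (3 ≤ u.length ∨
    ∃ s y, u = [s, y] ∧ leaves t + 1 ≤ leaves s)}
  have hQ : ∀ x ∈ fs Q,
      nd x ∈ fs (𝕜 := 𝕜) (single (Low (leaves t + leavesL l) (leaves t + 1))) := by
    intro x hx
    refine map_mem_of_fs nd ?_ hx
    rintro u ⟨hu1, hu2, hu3⟩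
    rw [nd_w]
    have h2u : 2 ≤ u.length := by
      rcases hu3 with hu3 | ⟨s, y, rfl, _⟩
      · omega
      · simp
    refine w_mem_single ⟨⟨?_, ?_⟩, ?_⟩
    · rw [red_node]; exact ⟨by omega, hu1⟩
    · rw [leaves_node (by rintro rfl; simp at h2u), hu2]
    · rcases hu3 with hu3 | ⟨s, y, rfl, hs⟩
      · exact fun hB => absurd hB (not_isLower_of_three_le hu3)
      · exact fun _ => hs.trans (leaves_le_rk s (by simp))
  rw [dTree_node (by simp; omega), b_sub_cons, M_of_two_le h2, ← w_cons, map_add, map_add, map_smul,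
    map_smul, nd_w]
  have key : ∀ a b c : ForestAlg 𝕜, -(a + b + c) + b = -(a + c) := by intros; abel
  rw [key, ← map_smul, ← map_add, ← map_neg]
  refine hQ _ (neg_mem (add_mem (Submodule.sum_mem _ fun n hn => ?_) (Submodule.smul_mem _ _ ?_)))
  · rcases n with _ | n
    · rw [List.take_zero, w_nil, M_one, zero_mul]; exact zero_mem _
    refine mul_mem_fs (B := {(t :: l).drop (n + 1)}) ?_ (good _ _ List.infix_rfl) (w_mem_fs rfl)
    rintro _ ⟨s, rfl, hs⟩ _ rfl
    have hs' := hs.append [] ((t :: l).drop (n + 1))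
    rw [List.nil_append, List.nil_append, List.take_append_drop] at hs'
    refine ⟨hs'.redL (by simp [ht, hl]), by simpa using hs'.leavesL, ?_⟩
    have hn' := Finset.mem_range.1 hn
    match hd : (t :: l).drop (n + 1) with
    | [] => simp at hd; omega
    | [y] =>
      refine Or.inr ⟨s, y, rfl, ?_⟩
      have h3 : leaves s = leavesL ((t :: l).take (n + 1)) := by simpa using hs.leavesL
      have h4 : n ≠ 0 := by
        rintro rfl
        have := congrArg List.length hd
        simp at this
        omega
      have h5 : l.take n ≠ [] := by
        rw [Ne, List.take_eq_nil_iff]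
        rintro (h | rfl)
        · exact h4 h
        · simp at h2
      rw [h3, List.take_succ_cons, leavesL_cons]
      exact Nat.add_le_add_left (leavesL_pos h5) _
    | y :: z :: r => left; simp
  · have := M_of_two_le h2 (𝕜 := 𝕜)
    refine mul_mem_fs (A := {[t]}) ?_ (w_mem_fs rfl) (this ▸ b_sub_mem (good l))
    rintro _ rfl u ⟨hu1, hu2⟩
    refine ⟨?_, ?_, Or.inl ?_⟩
    · simpa using ⟨ht, hu2.redL hl⟩
    · simpa using hu2.leavesL
    · simpa using hu1

theorem hTree_of_not_isLower {t : Tr} (ht : Red t) (hB : ¬ IsLower t) : hTree 𝕜 t = 0 := by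
  revert hB
  refine red_cases (p := fun t => ¬ IsLower t → hTree 𝕜 t = 0) ?_ ?_ ?_ ?_ ht
  · intro _; rw [leaf, hTree] <;> simp
  · intro t _ ih hB
    rw [isLower_leaf_iff] at hB
    rw [hTree_leaf, ih hB, zero_mul, map_zero, neg_zero]
  · intro t l _ _ hl hB
    match l, hl with
    | x :: l, _ => exact absurd (isLower_cons t x l) hB
  · intro t l _ _ hl _
    match l, hl with
    | x :: y :: l, _ => rw [hTree] <;> simp

/-- The homotopy does not lower the rank, and its values are combinations of upper trees. -/
theorem hTree_mem {t : Tr} (ht : Red t) (hB : IsLower t) :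
    hTree 𝕜 t ∈ fs (𝕜 := 𝕜) (single (Up (leaves t) (rk t))) := by
  revert hB
  refine red_cases
    (p := fun t => IsLower t → hTree 𝕜 t ∈ fs (𝕜 := 𝕜) (single (Up (leaves t) (rk t))))
    ?_ ?_ ?_ ?_ ht
  · exact fun hB => absurd hB not_isLower_leaf
  · intro t _ ih hB
    rw [isLower_leaf_iff] at hB
    rw [hTree_leaf, rk_leaf, leaves_node (by simp), leavesL_cons, leavesL_cons, leaves_leaf,
      leavesL_nil]
    exact neg_mem (nd_mul_leaf_mem (fun s hs => up_leaf hs) (ih hB))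
  · intro t l ht hl h2 _
    rw [hTree_node _ h2, (ord_node_node ht hl h2).2]
    refine neg_mem (Submodule.smul_mem _ _ (w_mem_single ?_))
    match l, h2 with
    | x :: l, h2 => rw [rk_cons]; exact up_node ht hl h2
  · exact fun t l _ _ h2 hB => absurd hB (not_isLower_of_three_le (by simpa using h2))

theorem htpy_mem {k m : ℕ} {x : ForestAlg 𝕜} (hx : x ∈ fs (single (Low k m))) :
    htpy x ∈ fs (𝕜 := 𝕜) (single (Up k m)) := by
  refine map_mem_of_fs htpy ?_ hx
  rintro _ ⟨t, rfl, ht⟩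
  rw [htpy_tree]
  by_cases hB : IsLower t
  · refine fs_mono (single_mono fun s hs => ?_) (hTree_mem ht.1.1 hB)
    rw [ht.1.2] at hs
    exact ⟨hs.1, hs.2.1, hs.2.2.1, (ht.2 hB).trans hs.2.2.2⟩
  · rw [hTree_of_not_isLower ht.1.1 hB]; exact zero_mem _

/-- On lower trees, `d htpy` is the identity up to higher rank. -/
theorem d_hTree_sub_mem {t : Tr} (ht : Red t) (hB : IsLower t) :
    d (hTree 𝕜 t) - w [t] ∈ fs (𝕜 := 𝕜) (single (Low (leaves t) (rk t + 1))) := by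
  revert hB
  refine red_cases (p := fun t => IsLower t →
    d (hTree 𝕜 t) - w [t] ∈ fs (𝕜 := 𝕜) (single (Low (leaves t) (rk t + 1)))) ?_ ?_ ?_ ?_ ht
  · exact fun hB => absurd hB not_isLower_leaf
  · intro t ht ih hB
    rw [isLower_leaf_iff] at hB
    have h1 := nd_mul_leaf_mem (fun s hs => low_leaf hs) (ih hB)
    rw [hTree_leaf, map_neg, d_nd_mul_leaf (single_subset_trees _ (hTree_mem ht hB)), neg_neg,
      rk_leaf, leaves_node (by simp), leavesL_cons, leavesL_cons, leaves_leaf, leavesL_nil]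
    rw [sub_mul, map_sub, ← w_cons, nd_w] at h1
    exact h1
  · intro t l ht hl h2 _
    have h1 := Submodule.smul_mem _ (- sg 𝕜 t) (dTree_add_mem ht hl h2 (𝕜 := 𝕜))
    rw [hTree_node _ h2, (ord_node_node ht hl h2).2, map_neg, map_smul, d_tree]
    have h3 : rk (.node [t, .node l]) = leaves t := by
      match l, h2 with
      | x :: l, h2 => rw [rk_cons]
    rw [h3]
    rw [smul_add, smul_smul, neg_mul, sg_mul_self, neg_smul, neg_smul, one_smul, ← sub_eq_add_neg]
      at h1
    exact h1
  · exact fun t l _ _ h2 hB => absurd hB (not_isLower_of_three_le (by simpa using h2))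

/-- On upper trees, `htpy d` is the identity up to higher rank. -/
theorem htpy_dTree_sub_mem {t : Tr} (ht : Red t) (hB : ¬ IsLower t) (hC : ∀ n, t ≠ comb n) :
    htpy (dTree 𝕜 t) - w [t] ∈ fs (𝕜 := 𝕜) (single (Up (leaves t) (rk t + 1))) := by
  revert hB hC
  refine red_cases (p := fun t => ¬ IsLower t → (∀ n, t ≠ comb n) →
    htpy (dTree 𝕜 t) - w [t] ∈ fs (𝕜 := 𝕜) (single (Up (leaves t) (rk t + 1)))) ?_ ?_ ?_ ?_ ht
  · exact fun _ hC => absurd rfl (hC 0)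
  · intro t ht ih hB hC
    rw [isLower_leaf_iff] at hB
    have h1 := nd_mul_leaf_mem (fun s hs => up_leaf hs)
      (ih hB fun n hn => hC (n + 1) (by rw [hn, comb]))
    rw [dTree_mul_leaf, map_neg, htpy_nd_mul_leaf (dTree_mem_trees _), neg_neg,
      rk_leaf, leaves_node (by simp), leavesL_cons, leavesL_cons, leaves_leaf, leavesL_nil]
    rw [sub_mul, map_sub, ← w_cons, nd_w] at h1
    exact h1
  · intro t l _ _ hl hB
    match l, hl with
    | x :: l, _ => exact absurd (isLower_cons t x l) hB
  · intro t l ht hl h2 _ _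
    have h1 := htpy_mem (dTree_add_mem ht hl h2 (𝕜 := 𝕜))
    rw [map_add, map_smul, htpy_tree, hTree_node _ h2, smul_neg, smul_smul, sg_mul_self, one_smul,
      ← sub_eq_add_neg] at h1
    rw [rk_of_two_le h2, leaves_node (by simp), leavesL_cons]
    exact h1

theorem dTree_comb (n : ℕ) : dTree 𝕜 (comb n) = 0 := by
  induction n with
  | zero => exact dTree_leaf
  | succ n ih => rw [comb, dTree_mul_leaf, ih, zero_mul, map_zero, neg_zero]

theorem aug_comb_ne_zero (n : ℕ) : aug 𝕜 (comb n) ≠ 0 := by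
  induction n with
  | zero => rw [comb, aug_leaf]; exact one_ne_zero
  | succ n ih => rw [comb, aug_two, aug_leaf, mul_one]; exact neg_ne_zero.2 ih

theorem d_d {k : ℕ} {x : ForestAlg 𝕜} (hx : x ∈ fs (single (Ord k))) : d (d x) = 0 :=
  eq_on_trees (f := d ∘ₗ d) (g := 0) (fun t => by rw [LinearMap.comp_apply, d_tree, d_dTree]; rfl)
    (single_subset_trees _ hx)

theorem augL_d {k : ℕ} {x : ForestAlg 𝕜} (hx : x ∈ fs (single (Ord k))) : augL (d x) = 0 :=
  eq_on_trees (f := augL ∘ₗ d) (g := 0) (fun t => by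
    rw [LinearMap.comp_apply, d_tree, augL_dTree]; rfl) (single_subset_trees _ hx)

/-- A cycle which is a combination of upper trees vanishes: it is equal to `htpy (d x) = 0` up to
terms of higher rank, and the rank is bounded. -/
theorem eq_zero_of_up {k : ℕ} {x : ForestAlg 𝕜} (hx : x ∈ fs (single (Up k 0))) (hd : d x = 0) :
    x = 0 := by
  have key : ∀ m, x ∈ fs (single (Up k m)) := by
    intro m
    induction m with
    | zero => exact hx
    | succ m ih =>
      have h1 : (htpy ∘ₗ d - LinearMap.id : ForestAlg 𝕜 →ₗ[𝕜] ForestAlg 𝕜) x ∈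
          fs (𝕜 := 𝕜) (single (Up k (m + 1))) := by
        refine map_mem_of_fs _ ?_ ih
        rintro _ ⟨t, rfl, ht⟩
        simp only [LinearMap.sub_apply, LinearMap.comp_apply, d_tree, LinearMap.id_apply]
        refine fs_mono (single_mono fun s hs => ?_) (htpy_dTree_sub_mem ht.1.1 ht.2.1 ht.2.2.1)
        rw [ht.1.2] at hs
        exact ⟨hs.1, hs.2.1, hs.2.2.1, (Nat.succ_le_succ ht.2.2.2).trans hs.2.2.2⟩
      simpa [hd] using h1
  have h2 := key (k ^ 2 + 1)
  have h3 : single (Up k (k ^ 2 + 1)) = ∅ := by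
    ext u
    simp only [Set.mem_empty_iff_false, iff_false]
    rintro ⟨t, rfl, ht⟩
    have h4 := rk_le ht.1.1
    rw [ht.1.2] at h4
    exact absurd (ht.2.2.2.trans h4) (by simp)
  rw [h3, fs, Set.image_empty, Submodule.span_empty] at h2
  exact (Submodule.mem_bot 𝕜).1 h2

theorem ord_eq_low (k : ℕ) : single (Ord k) = single (Low k 0) :=
  Set.Subset.antisymm (single_mono fun _ ht => ⟨ht, fun _ => Nat.zero_le _⟩)
    (single_mono fun _ ht => ht.1)

/-- Up to boundaries, the lower trees can be removed from a chain, one rank after the other. -/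
theorem exists_sub_d_mem {k : ℕ} {x : ForestAlg 𝕜} (hx : x ∈ fs (single (Ord k))) (m : ℕ) :
    ∃ y ∈ fs (𝕜 := 𝕜) (single (Ord k)), x - d y ∈ fs (𝕜 := 𝕜) (single (Low k m)) := by
  induction m with
  | zero => exact ⟨0, zero_mem _, by rwa [map_zero, sub_zero, ← ord_eq_low]⟩
  | succ m ih =>
    obtain ⟨y, hy, hxy⟩ := ih
    refine ⟨y + htpy (x - d y),
      add_mem hy (fs_mono (single_mono fun _ h => h.1) (htpy_mem hxy)), ?_⟩
    have h1 : (LinearMap.id - d ∘ₗ htpy : ForestAlg 𝕜 →ₗ[𝕜] ForestAlg 𝕜) (x - d y) ∈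
        fs (𝕜 := 𝕜) (single (Low k (m + 1))) := by
      refine map_mem_of_fs _ ?_ hxy
      rintro _ ⟨t, rfl, ht⟩
      simp only [LinearMap.sub_apply, LinearMap.comp_apply, htpy_tree, LinearMap.id_apply]
      by_cases hB : IsLower t
      · rw [← neg_sub]
        refine neg_mem (fs_mono (single_mono fun s hs => ?_) (d_hTree_sub_mem ht.1.1 hB))
        rw [ht.1.2] at hs
        exact ⟨hs.1, fun h => (Nat.succ_le_succ (ht.2 hB)).trans (hs.2 h)⟩
      · rw [hTree_of_not_isLower ht.1.1 hB, map_zero, sub_zero]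
        exact w_mem_single ⟨ht.1, fun h => absurd h hB⟩
    have h2 : x - d (y + htpy (x - d y)) =
        (LinearMap.id - d ∘ₗ htpy : ForestAlg 𝕜 →ₗ[𝕜] ForestAlg 𝕜) (x - d y) := by
      rw [map_add]
      simp only [LinearMap.sub_apply, LinearMap.id_apply, LinearMap.comp_apply]
      abel
    rw [h2]
    exact h1

/-- The complex of reduced trees with `k` leaves is acyclic relative to the augmentation. Up to a
boundary, a cycle is a combination of upper trees and of the left comb; the comb is a cycle and its
coefficient is detected by the augmentation. -/
theorem exists_d_eq {k : ℕ} {x : ForestAlg 𝕜} (hx : x ∈ fs (single (Ord k))) (hd : d x = 0)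
    (ha : augL x = 0) : ∃ y ∈ fs (𝕜 := 𝕜) (single (Ord k)), d y = x := by
  obtain ⟨y, hy, hxy⟩ := exists_sub_d_mem hx (k ^ 2 + 1)
  refine ⟨y, hy, ?_⟩
  have h1 : fs (𝕜 := 𝕜) (single (Low k (k ^ 2 + 1))) ≤
      fs (single (Up k 0)) ⊔ Submodule.span 𝕜 {w [comb (k - 1)]} := by
    refine Submodule.span_le.2 ?_
    rintro _ ⟨_, ⟨t, rfl, ht⟩, rfl⟩
    have hB : ¬ IsLower t := fun hB => by
      have h2 := ht.2 hB
      have h3 := rk_le ht.1.1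
      rw [ht.1.2] at h3
      omega
    by_cases hC : ∀ n, t ≠ comb n
    · exact Submodule.mem_sup_left (w_mem_single ⟨ht.1, hB, hC, Nat.zero_le _⟩)
    · push Not at hC
      obtain ⟨n, rfl⟩ := hC
      have := ht.1.2
      rw [leaves_comb] at this
      refine Submodule.mem_sup_right (Submodule.subset_span ?_)
      rw [← this]; rfl
  obtain ⟨a, ha', c, hc, hac⟩ := Submodule.mem_sup.1 (h1 hxy)
  obtain ⟨c, rfl⟩ := Submodule.mem_span_singleton.1 hc
  have h2 : d (x - d y) = 0 := by rw [map_sub, hd, d_d hy, sub_zero]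
  rw [← hac, map_add, map_smul, d_tree, dTree_comb, smul_zero, add_zero] at h2
  obtain rfl := eq_zero_of_up ha' h2
  have h3 : augL (x - d y) = 0 := by rw [map_sub, ha, augL_d hy, sub_zero]
  rw [← hac, zero_add, map_smul, augL_tree, smul_eq_mul, mul_eq_zero] at h3
  rcases h3 with h3 | h3
  · rw [h3, zero_smul, add_zero] at hac
    exact (sub_eq_zero.1 hac.symm).symm
  · exact absurd h3 (aug_comb_ne_zero _)

end ForestAlg

/-! ### The free operad on pure tensors -/

namespace PerColl

variable {𝕜 : Type u} [Field 𝕜] (E : PerColl 𝕜)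

theorem lift_of {α : Per} {V : Type u} [AddCommGroup V] [Module 𝕜 V]
    (φ : ∀ t : PTree α, E.T t →ₗ[𝕜] V) (t : PTree α) (x : E.T t) :
    E.lift φ (E.of t x) = φ t x := by
  simp only [lift, of, DFinsupp.lsingle_apply, DFinsupp.lsum_single]

/-- The pure tensor in the summand of `node f h t`. -/
noncomputable def tm {α β : Per} (f : α ⟶ β) (h : 2 ≤ β.k) (t : ∀ i, PTree (Per.fib f i))
    (e : E.obj β) (x : ∀ i, E.T (t i)) : E.T (.node f h t) :=
  E.nodeT f h t e x

theorem node_of {α β : Per} (f : α ⟶ β) (h : 2 ≤ β.k) (t : ∀ i, PTree (Per.fib f i))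
    (e : E.obj β) (x : ∀ i, E.T (t i)) :
    E.node f h e (fun i => E.of (t i) (x i)) = E.of (.node f h t) (E.tm f h t e x) := by
  simp only [node, LinearMap.comp_apply, of, DFinsupp.lsingle_apply]
  exact MultilinearMap.fromDFinsuppEquiv_single _ _ _

theorem liftNode_tm {α β : Per} (f : α ⟶ β) (h : 2 ≤ β.k) (t : ∀ i, PTree (Per.fib f i))
    {V : Type u} [AddCommGroup V] [Module 𝕜 V]
    (φ : E.obj β →ₗ[𝕜] MultilinearMap 𝕜 (fun i => E.T (t i)) V) (e : E.obj β)
    (x : ∀ i, E.T (t i)) : E.liftNode f h t φ (E.tm f h t e x) = φ e x := by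
  change TensorProduct.lift (M := E.obj β) (N := ⨂[𝕜] i, E.T (t i)) _
    (e ⊗ₜ PiTensorProduct.tprod 𝕜 x) = _
  rw [TensorProduct.lift.tmul]
  simp

theorem T_node_induction {α β : Per} {f : α ⟶ β} {h : 2 ≤ β.k} {t : ∀ i, PTree (Per.fib f i)}
    {p : E.T (.node f h t) → Prop} (htm : ∀ e x, p (E.tm f h t e x))
    (hadd : ∀ x y, p x → p y → p (x + y)) (hzero : p 0) (x : E.T (.node f h t)) : p x := by
  change E.obj β ⊗[𝕜] (⨂[𝕜] i, E.T (t i)) at x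
  refine TensorProduct.induction_on (motive := fun x : E.obj β ⊗[𝕜] (⨂[𝕜] i, E.T (t i)) => p x)
    x hzero (fun e y => ?_) hadd
  refine PiTensorProduct.induction_on (motive := fun y => p (e ⊗ₜ[𝕜] y)) y (fun c y => ?_)
    (fun y z hy hz => ?_)
  · rw [← TensorProduct.smul_tmul]
    exact htm (c • e) y
  · rw [TensorProduct.tmul_add]
    exact hadd _ _ hy hz

/-- A scalar as an element of the summand of `leaf h`. -/
def tl {α : Per} (h : α.k = 1) (c : 𝕜) : E.T (.leaf h) := c

theorem one_eq {α : Per} (h : α.k = 1) : E.one h = E.of (.leaf h) (E.tl h 1) := rfl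

theorem of_leaf {α : Per} (h : α.k = 1) (x : E.T (.leaf h)) :
    ∃ c : 𝕜, E.of (.leaf h) x = c • E.one h := by
  obtain ⟨c, hc⟩ : ∃ c, x = E.tl h c := ⟨x, rfl⟩
  have h1 : E.tl h c = c • E.tl h 1 := (mul_one c).symm
  exact ⟨c, by rw [hc, h1, map_smul, one_eq]⟩

theorem F_add_induction {α : Per} {p : E.F α → Prop} (hof : ∀ t x, p (E.of t x))
    (hadd : ∀ x y, p x → p y → p (x + y)) (hzero : p 0) (x : E.F α) : p x :=
  DFinsupp.induction x hzero fun t y _ _ _ hf => hadd _ _ (hof t y) hf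

/-- Induction for elements of the free operad. -/
theorem of_induction {p : ∀ {α : Per}, E.F α → Prop}
    (hone : ∀ {α : Per} (h : α.k = 1) (c : 𝕜), p (c • E.one h))
    (hnode : ∀ {α β : Per} (f : α ⟶ β) (h : 2 ≤ β.k) (e : E.obj β) (t : ∀ i, PTree (Per.fib f i))
      (x : ∀ i, E.T (t i)), (∀ i, p (E.of (t i) (x i))) →
      p (E.node f h e fun i => E.of (t i) (x i)))
    (hadd : ∀ {α : Per} (x y : E.F α), p x → p y → p (x + y)) (hzero : ∀ {α : Per}, p (0 : E.F α))
    {α : Per} (t : PTree α) (x : E.T t) : p (E.of t x) := by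
  induction t with
  | leaf h => obtain ⟨c, hc⟩ := E.of_leaf h x; rw [hc]; exact hone h c
  | node f h t ih =>
    refine E.T_node_induction (p := fun x => p (E.of (.node f h t) x)) (fun e x => ?_)
      (fun x y hx hy => ?_) ?_ x
    · rw [← node_of]; exact hnode f h e t x fun i => ih i (x i)
    · rw [map_add]; exact hadd _ _ hx hy
    · rw [map_zero]; exact hzero

theorem comp_of {α β : Per} (f : α ⟶ β) (t : PTree β) (x : E.T t) :
    E.comp f (E.of t x) = E.compT t f x := E.lift_of _ t x

theorem comp_one {α β : Per} (f : α ⟶ β) (h : β.k = 1) (y : ∀ i, E.F (Per.fib f i)) :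
    E.comp f (E.one h) y = castL 𝕜 E.F (Per.fib_of_trivial f h ⟨0, β.pos⟩) (y ⟨0, β.pos⟩) := by
  rw [one_eq, comp_of, compT]
  exact congrArg (fun m : MultilinearMap 𝕜 (fun i => E.F (Per.fib f i)) (E.F α) => m y)
    (one_smul 𝕜 _)

theorem comp_node {α β δ : Per} (f : α ⟶ β) (g : β ⟶ δ) (h : 2 ≤ δ.k) (e : E.obj δ)
    (t : ∀ j, PTree (Per.fib g j)) (x : ∀ j, E.T (t j)) (y : ∀ i, E.F (Per.fib f i)) :
    E.comp f (E.node g h e fun j => E.of (t j) (x j)) y =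
      E.node (f ≫ g) h e fun j => E.comp (Per.fibMap f g j) (E.of (t j) (x j))
        (E.args f g (fun j => ∑ j' with j < j', (t j').deg E.deg) j y) := by
  rw [node_of, comp_of, compT, liftNode_tm]
  simp only [comp_of]
  rfl

theorem twist_of (p : ℤ) {α : Per} (t : PTree α) (x : E.T t) :
    E.twist p α (E.of t x) = ((p * t.deg E.deg).negOnePow : ℤˣ) • E.of t x := E.lift_of _ t x

variable (ζ : ∀ α, E.obj α →ₗ[𝕜] E.F α)

theorem der_of {α : Per} (t : PTree α) (x : E.T t) : E.der ζ α (E.of t x) = E.derT ζ t x :=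
  E.lift_of _ t x

theorem der_one {α : Per} (h : α.k = 1) : E.der ζ α (E.one h) = 0 := by
  rw [one_eq, der_of, derT]; rfl

theorem units_smul_apply₂ {V : Type*} [AddCommGroup V] [Module 𝕜 V] {ι : Type*} {W : ι → Type*}
    [∀ i, AddCommGroup (W i)] [∀ i, Module 𝕜 (W i)] {N : Type*} [AddCommGroup N] [Module 𝕜 N]
    (s : ℤˣ) (A : V →ₗ[𝕜] MultilinearMap 𝕜 W N) (e : V) (x : ∀ i, W i) :
    (s • A) e x = s • A e x := by
  rcases Int.units_eq_one_or s with rfl | rfl <;> simp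

theorem der_node {α β : Per} (f : α ⟶ β) (h : 2 ≤ β.k) (e : E.obj β)
    (t : ∀ i, PTree (Per.fib f i)) (x : ∀ i, E.T (t i)) :
    E.der ζ α (E.node f h e fun i => E.of (t i) (x i)) =
      E.comp f (ζ β e) (fun i => E.of (t i) (x i)) +
      ∑ i, ((E.deg β + ∑ j with j < i, (t j).deg E.deg).negOnePow : ℤˣ) •
        E.node f h e (Function.update (fun j => E.of (t j) (x j)) i
          (E.der ζ _ (E.of (t i) (x i)))) := by
  rw [node_of, der_of, derT, liftNode_tm]
  simp only [LinearMap.add_apply, LinearMap.comp_apply, LinearMap.sum_apply, add_apply,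
    sum_apply, MultilinearMap.compLinearMapₗ_apply,
    MultilinearMap.compLinearMap_apply]
  congr 1
  refine Finset.sum_congr rfl fun i _ => ?_
  refine (units_smul_apply₂ _ _ e x).trans (congrArg _ ?_)
  change E.node f h e _ = E.node f h e _
  congr 1
  funext j
  rcases eq_or_ne j i with rfl | hj
  · simp [der_of]
  · simp [hj]

theorem ev_of (P : PerOperad 𝕜) (κ : ∀ α, E.obj α →ₗ[𝕜] P.obj α) {α : Per} (t : PTree α)
    (x : E.T t) : E.ev P κ α (E.of t x) = E.evT P κ t x := E.lift_of _ t x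

theorem ev_one (P : PerOperad 𝕜) (κ : ∀ α, E.obj α →ₗ[𝕜] P.obj α) {α : Per} (h : α.k = 1) :
    E.ev P κ α (E.one h) = P.one α h := by
  rw [one_eq, ev_of, evT]
  exact one_smul 𝕜 _

theorem ev_node (P : PerOperad 𝕜) (κ : ∀ α, E.obj α →ₗ[𝕜] P.obj α) {α β : Per} (f : α ⟶ β)
    (h : 2 ≤ β.k) (e : E.obj β) (t : ∀ i, PTree (Per.fib f i)) (x : ∀ i, E.T (t i)) :
    E.ev P κ α (E.node f h e fun i => E.of (t i) (x i)) =
      P.comp f (κ β e) fun i => E.ev P κ _ (E.of (t i) (x i)) := by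
  rw [node_of, ev_of, evT, liftNode_tm]
  simp only [ev_of]
  rfl

end PerColl

/-! ### The signs of the operadic suspension -/

/-- Functions on the components which do not depend on the name of the component are invariant
under transport. -/
theorem apply_castL {𝕜 : Type u} [Field 𝕜] {O : Per → Type u} [∀ α, AddCommGroup (O α)]
    [∀ α, Module 𝕜 (O α)] {X : Type*} (ψ : ∀ α, O α → X) {α β : Per} (h : α = β) (x : O α) :
    ψ β (castL 𝕜 O h x) = ψ α x := by
  subst h; rfl

theorem castL_castL {𝕜 : Type u} [Field 𝕜] {O : Per → Type u} [∀ α, AddCommGroup (O α)]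
    [∀ α, Module 𝕜 (O α)] {α β δ : Per} (h : α = β) (h' : β = δ) (x : O α) :
    castL 𝕜 O h' (castL 𝕜 O h x) = castL 𝕜 O (h.trans h') x := by
  subst h; subst h'; rfl

theorem castL_family {𝕜 : Type u} [Field 𝕜] {O : Per → Type u} [∀ α, AddCommGroup (O α)]
    [∀ α, Module 𝕜 (O α)] {ι : Type*} {a : ι → Per} (y : ∀ i, O (a i)) {i j : ι} (hij : i = j)
    (h : a i = a j) : castL 𝕜 O h (y i) = y j := by
  subst hij; rfl

namespace Per

theorem emb_id (α : Per) (j : Fin α.k) (l : Fin (fib (𝟙 α) j).k) : emb (𝟙 α) j l = j :=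
  γ_emb (𝟙 α) j l

theorem sum_emb {M : Type*} [AddCommMonoid M] {α β : Per} (g : α ⟶ β) (a : Fin α.k → M) :
    ∑ j, ∑ i, a (emb g j i) = ∑ i, a i := by
  classical
  rw [← Finset.sum_fiberwise Finset.univ g.γ a]
  refine Finset.sum_congr rfl fun j _ => ?_
  refine Finset.sum_nbij (emb g j) ?_ ?_ ?_ (fun _ _ => rfl)
  · intro i _
    simp [γ_emb]
  · exact (emb g j).injective.injOn
  · intro i hi
    have := (mem_range_emb g j i).2 (by simpa using hi)
    simpa using this

theorem fib_fibMap_k {α β δ : Per} (f : α ⟶ β) (g : β ⟶ δ) (j : Fin δ.k) (i : Fin (fib g j).k) :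
    (fib (fibMap f g j) i).k = (fib f (emb g j i)).k := by
  rw [← fib_fibMap]

theorem fib_comp_k {α β δ : Per} (f : α ⟶ β) (g : β ⟶ δ) (j : Fin δ.k) :
    (fib (f ≫ g) j).k = ∑ i, (fib f (emb g j i)).k := by
  rw [← sum_fib (fibMap f g j)]
  exact Finset.sum_congr rfl fun i _ => fib_fibMap_k f g j i

theorem sum_lt_emb {M : Type*} [AddCommMonoid M] {α β : Per} (g : α ⟶ β) (c : Fin α.k → M)
    (j : Fin β.k) (l : Fin (fib g j).k) :
    ∑ i with i < emb g j l, c i =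
      ∑ j' with j' < j, ∑ l', c (emb g j' l') + ∑ l' with l' < l, c (emb g j l') := by
  classical
  rw [Finset.sum_filter, ← sum_emb g, ← Finset.sum_filter_add_sum_filter_not Finset.univ (· < j)]
  congr 1
  · refine Finset.sum_congr rfl fun j' hj' => Finset.sum_congr rfl fun l' _ => if_pos ?_
    by_contra h
    have := g.γ.monotone (not_lt.1 h)
    rw [γ_emb, γ_emb] at this
    exact absurd (Finset.mem_filter.1 hj').2 (not_lt.2 this)
  · rw [Finset.sum_eq_single_of_mem j (by simp)]
    · rw [Finset.sum_filter]
      refine Finset.sum_congr rfl fun l' _ => ?_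
      simp only [(emb g j).lt_iff_lt]
    · intro j' hj' hne
      refine Finset.sum_eq_zero fun l' _ => if_neg fun h => ?_
      have := g.γ.monotone h.le
      rw [γ_emb, γ_emb] at this
      exact (Finset.mem_filter.1 hj').2 (lt_of_le_of_ne this hne)

/-- The exponent of the sign of the operadic suspension: the component over the `i`-th fiber, which
has the parity `|fᵢ| - 1`, is moved past one suspension for each element of the fibers on its
left. -/
def susp {α β : Per} (f : α ⟶ β) : ℕ :=
  ∑ i, (∑ i' with i' < i, (fib f i').k) * ((fib f i).k + 1)

/-- The cocycle identity satisfied by the signs of the operadic suspension, the third term being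
the Koszul sign in the composition of the free operad on generators of degree one. -/
theorem susp_comp {α β δ : Per} (f : α ⟶ β) (g : β ⟶ δ) :
    ((susp (f ≫ g) + ∑ j, susp (fibMap f g j) +
      ∑ j, (∑ j' with j < j', ((fib g j').k + 1)) * ∑ i, ((fib f (emb g j i)).k + 1) : ℕ) :
        ZMod 2) =
      (susp f + susp g : ℕ) := by
  have h1 : susp f = ∑ j, susp (fibMap f g j) +
      ∑ j, (∑ j' with j' < j, (fib (f ≫ g) j').k) * ((fib (f ≫ g) j).k + (fib g j).k) := by
    rw [susp, ← sum_emb g, ← Finset.sum_add_distrib]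
    refine Finset.sum_congr rfl fun j _ => ?_
    simp only [sum_lt_emb, add_mul, Finset.sum_add_distrib, ← Finset.mul_sum]
    rw [add_comm]
    congr 1
    · rw [susp]
      simp only [fib_fibMap_k]
    · simp only [← fib_comp_k]
      simp
  have h2 : ∑ j, (∑ j' with j < j', ((fib g j').k + 1)) * ∑ i, ((fib f (emb g j i)).k + 1) =
      ∑ j, ((fib g j).k + 1) * ∑ j' with j' < j, ((fib (f ≫ g) j').k + (fib g j').k) := by
    have h3 : ∀ j, ∑ i, ((fib f (emb g j i)).k + 1) = (fib (f ≫ g) j).k + (fib g j).k := by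
      intro j
      rw [Finset.sum_add_distrib, ← fib_comp_k]
      simp
    simp only [h3, Finset.sum_filter, Finset.sum_mul, Finset.mul_sum]
    rw [Finset.sum_comm]
    refine Finset.sum_congr rfl fun j _ => Finset.sum_congr rfl fun j' _ => ?_
    split_ifs <;> simp
  have h4 : ((∑ j, (∑ j' with j' < j, (fib (f ≫ g) j').k) * ((fib (f ≫ g) j).k + 1) +
      ∑ j, ((fib g j).k + 1) * ∑ j' with j' < j, ((fib (f ≫ g) j').k + (fib g j').k) : ℕ) :
        ZMod 2) =
      (∑ j, (∑ j' with j' < j, (fib (f ≫ g) j').k) * ((fib (f ≫ g) j).k + (fib g j).k) +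
        ∑ j, (∑ j' with j' < j, (fib g j').k) * ((fib g j).k + 1) : ℕ) := by
    have two : (2 : ZMod 2) = 0 := rfl
    rw [← Finset.sum_add_distrib, ← Finset.sum_add_distrib]
    simp only [Nat.cast_sum]
    refine Finset.sum_congr rfl fun j _ => ?_
    rw [Finset.sum_add_distrib]
    push_cast
    linear_combination (∑ j' with j' < j, ((fib (f ≫ g) j').k : ZMod 2)) * two
  rw [h2, h1]
  rw [show susp (f ≫ g) = ∑ j, (∑ j' with j' < j, (fib (f ≫ g) j').k) * ((fib (f ≫ g) j).k + 1)
    from rfl, show susp g = ∑ j, (∑ j' with j' < j, (fib g j').k) * ((fib g j).k + 1) from rfl]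
  rw [Nat.cast_add] at h4
  rw [Nat.cast_add _ (∑ j, (∑ j' with j' < j, (fib g j').k) * ((fib g j).k + 1)), Nat.cast_add,
    Nat.cast_add, Nat.cast_add]
  rw [Nat.cast_add] at h4
  linear_combination h4

theorem susp_of_trivial {α β : Per} (f : α ⟶ β) (hβ : β.k = 1) : susp f = 0 := by
  refine Finset.sum_eq_zero fun i _ => ?_
  rw [Finset.sum_eq_zero, zero_mul]
  intro j hj
  have : Subsingleton (Fin β.k) := by rw [hβ]; infer_instance
  exact absurd (Finset.mem_filter.1 hj).2 (by rw [Subsingleton.elim j i]; exact lt_irrefl _)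

end Per

namespace PerColl

variable {𝕜 : Type u} [Field 𝕜] (E : PerColl 𝕜)

theorem args_eq {α β δ : Per} (f : α ⟶ β) (g : β ⟶ δ) (p : Fin δ.k → ℤ) (j : Fin δ.k)
    (y : ∀ i, E.F (Per.fib f i)) (i : Fin (Per.fib g j).k) : E.args f g p j y i =
      castL 𝕜 E.F (Per.fib_fibMap f g j i) (E.twist (p j) _ (y (Per.emb g j i))) := rfl

theorem twist_zero {α : Per} (x : E.F α) : E.twist 0 α x = x := by
  induction x using E.F_add_induction with
  | hof t x => rw [twist_of]; simp
  | hadd x y hx hy => rw [map_add, hx, hy]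
  | hzero => rw [map_zero]

/-- The tree with one vertex. -/
def cor (α : Per) (h : 2 ≤ α.k) : PTree α := .node (𝟙 α) h fun i => .leaf (Per.fib_id α i)

theorem gen_eq_node {α : Per} (h : 2 ≤ α.k) (e : E.obj α) :
    E.gen α e = E.node (𝟙 α) h e fun i => E.one (Per.fib_id α i) := by
  rw [gen, dif_pos h]; rfl

theorem gen_eq {α : Per} (h : 2 ≤ α.k) (e : E.obj α) :
    E.gen α e = E.of (cor α h) (E.tm _ h _ e fun i => E.tl (Per.fib_id α i) 1) := by
  rw [gen_eq_node E h]
  simp only [one_eq]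
  rw [node_of]
  rfl

/-- Composing with a generator is grafting to a vertex. -/
theorem comp_gen {α β : Per} (f : α ⟶ β) (h : 2 ≤ β.k) (e : E.obj β)
    (y : ∀ i, E.F (Per.fib f i)) : E.comp f (E.gen β e) y = E.node f h e y := by
  rw [gen_eq_node E h]
  simp only [one_eq]
  rw [comp_node]
  change E.node f h e _ = _
  congr 1
  funext j
  rw [← one_eq, comp_one, args_eq, castL_castL]
  have h0 : (∑ j' with j < j', (PTree.leaf (Per.fib_id β j')).deg E.deg) = 0 :=
    Finset.sum_eq_zero fun j' _ => by rw [PTree.deg]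
  rw [h0, twist_zero]
  exact castL_family y (Per.emb_id β j _) _

/-- A multilinear map which vanishes as soon as one argument lies in the given submodules only
depends on the classes of its arguments. -/
theorem _root_.MultilinearMap.congr_of_sub_mem {ι : Type*} [Fintype ι] {W : ι → Type*}
    [∀ i, AddCommGroup (W i)] [∀ i, Module 𝕜 (W i)] {N : Type*} [AddCommGroup N] [Module 𝕜 N]
    (A : MultilinearMap 𝕜 W N) (I : ∀ i, Submodule 𝕜 (W i)) (J : Submodule 𝕜 N)
    (hA : ∀ y i, y i ∈ I i → A y ∈ J) {x z : ∀ i, W i} (hxz : ∀ i, x i - z i ∈ I i) :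
    A x - A z ∈ J := by
  classical
  have key : ∀ s : Finset ι, A (s.piecewise x z) - A z ∈ J := by
    intro s
    induction s using Finset.induction_on with
    | empty => simp
    | insert i s hi ih =>
      have h1 : A (Function.update (s.piecewise x z) i (x i)) =
          A (Function.update (s.piecewise x z) i (x i - z i)) + A (s.piecewise x z) := by
        conv_lhs => rw [← sub_add_cancel (x i) (z i)]
        rw [MultilinearMap.map_update_add]
        congr 2
        rw [Function.update_eq_self_iff]
        simp [hi]
      rw [Finset.piecewise_insert, h1, add_sub_assoc]
      exact add_mem (hA _ i (by simpa using hxz i)) ih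
  simpa using key Finset.univ

/-- A collection is binary if its components `α` with `|α| ≠ 2` vanish. -/
def Binary : Prop := ∀ α, α.k ≠ 2 → Subsingleton (E.obj α)

variable {E}

/-- In a binary collection, only the trees with `|α| - 1` vertices contribute to the free operad. -/
theorem weight_or_zero (hE : E.Binary) {α : Per} (t : PTree α) :
    t.weight = α.k - 1 ∨ ∀ x : E.T t, x = 0 := by
  induction t with
  | leaf h => left; rw [PTree.weight, PTree.deg, h]; rfl
  | @node α β f h t ih =>
    by_cases hβ : β.k = 2
    · by_cases hw : ∀ i, (t i).weight = (Per.fib f i).k - 1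
      · left
        rw [PTree.weight, PTree.deg]
        change 1 + ∑ i, (t i).weight = _
        rw [Finset.sum_congr rfl fun i _ => hw i, Finset.sum_sub_distrib, ← Per.sum_fib f]
        simp [hβ]
        ring
      · right
        push Not at hw
        obtain ⟨i, hi⟩ := hw
        have h0 := (ih i).resolve_left hi
        refine E.T_node_induction (fun e x => ?_) (fun x y hx hy => ?_) rfl
        · exact (E.nodeT f h t e).map_coord_zero i (h0 (x i))
        · rw [hx, hy, add_zero]
    · right
      have := hE β hβ
      refine E.T_node_induction (fun e x => ?_) (fun x y hx hy => ?_) rfl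
      · rw [Subsingleton.elim e 0, tm, map_zero]; rfl
      · rw [hx, hy, add_zero]

theorem deg_eq_weight {d : ℤ} (hd : ∀ α, E.deg α = d) {α : Per} (t : PTree α) :
    t.deg E.deg = d * t.weight := by
  induction t with
  | leaf h => rw [PTree.weight, PTree.deg, PTree.deg, mul_zero]
  | node f h t ih =>
    rw [PTree.weight, PTree.deg, PTree.deg, mul_add, Finset.mul_sum, hd, mul_one,
      Finset.sum_congr rfl fun i _ => ih i]
    rfl

/-- In a binary collection of constant degree the twist acts by a sign. -/
theorem twist_apply (hE : E.Binary) {d : ℤ} (hd : ∀ α, E.deg α = d) (p : ℤ) {α : Per} (x : E.F α) :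
    E.twist p α x = ((p * (d * (α.k - 1))).negOnePow : ℤˣ) • x := by
  induction x using E.F_add_induction with
  | hof t x =>
    rw [twist_of]
    rcases weight_or_zero hE t with h | h
    · rw [deg_eq_weight hd, h]
    · rw [h x, map_zero, smul_zero, smul_zero]
  | hadd x y hx hy => rw [map_add, hx, hy, smul_add]
  | hzero => rw [map_zero, smul_zero]

variable (E)

/-- The functional on the summands of the free operad which multiplies the values of `ev` on the
vertices, with the signs of the `d`-fold operadic suspension. -/
noncomputable def phiT (ev : ∀ α, E.obj α →ₗ[𝕜] 𝕜) (d : ℕ) :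
    ∀ {α : Per} (t : PTree α), E.T t →ₗ[𝕜] 𝕜
  | _, .leaf _ => (LinearMap.id : 𝕜 →ₗ[𝕜] 𝕜)
  | _, .node (β := β) f h t => E.liftNode f h t
      (MultilinearMap.compLinearMapₗ (fun i => phiT ev d (t i)) ∘ₗ
        LinearMap.toSpanSingleton 𝕜 _ ((-1 : 𝕜) ^ (d * Per.susp f) •
          MultilinearMap.mkPiAlgebra 𝕜 (Fin β.k) 𝕜) ∘ₗ ev β)

/-- The functional on the free operad which multiplies the values of `ev` on the
vertices, with the signs of the `d`-fold operadic suspension. -/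
noncomputable def phi (ev : ∀ α, E.obj α →ₗ[𝕜] 𝕜) (d : ℕ) (α : Per) : E.F α →ₗ[𝕜] 𝕜 :=
  E.lift fun t => E.phiT ev d t

section Phi
variable (ev : ∀ α, E.obj α →ₗ[𝕜] 𝕜) (d : ℕ)

theorem phi_of {α : Per} (t : PTree α) (x : E.T t) : E.phi ev d α (E.of t x) = E.phiT ev d t x :=
  E.lift_of _ t x

theorem phi_one {α : Per} (h : α.k = 1) : E.phi ev d α (E.one h) = 1 := by
  rw [one_eq, phi_of, phiT]; rfl

theorem phi_node_of {α β : Per} (f : α ⟶ β) (h : 2 ≤ β.k) (e : E.obj β)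
    (t : ∀ i, PTree (Per.fib f i)) (x : ∀ i, E.T (t i)) :
    E.phi ev d α (E.node f h e fun i => E.of (t i) (x i)) =
      (-1) ^ (d * Per.susp f) * ev β e * ∏ i, E.phi ev d _ (E.of (t i) (x i)) := by
  rw [node_of, phi_of, phiT, liftNode_tm]
  simp only [LinearMap.comp_apply, phi_of, MultilinearMap.compLinearMapₗ_apply,
    MultilinearMap.compLinearMap_apply]
  change ev β e * ((-1) ^ (d * Per.susp f) * ∏ i, E.phiT ev d (t i) (x i)) = _
  ring

theorem phi_node {α β : Per} (f : α ⟶ β) (h : 2 ≤ β.k) (e : E.obj β)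
    (y : ∀ i, E.F (Per.fib f i)) :
    E.phi ev d α (E.node f h e y) =
      (-1) ^ (d * Per.susp f) * ev β e * ∏ i, E.phi ev d _ (y i) := by
  have key : (E.phi ev d α).compMultilinearMap (E.node f h e) =
      ((-1) ^ (d * Per.susp f) * ev β e) • (MultilinearMap.mkPiAlgebra 𝕜 (Fin β.k) 𝕜).compLinearMap
        fun i => E.phi ev d (Per.fib f i) := by
    refine MultilinearMap.dfinsupp_ext fun t => MultilinearMap.ext fun x => ?_
    exact phi_node_of E ev d f h e t x
  exact congrArg (fun m : MultilinearMap 𝕜 (fun i => E.F (Per.fib f i)) 𝕜 => m y) key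

end Phi
end PerColl

theorem Int.negOnePow_smul_eq {𝕜 : Type u} [Field 𝕜] {n : ℤ} {m : ℕ} (h : (n : ZMod 2) = m)
    (a : 𝕜) :
    (n.negOnePow : ℤˣ) • a = (-1) ^ m * a := by
  have h1 : (n : ZMod 2) = (m : ℤ) := by rw [h]; simp
  rw [ZMod.intCast_eq_intCast_iff_dvd_sub] at h1
  have h2 : n.negOnePow = (m : ℤ).negOnePow := by
    rw [Int.negOnePow_eq_iff]
    obtain ⟨c, hc⟩ := h1
    exact ⟨-c, by push_cast at hc; omega⟩
  rw [h2]
  rcases Nat.even_or_odd m with hm | hm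
  · rw [Int.negOnePow_even _ (by exact_mod_cast hm), hm.neg_one_pow, one_smul, one_mul]
  · rw [Int.negOnePow_odd _ (by exact_mod_cast hm), hm.neg_one_pow]; simp

theorem neg_one_pow_eq_of_zmod {𝕜 : Type u} [Field 𝕜] {n m : ℕ} (h : (n : ZMod 2) = m) :
    (-1 : 𝕜) ^ n = (-1) ^ m := by
  rw [ZMod.natCast_eq_natCast_iff] at h
  rw [neg_one_pow_eq_pow_mod_two, neg_one_pow_eq_pow_mod_two (n := m)]
  exact congrArg _ h

namespace PerColl

variable {𝕜 : Type u} [Field 𝕜] (E : PerColl 𝕜) (ev : ∀ α, E.obj α →ₗ[𝕜] 𝕜) (d : ℕ)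

variable {E} in
/-- `phi` is compatible with the structure maps: `phi` is the morphism to the `d`-fold suspension
of the terminal operad which extends `ev`. -/
theorem phi_comp (hE : E.Binary) (hd : ∀ α, E.deg α = d) {α β : Per} (f : α ⟶ β) (x : E.F β)
    (y : ∀ i, E.F (Per.fib f i)) :
    E.phi ev d α (E.comp f x y) =
      (-1) ^ (d * Per.susp f) * E.phi ev d β x * ∏ i, E.phi ev d _ (y i) := by
  induction x using E.F_add_induction with
  | hadd x y hx hy => rw [map_add, add_apply, map_add, hx, hy, map_add]; ring
  | hzero => rw [map_zero]; simp
  | hof t x =>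
    refine E.of_induction (p := fun {β} x => ∀ {α : Per} (f : α ⟶ β) (y : ∀ i, E.F (Per.fib f i)),
      E.phi ev d α (E.comp f x y) =
        (-1) ^ (d * Per.susp f) * E.phi ev d β x * ∏ i, E.phi ev d _ (y i)) ?_ ?_ ?_ ?_ t x f y
    · intro β h c α f y
      rw [map_smul, smul_apply, map_smul, comp_one, apply_castL (fun α => E.phi ev d α),
        Per.susp_of_trivial f h, map_smul, phi_one]
      have : Subsingleton (Fin β.k) := by rw [h]; infer_instance
      rw [Fintype.prod_subsingleton _ (⟨0, β.pos⟩ : Fin β.k)]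
      simp
    · intro β δ g h e t x ih α f y
      rw [comp_node, phi_node, phi_node]
      -- Unless both sides vanish, the degrees of the subtrees are those of their components.
      by_cases hx : ∃ j, E.phi ev d _ (E.of (t j) (x j)) = 0
      · obtain ⟨j, hj⟩ := hx
        rw [Finset.prod_eq_zero (Finset.mem_univ j) (by rw [ih, hj, mul_zero, zero_mul]),
          Finset.prod_eq_zero (Finset.mem_univ j) hj]
        simp
      · push Not at hx
        have hw : ∀ j, (t j).deg E.deg = d * ((Per.fib g j).k - 1) := fun j => by
          rcases weight_or_zero hE (t j) with h | h
          · rw [deg_eq_weight hd, h]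
          · exact absurd (by rw [h (x j), map_zero, map_zero]) (hx j)
        have hy : ∀ j i, E.phi ev d _ (E.args f g
            (fun j => ∑ j' with j < j', (t j').deg E.deg) j y i) =
            (-1) ^ (d * ((∑ j' with j < j', ((Per.fib g j').k + 1)) *
              ((Per.fib f (Per.emb g j i)).k + 1))) * E.phi ev d _ (y (Per.emb g j i)) := by
          intro j i
          rw [args_eq, apply_castL (fun α => E.phi ev d α), twist_apply hE hd]
          have two : (2 : ZMod 2) = 0 := rfl
          have hdd : (d * d : ZMod 2) = d := by
            generalize (d : ZMod 2) = z; revert z; decide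
          have hs : ∀ (s : ℤˣ) (z : E.F (Per.fib f (Per.emb g j i))),
              E.phi ev d _ (s • z) = s • E.phi ev d _ z := fun s z => by
            rcases Int.units_eq_one_or s with rfl | rfl <;> simp
          rw [hs]
          refine Int.negOnePow_smul_eq ?_ _
          have e1 : ∀ a : ZMod 2, a - 1 = a + 1 := by decide
          push_cast
          simp only [hw]
          push_cast
          simp only [e1, ← Finset.mul_sum]
          linear_combination (∑ j' with j < j', ((((Per.fib g j').k : ℕ) : ZMod 2) + 1)) *
            (((Per.fib f (Per.emb g j i)).k : ZMod 2) + 1) * hdd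
        simp only [ih, hy, Finset.prod_mul_distrib]
        rw [prod_emb 𝕜 g fun i => E.phi ev d _ (y i)]
        simp only [Finset.prod_pow_eq_pow_sum]
        have hs := Per.susp_comp f g
        have hs' : (-1 : 𝕜) ^ (d * Per.susp (f ≫ g)) *
            ((-1) ^ (∑ j, d * Per.susp (Per.fibMap f g j)) *
          (-1) ^ (∑ j, ∑ i, d * ((∑ j' with j < j', ((Per.fib g j').k + 1)) *
              ((Per.fib f (Per.emb g j i)).k + 1)))) =
            (-1) ^ (d * Per.susp f) * (-1) ^ (d * Per.susp g) := by
          rw [← pow_add, ← pow_add, ← pow_add]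
          refine neg_one_pow_eq_of_zmod ?_
          simp only [← Finset.mul_sum, ← mul_add]
          rw [← add_assoc, Nat.cast_mul, hs, Nat.cast_mul]
        linear_combination (ev _ e * (∏ j, E.phi ev d _ (E.of (t j) (x j))) *
          ∏ i, E.phi ev d _ (y i)) * hs'
    · intro β x y hx hy α f z
      rw [map_add, add_apply, map_add, hx, hy, map_add]; ring
    · intro β α f z
      rw [map_zero]; simp

end PerColl

/-! ### Ideals with one-dimensional quotients -/

namespace Per

/-- The size of the first fiber. -/
abbrev fst {α β : Per} (f : α ⟶ β) : ℕ := (fib f ⟨0, β.pos⟩).k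

theorem fst_comp {α β δ : Per} (f : α ⟶ β) (g : β ⟶ δ) (c : ℕ → ℕ)
    (hc : ∀ i, (fib f i).k = c i) : fst (f ≫ g) = ∑ i ∈ Finset.range (fst g), c i := by
  rw [fst, fib_comp_k, Finset.sum_range]
  refine Finset.sum_congr rfl fun i _ => ?_
  have h0 : (Finset.univ.filter fun i' : Fin δ.k => i' < ⟨0, δ.pos⟩) = ∅ := by
    ext i'; simp [Fin.lt_def]
  rw [hc, emb_val, h0, Finset.sum_empty, zero_add]

theorem sum_of_two {M : Type*} [AddCommMonoid M] {r : ℕ} (hr : r = 2) (c : Fin r → M) :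
    ∑ i, c i = c ⟨0, by omega⟩ + c ⟨1, by omega⟩ := by
  subst hr; exact Fin.sum_univ_two c

theorem fst_lt {α β : Per} (f : α ⟶ β) (hβ : β.k = 2) : fst f < α.k := by
  rw [← sum_fib f, sum_of_two hβ]
  exact Nat.lt_add_of_pos_right (fib_k_pos _ _)

theorem snd_eq {α β : Per} (f : α ⟶ β) (hβ : β.k = 2) :
    (fib f ⟨1, by omega⟩).k = α.k - fst f := by
  have := sum_fib f
  rw [sum_of_two hβ] at this
  exact (Nat.sub_eq_of_eq_add' this.symm).symm

theorem fib_lt {α β : Per} (f : α ⟶ β) (hβ : 2 ≤ β.k) (i : Fin β.k) : (fib f i).k < α.k := by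
  have h1 : ∃ j, j ≠ i := by
    by_cases h : (i : ℕ) = 0
    · exact ⟨⟨1, hβ⟩, fun h' => by rw [← h'] at h; simp at h⟩
    · exact ⟨⟨0, β.pos⟩, fun h' => h (by rw [← h'])⟩
  obtain ⟨j, hj⟩ := h1
  rw [← sum_fib f, ← Finset.add_sum_erase _ _ (Finset.mem_univ i)]
  exact Nat.lt_add_of_pos_right
    ((fib_k_pos f j).trans_le (Finset.single_le_sum (f := fun i => (fib f i).k)
      (fun _ _ => Nat.zero_le _) (Finset.mem_erase.2 ⟨hj, Finset.mem_univ j⟩)))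

/-- A morphism to an object of cardinality two is determined by the size of its first fiber. -/
theorem sigma_ext_two {α β β' : Per} (f : α ⟶ β) (f' : α ⟶ β') (hβ : β.k = 2) (hβ' : β'.k = 2)
    (h : fst f = fst f') : (⟨β, f⟩ : Σ β : Per, α ⟶ β) = ⟨β', f'⟩ := by
  refine sigma_ext_of_card f f' (hβ.trans hβ'.symm) fun i => ?_
  have h0 : i = ⟨0, β.pos⟩ ∨ i = ⟨1, by omega⟩ := by
    have := i.2
    simp only [Fin.ext_iff]
    omega
  rcases h0 with rfl | rfl
  · exact h
  · rw [snd_eq f hβ, h]; exact (snd_eq f' hβ').symm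

theorem exists_two (α : Per) {a : ℕ} (h0 : 0 < a) (ha : a < α.k) :
    ∃ (β : Per) (f : α ⟶ β), β.k = 2 ∧ fst f = a := by
  obtain ⟨β, f, hk, h⟩ := exists_hom α ![a, α.k - a]
    (Fin.forall_fin_two.2 ⟨h0, Nat.sub_pos_of_lt ha⟩)
    (by rw [Fin.sum_univ_two]; simp; omega)
  exact ⟨β, f, hk, (h _).trans rfl⟩

/-- Reassociation: the morphism with fibers of sizes `(a, b)`, `a ≥ 2`, and the one with fibers of
sizes `(1, a + b - 1)` factor through a common object of cardinality three. -/
theorem exists_three {α β : Per} (f : α ⟶ β) (hβ : β.k = 2) (hf : 2 ≤ fst f) :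
    ∃ (δ β' β'' : Per) (h : α ⟶ δ) (g' : δ ⟶ β') (g'' : δ ⟶ β''), δ.k = 3 ∧ β'.k = 2 ∧
      β''.k = 2 ∧ (⟨β, f⟩ : Σ β : Per, α ⟶ β) = ⟨β', h ≫ g'⟩ ∧ fst (h ≫ g'') = 1 := by
  have ha := fst_lt f hβ
  let c : ℕ → ℕ := fun i => if i = 0 then 1 else if i = 1 then fst f - 1 else α.k - fst f
  obtain ⟨δ, h, hδ, hh⟩ := exists_hom α (r := 3) (fun i => c i)
    (by intro i; fin_cases i <;> simp [c] <;> omega)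
    (by rw [Fin.sum_univ_three]; simp [c]; omega)
  obtain ⟨β', g', hβ', hg'⟩ := exists_two δ (a := 2) (by omega) (by omega)
  obtain ⟨β'', g'', hβ'', hg''⟩ := exists_two δ (a := 1) (by omega) (by omega)
  refine ⟨δ, β', β'', h, g', g'', hδ, hβ', hβ'', sigma_ext_two _ _ hβ hβ' ?_, ?_⟩
  · rw [fst_comp h g' c hh, hg']
    simp [Finset.sum_range_succ, c]; omega
  · rw [fst_comp h g'' c hh, hg'']
    simp [c]

end Per

namespace PerColl

variable {𝕜 : Type u} [Field 𝕜] {E : PerColl 𝕜} {ev : ∀ α, E.obj α →ₗ[𝕜] 𝕜} {d : ℕ}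

/-- A nonzero linear functional is nonzero on some homogeneous element. -/
theorem exists_of_ne_zero {α : Per} (φ : E.F α →ₗ[𝕜] 𝕜) {z : E.F α} (hz : φ z ≠ 0) :
    ∃ t x, φ (E.of t x) ≠ 0 := by
  by_contra! h
  refine hz ?_
  induction z using E.F_add_induction with
  | hof t x => exact h t x
  | hadd x y hx hy =>
    rw [map_add]
    by_contra h'
    rcases not_and_or.1 (fun h'' : φ x = 0 ∧ φ y = 0 => h' (by rw [h''.1, h''.2, add_zero])) with
      h | h
    · exact h (hx h)
    · exact h (hy h)
  | hzero => exact map_zero _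

theorem node_sub_mem {I : ∀ α, Submodule 𝕜 (E.F α)} (hI : E.IsIdeal I) {α β : Per} (f : α ⟶ β)
    (h : 2 ≤ β.k) (e : E.obj β) {x z : ∀ i, E.F (Per.fib f i)}
    (hxz : ∀ i, x i - z i ∈ I _) : E.node f h e x - E.node f h e z ∈ I α := by
  refine (E.node f h e).congr_of_sub_mem (fun i => I (Per.fib f i)) (I α) (fun y i hy => ?_) hxz
  rw [← comp_gen]
  exact hI.right f _ y i hy

/-- If an ideal contains the kernel of `phi` on the elements of two fibers, an element with these
two subtrees is determined up to a scalar modulo the ideal. -/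
theorem exists_node_sub_mem {I : ∀ α, Submodule 𝕜 (E.F α)} (hI : E.IsIdeal I) {α β : Per}
    (f : α ⟶ β) (h : 2 ≤ β.k) (e g : E.obj β) (he : ∃ c : 𝕜, e = c • g)
    (hK : ∀ i (x : E.F (Per.fib f i)), E.phi ev d _ x = 0 → x ∈ I _)
    (x z : ∀ i, E.F (Per.fib f i)) (hz : ∀ i, E.phi ev d _ (z i) ≠ 0) :
    ∃ c : 𝕜, E.node f h e x - c • E.node f h g z ∈ I α := by
  obtain ⟨c, rfl⟩ := he
  let r : Fin β.k → 𝕜 := fun i => E.phi ev d _ (x i) / E.phi ev d _ (z i)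
  refine ⟨c * ∏ i, r i, ?_⟩
  rw [mul_smul, ← MultilinearMap.map_smul_univ, ← smul_apply, ← map_smul]
  refine node_sub_mem hI f h _ fun i => hK i _ ?_
  rw [map_sub, map_smul, smul_eq_mul, div_mul_cancel₀ _ (hz i), sub_self]

/-- Modulo an ideal which makes the two composites over objects of cardinality three proportional,
some tree with root `f` is proportional to a tree with root `f₁`, the first fiber of `f₁` having
size one. -/
theorem exists_reassoc (hE : E.Binary) (hd : ∀ α, E.deg α = d) (g : ∀ α, E.obj α)
    (hg : ∀ α, α.k = 2 → ev α (g α) ≠ 0) {I : ∀ α, Submodule 𝕜 (E.F α)} (hI : E.IsIdeal I)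
    (h3 : ∀ α, α.k = 3 → ∀ x, E.phi ev d α x = 0 → x ∈ I α) {α β β₁ : Per}
    (ex : ∀ δ : Per, δ.k < α.k → ∃ t x, E.phi ev d δ (E.of t x) ≠ 0)
    (f : α ⟶ β) (hβ : β.k = 2) (hf : 2 ≤ Per.fst f) (f₁ : α ⟶ β₁) (hβ₁ : β₁.k = 2)
    (hf₁ : Per.fst f₁ = 1) :
    ∃ (w : ∀ i, E.F (Per.fib f i)) (w₁ : ∀ i, E.F (Per.fib f₁ i)) (c : 𝕜),
      (∀ i, E.phi ev d _ (w i) ≠ 0) ∧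
      E.node f hβ.ge (g β) w - c • E.node f₁ hβ₁.ge (g β₁) w₁ ∈ I α := by
  have hα3 := Per.fst_lt f hβ
  obtain ⟨δ, β', β'', q, g', g'', hδ, hβ', hβ'', hff, hf'⟩ := Per.exists_three f hβ hf
  have hff₁ := Per.sigma_ext_two f₁ (q ≫ g'') hβ₁ hβ'' (hf₁.trans hf'.symm)
  cases hff
  cases hff₁
  choose s hs using fun i => ex _ ((Per.fib_lt g' hβ.ge i).trans_le (Per.k_le q))
  choose v hv using hs
  choose s' hs' using fun i => ex _ ((Per.fib_lt g'' hβ₁.ge i).trans_le (Per.k_le q))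
  choose v' hv' using hs'
  choose r y hy using fun i => ex _ (Per.fib_lt q (by omega) i)
  -- the two composites over the object `δ` of cardinality three
  set u := E.node g' hβ.ge (g β) fun i => E.of (s i) (v i) with hu
  set u' := E.node g'' hβ₁.ge (g β₁) fun i => E.of (s' i) (v' i) with hu'
  have hphi' : E.phi ev d _ u' ≠ 0 := by
    rw [hu', phi_node]
    exact mul_ne_zero (mul_ne_zero (pow_ne_zero _ (neg_ne_zero.2 one_ne_zero)) (hg _ hβ₁))
      (Finset.prod_ne_zero_iff.2 fun i _ => hv' i)
  have huu : u - (E.phi ev d _ u / E.phi ev d _ u') • u' ∈ I δ := by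
    refine h3 δ hδ _ ?_
    rw [map_sub, map_smul, smul_eq_mul, div_mul_cancel₀ _ hphi', sub_self]
  have hcomp := hI.left q _ (fun i => E.of (r i) (y i)) huu
  rw [map_sub, map_smul, sub_apply, smul_apply, hu, hu', comp_node, comp_node] at hcomp
  refine ⟨_, _, _, fun j => ?_, hcomp⟩
  rw [phi_comp ev d hE hd]
  refine mul_ne_zero (mul_ne_zero (pow_ne_zero _ (neg_ne_zero.2 one_ne_zero)) (hv j))
    (Finset.prod_ne_zero_iff.2 fun i _ => ?_)
  rw [args_eq, apply_castL (fun α => E.phi ev d α), twist_apply hE hd]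
  have := hy (Per.emb g' j i)
  generalize Int.negOnePow _ = n
  rcases Int.units_eq_one_or n with rfl | rfl
  · simpa using this
  · simpa using this

/-- In a free operad on at most one binary generator over each object, with relations making the
two composites over each object of cardinality three proportional, all the components of the
quotient are at most one-dimensional: two trees are connected by reassociations, up to
proportionality. -/
theorem ker_phi_le (hE : E.Binary) (hd : ∀ α, E.deg α = d) (g : ∀ α, E.obj α)
    (hg : ∀ α, α.k = 2 → ev α (g α) ≠ 0) (hspan : ∀ α (e : E.obj α), ∃ c : 𝕜, e = c • g α)
    {I : ∀ α, Submodule 𝕜 (E.F α)} (hI : E.IsIdeal I)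
    (hle : ∀ α x, x ∈ I α → E.phi ev d α x = 0)
    (h3 : ∀ α, α.k = 3 → ∀ x, E.phi ev d α x = 0 → x ∈ I α) (α : Per) :
    (∃ z, E.phi ev d α z ≠ 0) ∧ ∀ x, E.phi ev d α x = 0 → x ∈ I α := by
  induction hk : α.k using Nat.strong_induction_on generalizing α with
  | _ k ih =>
  subst hk
  -- it suffices to find one element which spans the quotient by the ideal
  suffices hz : ∃ z, E.phi ev d α z ≠ 0 ∧ ∀ t (x : E.T t), ∃ c : 𝕜, E.of t x - c • z ∈ I α by
    obtain ⟨z, hz0, hz⟩ := hz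
    refine ⟨⟨z, hz0⟩, fun x hx => ?_⟩
    have hx' : ∃ c : 𝕜, x - c • z ∈ I α := by
      clear hx
      induction x using E.F_add_induction with
      | hof t x => exact hz t x
      | hadd x y hx hy =>
        obtain ⟨c, hc⟩ := hx
        obtain ⟨c', hc'⟩ := hy
        refine ⟨c + c', ?_⟩
        rw [add_smul, add_sub_add_comm]
        exact add_mem hc hc'
      | hzero => exact ⟨0, by simp⟩
    obtain ⟨c, hc⟩ := hx'
    have h1 := hle α _ hc
    rw [map_sub, hx, map_smul, zero_sub, neg_eq_zero, smul_eq_mul, mul_eq_zero] at h1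
    rw [h1.resolve_right hz0, zero_smul, sub_zero] at hc
    exact hc
  by_cases h1 : α.k = 1
  · refine ⟨E.one h1, by rw [phi_one]; exact one_ne_zero, fun t x => ?_⟩
    cases t with
    | leaf h =>
      obtain ⟨c, hc⟩ := E.of_leaf h x
      exact ⟨c, by rw [hc, sub_self]; exact zero_mem _⟩
    | node f h t => exact absurd (Per.k_le f) (by omega)
  have hα := α.pos
  -- an element over a fiber on which `phi` does not vanish
  have ex : ∀ δ : Per, δ.k < α.k → ∃ t x, E.phi ev d δ (E.of t x) ≠ 0 := fun δ hδ => by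
    obtain ⟨z, hz⟩ := (ih δ.k hδ δ rfl).1
    exact exists_of_ne_zero _ hz
  have hK : ∀ {β : Per} (f : α ⟶ β), 2 ≤ β.k → ∀ i (x : E.F (Per.fib f i)),
      E.phi ev d _ x = 0 → x ∈ I _ := fun f hβ i => (ih _ (Per.fib_lt f hβ i) _ rfl).2
  obtain ⟨β₁, f₁, hβ₁, hf₁⟩ := Per.exists_two α (a := 1) one_pos (by omega)
  have hβ₁' : 2 ≤ β₁.k := hβ₁.ge
  choose t₁ x₁ hx₁ using fun i => ex _ (Per.fib_lt f₁ hβ₁' i)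
  refine ⟨E.node f₁ hβ₁' (g β₁) fun i => E.of (t₁ i) (x₁ i), ?_, fun t z => ?_⟩
  · rw [phi_node]
    exact mul_ne_zero (mul_ne_zero (pow_ne_zero _ (neg_ne_zero.2 one_ne_zero)) (hg _ hβ₁))
      (Finset.prod_ne_zero_iff.2 fun i _ => hx₁ i)
  cases t with
  | leaf h => exact absurd h h1
  | @node _ β f h t =>
  refine E.T_node_induction (p := fun x => ∃ c : 𝕜, E.of (.node f h t) x - c •
    E.node f₁ hβ₁' (g β₁) (fun i => E.of (t₁ i) (x₁ i)) ∈ I α) (fun e x => ?_)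
    (fun x y hx hy => ?_) ⟨0, by simp⟩ z
  swap
  · obtain ⟨c, hc⟩ := hx
    obtain ⟨c', hc'⟩ := hy
    refine ⟨c + c', ?_⟩
    rw [map_add, add_smul, add_sub_add_comm]
    exact add_mem hc hc'
  rw [← node_of]
  by_cases hβ : β.k = 2
  swap
  · have := hE β hβ
    exact ⟨0, by rw [Subsingleton.elim e 0]; simp⟩
  by_cases hf : Per.fst f = 1
  · have hff := Per.sigma_ext_two f f₁ hβ hβ₁ (hf.trans hf₁.symm)
    have hx := exists_node_sub_mem (ev := ev) (d := d) hI f h e (g β) (hspan _ e) (hK f h)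
      (fun i => E.of (t i) (x i))
    clear hK
    generalize (fun i => E.of (t i) (x i)) = y at hx ⊢
    clear x z t
    cases hff
    exact hx _ hx₁
  have hf2 : 2 ≤ Per.fst f := by
    have := Per.fib_k_pos f ⟨0, β.pos⟩
    unfold Per.fst at hf ⊢
    omega
  obtain ⟨w, w₁, c₁, hw, hc₁⟩ := exists_reassoc hE hd g hg hI h3 ex f hβ hf2 f₁ hβ₁ hf₁
  obtain ⟨c, hc⟩ := exists_node_sub_mem hI f h e (g β) (hspan _ e) (hK _ h)
    (fun i => E.of (t i) (x i)) w hw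
  obtain ⟨c', hc'⟩ := exists_node_sub_mem hI f₁ hβ₁' (g β₁) (g β₁) ⟨1, by simp⟩
    (hK _ hβ₁') w₁ _ hx₁
  refine ⟨c * (c₁ * c'), ?_⟩
  have := add_mem hc (Submodule.smul_mem _ c (add_mem hc₁ (Submodule.smul_mem _ c₁ hc')))
  convert this using 1
  simp only [smul_sub, smul_add, mul_smul]
  abel

end PerColl

/-! ### The pairing and the components of low cardinality -/

namespace PerColl

variable {𝕜 : Type u} [Field 𝕜] (E : PerColl 𝕜)

section Pair

/-- The components of the suspended dual, as linear functionals. -/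
def toDual (β : Per) : E.susDual.obj β →ₗ[𝕜] Module.Dual 𝕜 (E.obj β) := LinearMap.id

theorem pair_of {α : Per} (t : PTree α) (x : E.susDual.T t) (y : E.F α) :
    E.pair α (E.susDual.of t x) y = E.pairT t x (y t) := by
  rw [pair, lift_of]; rfl

theorem of_apply_self {α : Per} (t : PTree α) (x : E.T t) : E.of t x t = x :=
  DFinsupp.single_eq_same

theorem of_apply_ne {α : Per} {t s : PTree α} (h : t ≠ s) (x : E.T t) : E.of t x s = 0 :=
  DFinsupp.single_eq_of_ne h.symm

theorem pairT_tm {α β : Per} (f : α ⟶ β) (h : 2 ≤ β.k) (t : ∀ i, PTree (Per.fib f i))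
    (e : E.susDual.obj β) (x : ∀ i, E.susDual.T (t i)) (e' : E.obj β)
    (y : ∀ i, E.T (t i)) :
    E.pairT (.node f h t) (E.susDual.tm f h t e x) (E.tm f h t e' y) =
      E.toDual β e e' * ∏ i, E.pairT (t i) (x i) (y i) := by
  rw [pairT]
  change TensorProduct.dualDistrib 𝕜 (E.obj β) (⨂[𝕜] i, E.T (t i)) (E.toDual β e ⊗ₜ[𝕜]
    (PiTensorProduct.dualDistrib (PiTensorProduct.map (fun i => E.pairT (t i))
      (PiTensorProduct.tprod 𝕜 x)))) (e' ⊗ₜ[𝕜] PiTensorProduct.tprod 𝕜 y) = _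
  rw [PiTensorProduct.map_tprod, TensorProduct.dualDistrib_apply,
    PiTensorProduct.dualDistrib_apply]

theorem pair_node_of {α β : Per} (f : α ⟶ β) (h : 2 ≤ β.k) (e : E.susDual.obj β)
    (t : ∀ i, PTree (Per.fib f i)) (x : ∀ i, E.susDual.T (t i)) (e' : E.obj β)
    (s : ∀ i, PTree (Per.fib f i)) (y : ∀ i, E.T (s i)) :
    E.pair α (E.susDual.node f h e fun i => E.susDual.of (t i) (x i))
      (E.node f h e' fun i => E.of (s i) (y i)) =
      E.toDual β e e' * ∏ i, E.pair _ (E.susDual.of (t i) (x i)) (E.of (s i) (y i)) := by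
  rw [node_of, node_of, pair_of]
  simp only [pair_of]
  by_cases hst : s = t
  · subst hst
    simp only [of_apply_self]
    exact pairT_tm E f h s e x e' y
  · rw [of_apply_ne E (by simpa using hst), map_zero]
    obtain ⟨i, hi⟩ := Function.ne_iff.1 hst
    rw [Finset.prod_eq_zero (Finset.mem_univ i) (by rw [of_apply_ne E hi, map_zero]), mul_zero]

/-- The pairing of two trees with the same root. -/
theorem pair_node {α β : Per} (f : α ⟶ β) (h : 2 ≤ β.k) (e : E.susDual.obj β)
    (x : ∀ i, E.susDual.F (Per.fib f i)) (e' : E.obj β) (y : ∀ i, E.F (Per.fib f i)) :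
    E.pair α (E.susDual.node f h e x) (E.node f h e' y) =
      E.toDual β e e' * ∏ i, E.pair _ (x i) (y i) := by
  have key : ∀ (t : ∀ i, PTree (Per.fib f i)) (x : ∀ i, E.susDual.T (t i)),
      (E.pair α (E.susDual.node f h e fun i => E.susDual.of (t i) (x i))).compMultilinearMap
        (E.node f h e') = E.toDual β e e' • (MultilinearMap.mkPiAlgebra 𝕜 (Fin β.k) 𝕜).compLinearMap
          fun i => E.pair _ (E.susDual.of (t i) (x i)) := fun t x =>
    MultilinearMap.dfinsupp_ext fun s => MultilinearMap.ext fun y =>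
      pair_node_of E f h e t x e' s y
  have key' : ((E.pair α).flip (E.node f h e' y)).compMultilinearMap (E.susDual.node f h e) =
      E.toDual β e e' • (MultilinearMap.mkPiAlgebra 𝕜 (Fin β.k) 𝕜).compLinearMap
          fun i => (E.pair _).flip (y i) := by
    refine MultilinearMap.dfinsupp_ext fun t => MultilinearMap.ext fun x => ?_
    exact congrArg (fun m : MultilinearMap 𝕜 (fun i => E.F (Per.fib f i)) 𝕜 => m y) (key t x)
  exact congrArg (fun m : MultilinearMap 𝕜 (fun i => E.susDual.F (Per.fib f i)) 𝕜 => m x) key'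

/-- The pairing of two trees with different roots. -/
theorem pair_node_ne {α β β' : Per} (f : α ⟶ β) (f' : α ⟶ β')
    (hff : (⟨β, f⟩ : Σ β : Per, α ⟶ β) ≠ ⟨β', f'⟩) (h : 2 ≤ β.k) (h' : 2 ≤ β'.k)
    (e : E.susDual.obj β)
    (x : ∀ i, E.susDual.F (Per.fib f i)) (e' : E.obj β') (y : ∀ i, E.F (Per.fib f' i)) :
    E.pair α (E.susDual.node f h e x) (E.node f' h' e' y) = 0 := by
  have key : ∀ (t : ∀ i, PTree (Per.fib f i)) (x : ∀ i, E.susDual.T (t i)),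
      (E.pair α (E.susDual.node f h e fun i => E.susDual.of (t i) (x i))).compMultilinearMap
        (E.node f' h' e') = 0 := fun t x =>
    MultilinearMap.dfinsupp_ext fun s => MultilinearMap.ext fun y => by
      change E.pair α (E.susDual.node f h e fun i => E.susDual.of (t i) (x i))
        (E.node f' h' e' fun i => E.of (s i) (y i)) = 0
      rw [node_of, node_of, pair_of, of_apply_ne, map_zero]
      intro hst
      injection hst with _ h1 h2
      subst h1
      cases h2
      exact hff rfl
  have key' : ((E.pair α).flip (E.node f' h' e' y)).compMultilinearMap (E.susDual.node f h e) =
      0 := by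
    refine MultilinearMap.dfinsupp_ext fun t => MultilinearMap.ext fun x => ?_
    exact congrArg (fun m : MultilinearMap 𝕜 (fun i => E.F (Per.fib f' i)) 𝕜 => m y) (key t x)
  exact congrArg (fun m : MultilinearMap 𝕜 (fun i => E.susDual.F (Per.fib f i)) 𝕜 => m x) key'

theorem pair_one {α : Per} (h : α.k = 1) : E.pair α (E.susDual.one h) (E.one h) = 1 := by
  rw [one_eq, one_eq, pair_of, of_apply_self, pairT]
  exact mul_one (1 : 𝕜)

end Pair

section Small
variable {E} (g : ∀ α, E.obj α)

/-- The tree with at most one vertex, with label from the family `g`. -/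
noncomputable def un (α : Per) : E.F α := E.oneOrZero α + E.gen α (g α)

theorem un_of_one {α : Per} (h : α.k = 1) : un g α = E.one h := by
  rw [un, oneOrZero, dif_pos h, gen, dif_neg (by omega)]; simp

theorem un_of_two_le {α : Per} (h : 2 ≤ α.k) :
    un g α = E.node (𝟙 α) h (g α) fun i => un g (Per.fib (𝟙 α) i) := by
  rw [un, oneOrZero, dif_neg (by omega), zero_add, gen_eq_node E h]
  congr 1
  funext i
  rw [un_of_one g (Per.fib_id α i)]

variable {g}

theorem node_smul {α β : Per} (f : α ⟶ β) (h : 2 ≤ β.k) (e e' : E.obj β)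
    (he : ∃ c : 𝕜, e = c • e')
    (y y' : ∀ i, E.F (Per.fib f i)) (hy : ∀ i, ∃ c : 𝕜, y i = c • y' i) :
    ∃ c : 𝕜, E.node f h e y = c • E.node f h e' y' := by
  obtain ⟨c, rfl⟩ := he
  choose r hr using hy
  obtain rfl : y = fun i => r i • y' i := funext hr
  exact ⟨c * ∏ i, r i, by rw [map_smul, smul_apply, MultilinearMap.map_smul_univ, mul_smul]⟩

theorem exists_smul_of_tm {α β : Per} {f : α ⟶ β} {h : 2 ≤ β.k} {t : ∀ i, PTree (Per.fib f i)}
    {z : E.F α}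
    (hz : ∀ (e : E.obj β) (x : ∀ i, E.T (t i)),
      ∃ c : 𝕜, E.node f h e (fun i => E.of (t i) (x i)) = c • z)
    (x : E.T (.node f h t)) : ∃ c : 𝕜, E.of (.node f h t) x = c • z := by
  refine E.T_node_induction (p := fun x => ∃ c : 𝕜, E.of (.node f h t) x = c • z) (fun e x => ?_)
    (fun x y hx hy => ?_) ⟨0, by simp⟩ x
  · rw [← node_of]; exact hz e x
  · obtain ⟨c, hc⟩ := hx
    obtain ⟨c', hc'⟩ := hy
    exact ⟨c + c', by rw [map_add, hc, hc', add_smul]⟩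

theorem exists_smul_un (hspan : ∀ α (e : E.obj α), ∃ c : 𝕜, e = c • g α) {α : Per} (hα : α.k ≤ 2)
    (x : E.F α) : ∃ c : 𝕜, x = c • un g α := by
  have hadd : ∀ (β : Per), (∀ t (x : E.T t), ∃ c : 𝕜, E.of t x = c • un g β) →
      ∀ x : E.F β, ∃ c : 𝕜, x = c • un g β := by
    intro β h x
    induction x using E.F_add_induction with
    | hof t x => exact h t x
    | hadd x y hx hy =>
      obtain ⟨c, hc⟩ := hx
      obtain ⟨c', hc'⟩ := hy
      exact ⟨c + c', by rw [add_smul, ← hc, ← hc']⟩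
    | hzero => exact ⟨0, by simp⟩
  have h1 : ∀ (β : Per), β.k = 1 → ∀ x : E.F β, ∃ c : 𝕜, x = c • un g β := by
    intro β hβ
    refine hadd β fun t x => ?_
    cases t with
    | leaf h => rw [un_of_one g h]; exact E.of_leaf h x
    | node f h t => exact absurd (Per.k_le f) (by omega)
  by_cases hα1 : α.k = 1
  · exact h1 α hα1 x
  refine hadd α (fun t => ?_) x
  cases t with
  | leaf h => exact absurd h hα1
  | @node _ β f h t =>
    refine exists_smul_of_tm fun e x => ?_
    have hf := Per.eq_id_of_fib f (by have := Per.k_le f; have := α.pos; omega)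
    generalize (fun i => E.of (t i) (x i)) = y
    clear x t
    cases hf
    rw [un_of_two_le g h]
    exact node_smul _ _ _ _ (hspan _ e) _ _ fun i => h1 _ (Per.fib_id α i) _

/-- The elements over objects of cardinality three are linear combinations of two trees. -/
theorem exists_of_three (hE : E.Binary) (hspan : ∀ α (e : E.obj α), ∃ c : 𝕜, e = c • g α)
    {α β₁ β₂ : Per} (hα : α.k = 3) (f₁ : α ⟶ β₁) (f₂ : α ⟶ β₂) (h₁ : β₁.k = 2) (h₂ : β₂.k = 2)
    (hf₁ : Per.fst f₁ = 1) (hf₂ : Per.fst f₂ = 2) (x : E.F α) :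
    ∃ c₁ c₂ : 𝕜, x = c₁ • E.node f₁ h₁.ge (g β₁) (fun _ => un g _) +
      c₂ • E.node f₂ h₂.ge (g β₂) (fun _ => un g _) := by
  induction x using E.F_add_induction with
  | hadd x y hx hy =>
    obtain ⟨c₁, c₂, hc⟩ := hx
    obtain ⟨c₁', c₂', hc'⟩ := hy
    refine ⟨c₁ + c₁', c₂ + c₂', ?_⟩
    rw [hc, hc', add_smul, add_smul]
    abel
  | hzero => exact ⟨0, 0, by simp⟩
  | hof t x =>
    cases t with
    | leaf h => omega
    | @node _ β f h t =>
      by_cases hβ : β.k = 2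
      · have hsm : ∀ i, (Per.fib f i).k ≤ 2 := fun i => by
          have := Per.fib_lt f h i; omega
        obtain ⟨c, hc⟩ := exists_smul_of_tm (z := E.node f h (g β) fun i => un g _) (fun e x =>
          node_smul f h e (g β) (hspan _ e) _ _ fun i =>
            exists_smul_un hspan (hsm i) (E.of (t i) (x i))) x
        rw [hc]
        clear hc x t
        have h0 := Per.fib_k_pos f ⟨0, β.pos⟩
        have h1 := hsm ⟨0, β.pos⟩
        rcases (by unfold Per.fst; omega : Per.fst f = 1 ∨ Per.fst f = 2) with h2 | h2
        · cases Per.sigma_ext_two f f₁ hβ h₁ (h2.trans hf₁.symm)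
          exact ⟨c, 0, by rw [zero_smul, add_zero]⟩
        · cases Per.sigma_ext_two f f₂ hβ h₂ (h2.trans hf₂.symm)
          exact ⟨0, c, by rw [zero_smul, zero_add]⟩
      · obtain ⟨c, hc⟩ := exists_smul_of_tm (z := (0 : E.F α)) (fun e y => ⟨0, by
          have := hE β hβ
          rw [Subsingleton.elim e 0]; simp⟩) x
        exact ⟨0, 0, by rw [hc]; simp⟩

variable {ev : ∀ α, E.obj α →ₗ[𝕜] 𝕜} {d : ℕ}

theorem _root_.Per.susp_of_two {α β : Per} (f : α ⟶ β) (hβ : β.k = 2) :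
    Per.susp f = Per.fst f * (α.k - Per.fst f + 1) := by
  rw [Per.susp, Per.sum_of_two hβ, Per.snd_eq f hβ]
  have h0 : (Finset.univ.filter fun i' : Fin β.k => i' < ⟨0, β.pos⟩) = ∅ := by
    ext i'; simp [Fin.lt_def]
  have h1 : (Finset.univ.filter fun i' : Fin β.k => i' < ⟨1, by omega⟩) = {⟨0, β.pos⟩} := by
    ext i'
    simp [Fin.lt_def, Fin.ext_iff]
  rw [h0, h1]
  simp

theorem phi_un (hg : ∀ α, α.k = 2 → ev α (g α) = 1) {α : Per} (hα : α.k ≤ 2) :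
    E.phi ev d α (un g α) = 1 := by
  by_cases h1 : α.k = 1
  · rw [un_of_one g h1, phi_one]
  · have := α.pos
    have h2 : α.k = 2 := by omega
    have hs : Per.susp (𝟙 α) = 2 := by
      rw [Per.susp_of_two _ h2, Per.fst, Per.fib_id, h2]
    rw [un_of_two_le g h2.ge, phi_node, hg α h2, hs]
    have : ∀ i, E.phi ev d _ (un g (Per.fib (𝟙 α) i)) = 1 := fun i => by
      rw [un_of_one g (Per.fib_id α i), phi_one]
    simp [this, mul_comm d 2, pow_mul]

theorem phi_node_un (hg : ∀ α, α.k = 2 → ev α (g α) = 1) {α β : Per} (hα : α.k = 3) (f : α ⟶ β)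
    (hβ : β.k = 2) : E.phi ev d α (E.node f hβ.ge (g β) fun _ => un g _) =
      (-1) ^ (d * Per.susp f) := by
  rw [phi_node, hg β hβ, mul_one, Finset.prod_congr rfl fun i _ => phi_un hg
    (by have := Per.fib_lt f hβ.ge i; omega)]
  simp

theorem pair_un (g' : ∀ α, E.susDual.obj α)
    (hg' : ∀ α, α.k = 2 → E.toDual α (g' α) (g α) = 1)
    {α : Per} (hα : α.k ≤ 2) :
    E.pair α (un (E := E.susDual) g' α) (un g α) = 1 := by
  by_cases h1 : α.k = 1
  · rw [un_of_one g h1, un_of_one (E := E.susDual) g' h1, pair_one]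
  · have := α.pos
    have h2 : α.k = 2 := by omega
    rw [un_of_two_le g h2.ge, un_of_two_le (E := E.susDual) g' h2.ge, pair_node, hg' α h2, one_mul]
    refine Finset.prod_eq_one fun i _ => ?_
    have h3 := Per.fib_id α i
    rw [un_of_one g h3, un_of_one (E := E.susDual) g' h3, pair_one]

theorem pair_node_un (g' : ∀ α, E.susDual.obj α)
    (hg' : ∀ α, α.k = 2 → E.toDual α (g' α) (g α) = 1)
    {α β : Per} (hα : α.k = 3) (f : α ⟶ β) (hβ : β.k = 2) :
    E.pair α (E.susDual.node f hβ.ge (g' β) fun _ => un (E := E.susDual) g' _)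
      (E.node f hβ.ge (g β) fun _ => un g _) = 1 := by
  rw [pair_node, hg' β hβ, one_mul, Finset.prod_congr rfl fun i _ => pair_un g' hg'
    (by have := Per.fib_lt f hβ.ge i; omega)]
  simp

end Small

section Ideals
variable {E} {ev : ∀ α, E.obj α →ₗ[𝕜] 𝕜} {d : ℕ}

theorem ker_phi_isIdeal (hE : E.Binary) (hd : ∀ α, E.deg α = d) :
    E.IsIdeal fun α => LinearMap.ker (E.phi ev d α) where
  left f x y hx := by
    rw [LinearMap.mem_ker] at hx ⊢
    rw [phi_comp ev d hE hd, hx, mul_zero, zero_mul]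
  right f x y i hy := by
    rw [LinearMap.mem_ker] at hy ⊢
    rw [phi_comp ev d hE hd, Finset.prod_eq_zero (Finset.mem_univ i) hy, mul_zero]

theorem ideal_le {I R : ∀ α, Submodule 𝕜 (E.F α)} (hI : E.IsIdeal I) (h : ∀ α, R α ≤ I α)
    (α : Per) : E.ideal R α ≤ I α :=
  iInf_le (fun I : {I : ∀ α, Submodule 𝕜 (E.F α) // E.IsIdeal I ∧ ∀ α, R α ≤ I α} => I.1 α)
    ⟨I, hI, h⟩

theorem le_ideal (R : ∀ α, Submodule 𝕜 (E.F α)) (α : Per) : R α ≤ E.ideal R α :=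
  le_iInf fun I => I.2.2 α

/-- Over an object `α`, the free operad on a binary collection is concentrated in weight
`|α| - 1`. -/
theorem mem_weightPart (hE : E.Binary) {α : Per} (x : E.F α) : x ∈ E.weightPart (α.k - 1) α := by
  induction x using E.F_add_induction with
  | hof t x =>
    rcases weight_or_zero hE t with h | h
    · exact Submodule.mem_iSup_of_mem (⟨t, h⟩ : {t : PTree α // t.weight = (α.k : ℤ) - 1}) ⟨x, rfl⟩
    · rw [h x, map_zero]; exact zero_mem _
  | hadd x y hx hy => exact add_mem hx hy
  | hzero => exact zero_mem _

theorem weightPart_eq_bot (hE : E.Binary) {α : Per} {s : ℤ} (h : s ≠ α.k - 1) :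
    E.weightPart s α = ⊥ := by
  rw [weightPart, iSup_eq_bot]
  rintro ⟨t, ht⟩
  rw [LinearMap.range_eq_bot]
  refine LinearMap.ext fun x => ?_
  rw [(weight_or_zero hE t).resolve_left (fun h' => h (ht.symm.trans h')) x, map_zero, map_zero]

end Ideals

end PerColl

/-! ### The quadratic presentation of the terminal operad -/

namespace PerColl

variable (𝕜 : Type u) [Field 𝕜]

/-- The generators of the terminal operad: one binary operation over each object of
cardinality two. -/
noncomputable def binColl : PerColl 𝕜 where
  obj α := PLift (α.k = 2) → 𝕜
  deg _ := 0

/-- The basis vector of a component of cardinality two. -/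
def binGen (α : Per) : (binColl 𝕜).obj α := fun _ => 1

/-- The coordinate of a generator. -/
noncomputable def binEv (α : Per) : (binColl 𝕜).obj α →ₗ[𝕜] 𝕜 :=
  if h : α.k = 2 then LinearMap.proj (R := 𝕜) (φ := fun _ : PLift (α.k = 2) => 𝕜) ⟨h⟩ else 0

variable {𝕜}

theorem binary_binColl : (binColl 𝕜).Binary := fun _ h =>
  ⟨fun _ _ => funext fun p => absurd p.down h⟩

theorem binEv_apply {α : Per} (h : α.k = 2) (e : PLift (α.k = 2) → 𝕜) :
    binEv 𝕜 α e = e ⟨h⟩ :=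
  congrArg (fun φ : (PLift (α.k = 2) → 𝕜) →ₗ[𝕜] 𝕜 => φ e) (dif_pos h)

theorem binEv_gen (α : Per) (h : α.k = 2) : binEv 𝕜 α (binGen 𝕜 α) = 1 := binEv_apply h _

theorem bin_eq (α : Per) (e : (binColl 𝕜).obj α) : e = binEv 𝕜 α e • binGen 𝕜 α := by
  by_cases h : α.k = 2
  · rw [show binEv 𝕜 α e = _ from binEv_apply h e]
    exact funext fun p => (mul_one _).symm
  · exact (binary_binColl α h).elim _ _

theorem bin_span (α : Per) (e : (binColl 𝕜).obj α) : ∃ c : 𝕜, e = c • binGen 𝕜 α :=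
  ⟨_, bin_eq α e⟩

variable (𝕜)

/-- The projection of the free operad on `binColl` onto the terminal operad. -/
noncomputable abbrev binPhi (α : Per) : (binColl 𝕜).F α →ₗ[𝕜] 𝕜 :=
  (binColl 𝕜).phi (binEv 𝕜) 0 α

/-- The quadratic relations of the terminal operad. -/
noncomputable def binRel (α : Per) : Submodule 𝕜 ((binColl 𝕜).F α) :=
  (binColl 𝕜).weightPart 2 α ⊓ LinearMap.ker (binPhi 𝕜 α)

variable {𝕜}

theorem mem_binRel {α : Per} (hα : α.k = 3) {x : (binColl 𝕜).F α} :
    x ∈ binRel 𝕜 α ↔ binPhi 𝕜 α x = 0 := by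
  refine ⟨fun h => h.2, fun h => ⟨?_, h⟩⟩
  have := mem_weightPart binary_binColl x
  rwa [hα] at this

theorem ideal_binRel_le (α : Per) :
    (binColl 𝕜).ideal (binRel 𝕜) α ≤ LinearMap.ker (binPhi 𝕜 α) :=
  ideal_le (ker_phi_isIdeal binary_binColl fun _ => rfl) (fun _ => inf_le_right) α

/-- The free operad modulo the relations is one-dimensional over each object. -/
theorem exists_binPhi (α : Per) : (∃ z, binPhi 𝕜 α z ≠ 0) ∧
    ∀ x, binPhi 𝕜 α x = 0 → x ∈ (binColl 𝕜).ideal (binRel 𝕜) α :=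
  ker_phi_le binary_binColl (fun _ => rfl) (binGen 𝕜)
    (fun α h => by rw [binEv_gen α h]; exact one_ne_zero) bin_span (ideal_isIdeal _ _)
    (fun α x hx => ideal_binRel_le α hx)
    (fun α hα x hx => le_ideal _ _ ((mem_binRel hα).2 hx)) α

theorem binPhi_comp {α β : Per} (f : α ⟶ β) (x : (binColl 𝕜).F β)
    (y : ∀ i, (binColl 𝕜).F (Per.fib f i)) : binPhi 𝕜 α ((binColl 𝕜).comp f x y) =
      (onePer 𝕜).comp f (binPhi 𝕜 β x) fun i => binPhi 𝕜 _ (y i) := by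
  have h := phi_comp (binEv 𝕜) 0 binary_binColl (fun _ => rfl) f x y
  rw [zero_mul, pow_zero, one_mul] at h
  exact h

theorem binPhi_surjective (α : Per) : Function.Surjective (binPhi 𝕜 α) := by
  obtain ⟨z, hz⟩ := (exists_binPhi (𝕜 := 𝕜) α).1
  exact LinearMap.surjective fun h => hz (by rw [h]; rfl)

variable (𝕜) in
/-- The quadratic presentation of the terminal operad. -/
noncomputable def terminalPresentation : BinaryQuadratic (onePer 𝕜) where
  E := binColl 𝕜
  deg_eq _ := rfl
  binary := binary_binColl
  R := binRel 𝕜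
  quadratic _ := inf_le_left
  proj := binPhi 𝕜
  proj_one _ h := phi_one (𝕜 := 𝕜) _ _ _ h
  proj_comp := binPhi_comp
  surj := binPhi_surjective
  ker α := le_antisymm (fun x hx => (exists_binPhi α).2 x hx) (ideal_binRel_le α)

/-! ### The Koszul dual -/

theorem binary_susDual : (binColl 𝕜).susDual.Binary := fun α h =>
  ⟨fun a b => LinearMap.ext fun e => by
    have := binary_binColl (𝕜 := 𝕜) α h
    rw [Subsingleton.elim e 0]
    exact (LinearMap.map_zero ((binColl 𝕜).toDual α a)).trans
      (LinearMap.map_zero ((binColl 𝕜).toDual α b)).symm⟩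

variable (𝕜) in
/-- The dual basis of the generators. -/
noncomputable def susGen (α : Per) : (binColl 𝕜).susDual.obj α := binEv 𝕜 α

variable (𝕜) in
/-- The coordinate of a dual generator. -/
noncomputable def susEv (α : Per) : (binColl 𝕜).susDual.obj α →ₗ[𝕜] 𝕜 :=
  Module.Dual.eval 𝕜 ((binColl 𝕜).obj α) (binGen 𝕜 α)

theorem susEv_gen (α : Per) (h : α.k = 2) : susEv 𝕜 α (susGen 𝕜 α) = 1 := binEv_gen α h

theorem sus_eq (α : Per) (e : (binColl 𝕜).susDual.obj α) : e = susEv 𝕜 α e • susGen 𝕜 α := by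
  refine LinearMap.ext fun x => ?_
  have h := LinearMap.map_smul ((binColl 𝕜).toDual α e) (binEv 𝕜 α x) (binGen 𝕜 α)
  rw [← bin_eq α x] at h
  exact h.trans (mul_comm _ _)

theorem sus_span (α : Per) (e : (binColl 𝕜).susDual.obj α) : ∃ c : 𝕜, e = c • susGen 𝕜 α :=
  ⟨_, sus_eq α e⟩

variable (𝕜) in
/-- The morphism from the free operad on the dual generators to the suspension of the terminal
operad. -/
noncomputable abbrev susPhi (α : Per) : (binColl 𝕜).susDual.F α →ₗ[𝕜] 𝕜 :=
  (binColl 𝕜).susDual.phi (susEv 𝕜) 1 α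

/-- Over objects of cardinality three, the annihilator of the relations is spanned by the sum of
the two composites, which have opposite signs in the suspension. -/
theorem mem_perp_iff {α : Per} (hα : α.k = 3) (x : (binColl 𝕜).susDual.F α) :
    x ∈ (binColl 𝕜).perp (binRel 𝕜) α ↔ susPhi 𝕜 α x = 0 := by
  obtain ⟨β₁, f₁, h₁, hf₁⟩ := Per.exists_two α (a := 1) one_pos (by omega)
  obtain ⟨β₂, f₂, h₂, hf₂⟩ := Per.exists_two α (a := 2) two_pos (by omega)
  have hg : ∀ α, α.k = 2 → (binColl 𝕜).toDual α (susGen 𝕜 α) (binGen 𝕜 α) = 1 := binEv_gen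
  have p₁ : susPhi 𝕜 α _ = _ := phi_node_un (d := 1) susEv_gen hα f₁ h₁
  have p₂ : susPhi 𝕜 α _ = _ := phi_node_un (d := 1) susEv_gen hα f₂ h₂
  have q₁ : binPhi 𝕜 α _ = _ := phi_node_un (d := 0) binEv_gen hα f₁ h₁
  have q₂ : binPhi 𝕜 α _ = _ := phi_node_un (d := 0) binEv_gen hα f₂ h₂
  have r₁ := pair_node_un (susGen 𝕜) hg hα f₁ h₁
  have r₂ := pair_node_un (susGen 𝕜) hg hα f₂ h₂
  have hne : (⟨β₁, f₁⟩ : Σ β : Per, α ⟶ β) ≠ ⟨β₂, f₂⟩ := fun h => by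
    cases h; rw [hf₁] at hf₂; exact absurd hf₂ (by decide)
  have r₃ := (binColl 𝕜).pair_node_ne f₁ f₂ hne h₁.ge h₂.ge (susGen 𝕜 β₁)
    (fun i => un (E := (binColl 𝕜).susDual) (susGen 𝕜) _) (binGen 𝕜 β₂) (fun i => un (binGen 𝕜) _)
  have r₄ := (binColl 𝕜).pair_node_ne f₂ f₁ hne.symm h₂.ge h₁.ge (susGen 𝕜 β₂)
    (fun i => un (E := (binColl 𝕜).susDual) (susGen 𝕜) _) (binGen 𝕜 β₁) (fun i => un (binGen 𝕜) _)
  rw [Per.susp_of_two f₁ h₁, hf₁, hα] at p₁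
  rw [Per.susp_of_two f₂ h₂, hf₂, hα] at p₂
  rw [zero_mul, pow_zero] at q₁ q₂
  have hx := exists_of_three (𝕜 := 𝕜) binary_susDual sus_span hα f₁ f₂ h₁ h₂ hf₁ hf₂
  have hr := exists_of_three (𝕜 := 𝕜) binary_binColl bin_span hα f₁ f₂ h₁ h₂ hf₁ hf₂
  generalize (binColl 𝕜).susDual.node f₁ h₁.ge (susGen 𝕜 β₁)
    (fun i => un (E := (binColl 𝕜).susDual) (susGen 𝕜) (Per.fib f₁ i)) = A₁ at *
  generalize (binColl 𝕜).susDual.node f₂ h₂.ge (susGen 𝕜 β₂)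
    (fun i => un (E := (binColl 𝕜).susDual) (susGen 𝕜) (Per.fib f₂ i)) = A₂ at *
  generalize (binColl 𝕜).node f₁ h₁.ge (binGen 𝕜 β₁)
    (fun i => un (binGen 𝕜) (Per.fib f₁ i)) = B₁ at *
  generalize (binColl 𝕜).node f₂ h₂.ge (binGen 𝕜 β₂)
    (fun i => un (binGen 𝕜) (Per.fib f₂ i)) = B₂ at *
  obtain ⟨c₁, c₂, rfl⟩ := hx x
  have hpair : ∀ d₁ d₂ : 𝕜, (binColl 𝕜).pair α (c₁ • A₁ + c₂ • A₂) (d₁ • B₁ + d₂ • B₂) =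
      c₁ * d₁ + c₂ * d₂ := by
    intro d₁ d₂
    have h1 : ∀ y, (binColl 𝕜).pair α (c₁ • A₁ + c₂ • A₂) y =
        c₁ * (binColl 𝕜).pair α A₁ y + c₂ * (binColl 𝕜).pair α A₂ y := fun y => by
      rw [map_add, map_smul, map_smul]; rfl
    rw [h1, map_add, map_add, map_smul, map_smul, map_smul, map_smul, r₁, r₂, r₃, r₄]
    simp
  have hphi : susPhi 𝕜 α (c₁ • A₁ + c₂ • A₂) = - c₁ + c₂ := by
    rw [map_add, map_smul, map_smul, p₁, p₂]; norm_num
  have hphi' : ∀ d₁ d₂ : 𝕜, binPhi 𝕜 α (d₁ • B₁ + d₂ • B₂) = d₁ + d₂ := by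
    intro d₁ d₂
    rw [map_add, map_smul, map_smul, q₁, q₂]; simp
  rw [hphi]
  constructor
  · rintro ⟨-, hx⟩
    -- the relation of associativity
    have h := (Submodule.mem_dualAnnihilator _).1 hx ((1 : 𝕜) • B₁ + (-1 : 𝕜) • B₂)
      ((mem_binRel hα).2 (by rw [hphi']; ring))
    rw [hpair] at h
    linear_combination -h
  · intro hc
    refine ⟨?_, (Submodule.mem_dualAnnihilator _).2 fun r hr' => ?_⟩
    · have := mem_weightPart binary_susDual (c₁ • A₁ + c₂ • A₂)
      rwa [hα] at this
    · obtain ⟨d₁, d₂, rfl⟩ := hr r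
      rw [mem_binRel hα, hphi'] at hr'
      rw [hpair]
      linear_combination c₁ * hr' + d₂ * hc

theorem ideal_perp_le (α : Per) :
    (binColl 𝕜).susDual.ideal ((binColl 𝕜).perp (binRel 𝕜)) α ≤ LinearMap.ker (susPhi 𝕜 α) := by
  refine ideal_le (ker_phi_isIdeal binary_susDual fun _ => rfl) (fun α x hx => ?_) α
  by_cases hα : α.k = 3
  · exact (mem_perp_iff hα x).1 hx
  · have h := hx.1
    rw [weightPart_eq_bot binary_susDual (by omega)] at h
    rw [(Submodule.mem_bot 𝕜).1 h]
    exact zero_mem _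

/-- The Koszul dual is one-dimensional over each object. -/
theorem exists_susPhi (α : Per) : (∃ z, susPhi 𝕜 α z ≠ 0) ∧
    ∀ x, susPhi 𝕜 α x = 0 → x ∈ (binColl 𝕜).susDual.ideal ((binColl 𝕜).perp (binRel 𝕜)) α :=
  ker_phi_le binary_susDual (fun _ => rfl) (susGen 𝕜)
    (fun α h => by rw [susEv_gen α h]; exact one_ne_zero) sus_span (ideal_isIdeal _ _)
    (fun α x hx => ideal_perp_le α hx)
    (fun α hα x hx => le_ideal _ _ ((mem_perp_iff hα x).2 hx)) α

variable (𝕜) in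
/-- The components of the Koszul dual of the terminal operad. -/
abbrev Kos (α : Per) : Type u := (binColl 𝕜).KDual (binRel 𝕜) α

variable (𝕜) in
/-- The basis of a component of the dual of the Koszul dual. -/
noncomputable def kosPhi (α : Per) : Kos 𝕜 α →ₗ[𝕜] 𝕜 :=
  Submodule.liftQ _ (susPhi 𝕜 α) (ideal_perp_le α)

theorem kosPhi_mk {α : Per} (x : (binColl 𝕜).susDual.F α) :
    kosPhi 𝕜 α ((binColl 𝕜).toKDual (binRel 𝕜) α x) = susPhi 𝕜 α x := rfl

theorem toKDual_surjective (α : Per) :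
    Function.Surjective ((binColl 𝕜).toKDual (binRel 𝕜) α) := Submodule.mkQ_surjective _

theorem kosPhi_injective (α : Per) : Function.Injective (kosPhi 𝕜 α) := by
  rw [injective_iff_map_eq_zero]
  intro x hx
  obtain ⟨x, rfl⟩ := toKDual_surjective α x
  exact (Submodule.Quotient.mk_eq_zero _).2 ((exists_susPhi α).2 x hx)

theorem kosPhi_surjective (α : Per) : Function.Surjective (kosPhi 𝕜 α) := by
  obtain ⟨z, hz⟩ := (exists_susPhi (𝕜 := 𝕜) α).1
  exact LinearMap.surjective fun h => hz (by rw [← kosPhi_mk, h]; rfl)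

instance (α : Per) : Module.Finite 𝕜 (Kos 𝕜 α) :=
  Module.Finite.of_injective (kosPhi 𝕜 α) (kosPhi_injective α)

theorem kos_span (α : Per) (φ : Module.Dual 𝕜 (Kos 𝕜 α)) : ∃ c : 𝕜, φ = c • kosPhi 𝕜 α := by
  obtain ⟨z, hz⟩ := kosPhi_surjective (𝕜 := 𝕜) α 1
  refine ⟨φ z, LinearMap.ext fun x => ?_⟩
  have hx : x = kosPhi 𝕜 α x • z := kosPhi_injective α (by rw [map_smul, hz]; simp)
  conv_lhs => rw [hx, map_smul]
  exact mul_comm _ _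

theorem kosPhi_kcirc {α : Per} (p : α.Elem) (x : Kos 𝕜 p.tgt.1)
    (y : Kos 𝕜 (Per.fib p.tgt.2 p.i)) :
    kosPhi 𝕜 α ((binColl 𝕜).kcirc (binRel 𝕜) p.tgt.2 p.i x y) =
      (-1) ^ Per.susp p.tgt.2 * (kosPhi 𝕜 _ x * kosPhi 𝕜 _ y) := by
  obtain ⟨x, rfl⟩ := toKDual_surjective _ x
  obtain ⟨y, rfl⟩ := toKDual_surjective _ y
  change susPhi 𝕜 α ((binColl 𝕜).susDual.circ p.tgt.2 p.i x y) = _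
  rw [circ, LinearMap.mk₂_apply, susPhi, phi_comp _ _ binary_susDual (fun _ => rfl)]
  rw [Finset.prod_eq_single p.i]
  · rw [Function.update_self, mul_assoc, Nat.one_mul]; rfl
  · intro j _ hj
    rw [Function.update_of_ne hj, oneOrZero, dif_pos (p.triv j hj), phi_one]
  · exact fun h => absurd (Finset.mem_univ _) h

/-- The duals of the partial compositions of the Koszul dual map basis vectors to basis vectors, up
to the signs of the suspension. -/
theorem coop_kosPhi {α : Per} (p : α.Elem) :
    (binColl 𝕜).coop (binRel 𝕜) p.tgt.2 p.i (kosPhi 𝕜 α) =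
      (-1 : 𝕜) ^ Per.susp p.tgt.2 • (kosPhi 𝕜 p.tgt.1 ⊗ₜ kosPhi 𝕜 (Per.fib p.tgt.2 p.i)) := by
  rw [coop, LinearMap.comp_apply]
  refine (LinearEquiv.symm_apply_eq _).2 ?_
  refine TensorProduct.ext' fun x y => ?_
  rw [map_smul]
  change kosPhi 𝕜 α ((binColl 𝕜).kcirc (binRel 𝕜) p.tgt.2 p.i x y) = _
  rw [kosPhi_kcirc]
  rfl

variable (𝕜) in
/-- The generators of the dual dg operad of the Koszul dual of the terminal operad. -/
noncomputable abbrev cob : PerColl 𝕜 := (binColl 𝕜).cobarColl (binRel 𝕜)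

variable (𝕜) in
/-- The basis of the generators of the dual dg operad. -/
noncomputable def cobGen (α : Per) : (cob 𝕜).obj α := kosPhi 𝕜 α

theorem cob_span (α : Per) (e : (cob 𝕜).obj α) : ∃ c : 𝕜, e = c • cobGen 𝕜 α := kos_span α e

theorem sum_negOnePow_apply {ι V W : Type*} {X Y : ι → Type*} [Fintype ι] [AddCommGroup V]
    [Module 𝕜 V] [∀ i, AddCommGroup (X i)] [∀ i, Module 𝕜 (X i)] [∀ i, AddCommGroup (Y i)]
    [∀ i, Module 𝕜 (Y i)] [AddCommGroup W] [Module 𝕜 W] (k : ι → ℕ)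
    (A : ∀ i, X i →ₗ[𝕜] Y i →ₗ[𝕜] W) (B : ∀ i, V →ₗ[𝕜] X i ⊗[𝕜] Y i) (x : V) (c : ι → 𝕜)
    (a : ∀ i, X i) (b : ∀ i, Y i) (hB : ∀ i, B i x = c i • (a i ⊗ₜ b i)) :
    (∑ i, (((k i : ℤ) - 1).negOnePow : ℤˣ) • TensorProduct.lift (A i) ∘ₗ B i) x =
      ∑ i, ((-1 : 𝕜) ^ (k i + 1) * c i) • A i (a i) (b i) := by
  rw [LinearMap.sum_apply]
  refine Finset.sum_congr rfl fun i _ => ?_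
  have h1 : ((k i : ℤ) - 1).negOnePow = ((k i + 1 : ℕ) : ℤ).negOnePow := by
    rw [Int.negOnePow_eq_iff]
    exact ⟨-1, by push_cast; ring⟩
  rw [h1, mul_smul, ← TensorProduct.lift.tmul, ← map_smul, ← hB]
  rcases Nat.even_or_odd (k i + 1) with hm | hm
  · rw [Int.negOnePow_even _ (by exact_mod_cast hm), hm.neg_one_pow, one_smul, one_smul]
    rfl
  · rw [Int.negOnePow_odd _ (by exact_mod_cast hm), hm.neg_one_pow]
    simp

theorem zeta_eq_of_coop (E : PerColl 𝕜) (R : ∀ α, Submodule 𝕜 (E.F α))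
    [∀ α, Module.Finite 𝕜 (E.KDual R α)] (φ : ∀ α, Module.Dual 𝕜 (E.KDual R α)) (α : Per)
    (c : α.Elem → 𝕜) (h : ∀ p : α.Elem, E.coop R p.tgt.2 p.i (φ α) = c p • (φ _ ⊗ₜ φ _)) :
    E.zeta R α (φ α) = ∑ p : α.Elem, ((-1 : 𝕜) ^ (p.tgt.1.k + 1) * c p) •
      (E.cobarColl R).circ p.tgt.2 p.i ((E.cobarColl R).gen _ (φ p.tgt.1))
          ((E.cobarColl R).gen _ (φ (Per.fib p.tgt.2 p.i))) :=
  sum_negOnePow_apply (fun p : α.Elem => p.tgt.1.k)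
    (fun p => ((E.cobarColl R).circ p.tgt.2 p.i).compl₁₂ ((E.cobarColl R).gen p.tgt.1)
      ((E.cobarColl R).gen (Per.fib p.tgt.2 p.i))) _ _ c _ _ h

/-- The differential of the dual dg operad on the basis of the generators. -/
theorem zeta_cobGen (α : Per) :
    (binColl 𝕜).zeta (binRel 𝕜) α (cobGen 𝕜 α) =
      ∑ p : α.Elem, ((-1 : 𝕜) ^ (p.tgt.1.k + 1) * (-1) ^ Per.susp p.tgt.2) •
        (cob 𝕜).circ p.tgt.2 p.i ((cob 𝕜).gen _ (cobGen 𝕜 p.tgt.1))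
          ((cob 𝕜).gen _ (cobGen 𝕜 (Per.fib p.tgt.2 p.i))) :=
  zeta_eq_of_coop (binColl 𝕜) (binRel 𝕜) (kosPhi 𝕜) α _ coop_kosPhi

end PerColl

/-! ### The differential on planar trees in terms of intervals of inputs -/

namespace ForestAlg
open Tr
variable {𝕜 : Type u} [Field 𝕜]

theorem sum_range_intervals {M : Type*} [AddCommGroup M] (r : ℕ) (hr : 2 ≤ r) (T : ℕ → ℕ → M)
    (h0 : ∀ i, T i 0 = 0) :
    ∑ i ∈ Finset.range r, ∑ n ∈ Finset.range (r - i + 1), T i n =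
      ∑ x ∈ Per.Elem.intervals r, T x.1 x.2 + ∑ i ∈ Finset.range r, T i 1 + T 0 r := by
  have h1 : ∀ i ∈ Finset.range r, ∑ n ∈ Finset.range (r - i + 1), T i n =
      ∑ n ∈ Finset.range r, (if 2 ≤ n ∧ i + n ≤ r then T i n else 0) + T i 1 +
        if i = 0 then T i r else 0 := by
    intro i hi
    rw [Finset.mem_range] at hi
    have h2 : ∑ n ∈ Finset.range (r - i + 1), T i n =
        ∑ n ∈ Finset.range (r + 1), if i + n ≤ r then T i n else 0 := by
      rw [← Finset.sum_filter]
      refine Finset.sum_congr ?_ fun _ _ => rfl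
      ext n
      simp only [Finset.mem_range, Finset.mem_filter]
      omega
    have h3 : T i 1 = ∑ n ∈ Finset.range r, if n = 1 then T i n else 0 := by
      rw [Finset.sum_ite_eq', if_pos (Finset.mem_range.2 (by omega))]
    rw [h2, Finset.sum_range_succ, h3, ← Finset.sum_add_distrib]
    congr 1
    · refine Finset.sum_congr rfl fun n _ => ?_
      rcases (by omega : n = 0 ∨ n = 1 ∨ 2 ≤ n) with rfl | rfl | hn
      · simp [h0]
      · rw [if_pos (by omega), if_neg (by omega), if_pos rfl, zero_add]
      · rw [if_neg (by omega : ¬ n = 1), add_zero]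
        simp [hn]
    · by_cases hi0 : i = 0
      · simp [hi0]
      · rw [if_neg hi0, if_neg (by omega)]
  rw [Finset.sum_congr rfl h1, Finset.sum_add_distrib, Finset.sum_add_distrib]
  congr 1
  · congr 1
    rw [Per.Elem.intervals, Finset.sum_filter, Finset.sum_product]
  · rw [Finset.sum_ite_eq', if_pos (Finset.mem_range.2 (by omega))]

/-- The forest obtained by grafting the `b` trees starting from position `a` to a new root. -/
def _root_.Tr.contract (L : List Tr) (x : ℕ × ℕ) : List Tr :=
  L.take x.1 ++ Tr.node ((L.drop x.1).take x.2) :: L.drop (x.1 + x.2)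

/-- The differential of a tree, as a sum over the intervals of inputs of the root and over the
inputs of the root. -/
theorem neg_dTree_node {L : List Tr} (hL : 2 ≤ L.length) :
    - dTree 𝕜 (.node L) =
      ∑ x ∈ Per.Elem.intervals L.length, sgL 𝕜 (L.take x.1) • w [.node (contract L x)] +
      ∑ i : Fin L.length, sgL 𝕜 (L.take i) •
        nd (w (L.take i) * dTree 𝕜 L[i] * w (L.drop (i + 1))) := by
  let T : ℕ → ℕ → ForestAlg 𝕜 := fun i n => sgL 𝕜 (L.take i) •
    nd (w (L.take i) * M (w ((L.drop i).take n)) * w (L.drop (i + n)))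
  have hb : nd (b M (w L)) = ∑ i ∈ Finset.range L.length,
      ∑ n ∈ Finset.range (L.length - i + 1), T i n := by
    rw [b_w, map_sum]
    refine Finset.sum_congr rfl fun i _ => ?_
    rw [P_w, List.length_drop, Finset.mul_sum, Finset.smul_sum, map_sum]
    refine Finset.sum_congr rfl fun n _ => ?_
    rw [map_smul, List.drop_drop, ← mul_assoc]
  rw [dTree_node hL, neg_neg, map_sub, hb, sum_range_intervals _ hL T]
  · have h1 : T 0 L.length = nd (M (w L)) := by simp [T]
    rw [h1, add_sub_cancel_right]
    congr 1
    · refine Finset.sum_congr rfl fun x hx => ?_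
      simp only [Per.Elem.intervals, Finset.mem_filter, Finset.mem_product, Finset.mem_range] at hx
      simp only [T]
      rw [M_of_two_le (by rw [List.length_take, List.length_drop]; omega), ← w_append, ← w_append,
        nd_w, contract]
      simp
    · rw [Finset.sum_range]
      refine Finset.sum_congr rfl fun i _ => ?_
      have h2 : (L.drop i).take 1 = [L[i]] := by
        rw [List.drop_eq_getElem_cons i.2]; rfl
      simp only [T]
      rw [h2, M_tree]
  · intro i
    simp [T, M_one]

/-- The sign by which the planar tree attached to a tree of the free operad is multiplied, at a
vertex with subtrees `l`: each subtree is exchanged with the desuspensions of the subtrees on its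
right. -/
def θ (𝕜 : Type u) [Field 𝕜] : List Tr → 𝕜
  | [] => 1
  | t :: l => sg 𝕜 t ^ l.length * θ 𝕜 l

theorem sgL_mul_self (l : List Tr) : sgL 𝕜 l * sgL 𝕜 l = 1 := by
  have := sg_mul_self 𝕜 (.node l)
  rwa [sg_node, neg_mul_neg] at this

theorem θ_append (l l' : List Tr) : θ 𝕜 (l ++ l') = θ 𝕜 l * sgL 𝕜 l ^ l'.length * θ 𝕜 l' := by
  induction l with
  | nil => simp [θ]
  | cons t l ih =>
    rw [List.cons_append, θ, ih, θ, sgL_cons, List.length_append, pow_add, mul_pow]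
    ring

/-- Grafting the trees of a forest to a new root, with signs. -/
noncomputable def ndθ : ForestAlg 𝕜 →ₗ[𝕜] ForestAlg 𝕜 := lin fun l => θ 𝕜 l • w [.node l]

theorem ndθ_w (l : List Tr) : (ndθ (w l) : ForestAlg 𝕜) = θ 𝕜 l • w [.node l] := lin_w _ _

theorem sgL_pow_sq (l : List Tr) : sgL 𝕜 l ^ 2 = 1 := by rw [pow_two, sgL_mul_self]

theorem neg_one_pow_mul_self (n : ℕ) : (-1 : 𝕜) ^ n * (-1) ^ n = 1 := by
  rw [← mul_pow]; simp

theorem θ_replace {l : List Tr} {i : ℕ} (hi : i < l.length) {s : Tr} (hs : sg 𝕜 s = - sg 𝕜 l[i]) :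
    θ 𝕜 (l.take i ++ s :: l.drop (i + 1)) = (-1) ^ (l.length - (i + 1)) * θ 𝕜 l := by
  conv_rhs => rw [← List.take_append_drop i l, List.drop_eq_getElem_cons hi]
  rw [θ_append, θ_append, θ, θ, hs, neg_pow]
  simp only [List.length_cons, List.length_drop, List.length_append, List.length_take]
  have : min i l.length + (l.length - (i + 1) + 1) - (i + 1) = l.length - (i + 1) := by omega
  rw [this]
  ring

/-- Replacing a subtree of the root by its differential. -/
theorem ndθ_dTree {l : List Tr} {i : ℕ} (hi : i < l.length) :
    ndθ (w (l.take i) * dTree 𝕜 l[i] * w (l.drop (i + 1))) = ((-1) ^ (l.length - (i + 1)) * θ 𝕜 l) •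
      nd (w (l.take i) * dTree 𝕜 l[i] * w (l.drop (i + 1))) := by
  let B : ForestAlg 𝕜 →ₗ[𝕜] ForestAlg 𝕜 :=
    LinearMap.mulRight 𝕜 (w (l.drop (i + 1))) ∘ₗ LinearMap.mulLeft 𝕜 (w (l.take i))
  refine eq_of_fs (ndθ ∘ₗ B) (((-1) ^ (l.length - (i + 1)) * θ 𝕜 l) • nd ∘ₗ B) ?_
    (dTree_mem (𝕜 := 𝕜) l[i])
  rintro _ ⟨s, rfl, hs⟩
  have h1 : sg 𝕜 s = - sg 𝕜 l[i] := by simpa using hs.sgL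
  have h2 : B (w [s]) = w (l.take i ++ s :: l.drop (i + 1)) := by
    change w (l.take i) * w [s] * w (l.drop (i + 1)) = _
    rw [← w_append, ← w_append]; simp
  change ndθ (B (w [s])) = ((-1) ^ (l.length - (i + 1)) * θ 𝕜 l) • nd (B (w [s]))
  rw [h2, ndθ_w, nd_w, θ_replace hi h1]

/-- The signs of the two differentials agree on the terms which graft the inputs in the interval
`x`. On the left-hand side, the first factor is the desuspension in the dual dg operad, the second
one is the sign of the suspension, and the third one is the Koszul sign of moving the upper vertex
past the subtrees on its left. -/
theorem θ_contract {L : List Tr} {x : ℕ × ℕ} (hx : x ∈ Per.Elem.intervals L.length) :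
    (-1) ^ (L.length + 1 - x.2 + 1) * (-1) ^ (x.1 * (x.2 + 1)) *
      ((-1) ^ x.1 * sgL 𝕜 (L.take x.1)) ^ x.2 * θ 𝕜 ((L.drop x.1).take x.2) *
      θ 𝕜 (contract L x) = θ 𝕜 L * sgL 𝕜 (L.take x.1) := by
  obtain ⟨a, b⟩ := x
  simp only [Per.Elem.intervals, Finset.mem_filter, Finset.mem_product, Finset.mem_range] at hx
  have hL : L = L.take a ++ ((L.drop a).take b ++ L.drop (a + b)) := by
    rw [← List.drop_drop, List.take_append_drop, List.take_append_drop]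
  have ha : (L.take a).length = a := by rw [List.length_take]; omega
  have hb : ((L.drop a).take b).length = b := by rw [List.length_take, List.length_drop]; omega
  dsimp only [contract]
  conv_rhs => rw [hL]
  generalize L.take a = u at *
  generalize (L.drop a).take b = v at *
  generalize L.drop (a + b) = z at *
  have hlen : L.length = a + (b + z.length) := by
    rw [hL, List.length_append, List.length_append, ha, hb]
  have e1 : L.length + 1 - b + 1 = a + z.length + 2 := by omega
  rw [e1, List.take_append_of_le_length (by omega), List.take_of_length_le (by omega), θ_append,
    θ_append, θ_append, θ, sg_node, List.length_cons, List.length_append, hb]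
  have hu := sgL_pow_sq (𝕜 := 𝕜) u
  have hm : ((-1 : 𝕜) ^ (a + z.length + 2) * (-1) ^ (a * (b + 1))) * ((-1) ^ a) ^ b *
      (-1) ^ z.length = 1 := by
    rw [← pow_mul, ← pow_add, ← pow_add, ← pow_add]
    exact Even.neg_one_pow ⟨a + z.length + 1 + a * b, by ring⟩
  rw [mul_pow, neg_pow (sgL 𝕜 v)]
  linear_combination (sgL 𝕜 u ^ b * θ 𝕜 v * θ 𝕜 u * sgL 𝕜 u ^ (z.length + 1) *
    sgL 𝕜 v ^ z.length * θ 𝕜 z) * hm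
end ForestAlg

/-! ### Trees of the free operad as planar trees -/

/-- The planar tree underlying a tree of the free operad. -/
def PTree.shape : ∀ {α : Per}, PTree α → Tr
  | _, .leaf _ => Tr.leaf
  | _, .node _ _ t => .node (List.ofFn fun i => (t i).shape)

namespace PTree
open Tr

theorem leavesL_ofFn {r : ℕ} (s : Fin r → Tr) : leavesL (List.ofFn s) = ∑ i, leaves (s i) := by
  induction r with
  | zero => simp
  | succ r ih => rw [List.ofFn_succ, leavesL_cons, ih, Fin.sum_univ_succ]

theorem leaves_shape {α : Per} (t : PTree α) : leaves t.shape = α.k := by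
  induction t with
  | leaf h => rw [shape, leaves_leaf, h]
  | @node α β f h t ih =>
    rw [shape, leaves_node, leavesL_ofFn, ← Per.sum_fib f]
    · exact Finset.sum_congr rfl fun i _ => ih i
    · intro h0
      have := congrArg List.length h0
      rw [List.length_ofFn] at this
      simp at this
      omega

theorem red_shape {α : Per} (t : PTree α) : Red t.shape := by
  induction t with
  | leaf h => exact red_leaf
  | @node α β f h t ih =>
    rw [shape, red_node, List.length_ofFn, redL_iff]
    refine ⟨by omega, fun s hs => ?_⟩
    obtain ⟨i, rfl⟩ := List.mem_ofFn.1 hs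
    exact ih i

/-- A tree of the free operad is determined by its underlying planar tree. -/
theorem shape_injective {α : Per} : Function.Injective (shape (α := α)) := by
  intro t s hts
  induction t with
  | leaf h =>
    cases s with
    | leaf _ => rfl
    | node f h' s => exact absurd (Per.k_le f) (by omega)
  | @node α β f h t ih =>
    cases s with
    | leaf h' => exact absurd (Per.k_le f) (by omega)
    | @node _ β' f' h' s =>
      rw [shape, shape, Tr.node.injEq] at hts
      have hk : β.k = β'.k := by simpa using congrArg List.length hts
      have hs : ∀ i, (t i).shape = (s (Fin.cast hk i)).shape := fun i => by
        have := List.getElem_of_eq hts (i := i) (by simp)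
        rw [List.getElem_ofFn, List.getElem_ofFn] at this
        exact this
      have hff := Per.sigma_ext_of_card f f' hk fun i => by
        rw [← leaves_shape (t i), hs, leaves_shape]
      cases hff
      congr 1
      funext i
      exact ih i (hs i)

/-- Every reduced planar tree with `|α|` leaves underlies a tree of the free operad. -/
theorem exists_shape {s : Tr} (hs : Red s) {α : Per} (hα : leaves s = α.k) :
    ∃ t : PTree α, t.shape = s := by
  induction s using Tr.ind generalizing α with
  | h l ih =>
    rw [red_node, redL_iff] at hs
    by_cases hl : l = []
    · subst hl
      exact ⟨.leaf (by rw [← hα]; exact leaves_leaf), by rw [shape]; rfl⟩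
    · have h2 : 2 ≤ l.length := by
        have := List.length_pos_iff.2 hl
        omega
      rw [leaves_node hl] at hα
      obtain ⟨β, f, hk, hf⟩ := Per.exists_hom α (fun i : Fin l.length => leaves l[i])
        (fun i => leaves_pos _) (by
          rw [← leavesL_ofFn]
          exact (congrArg leavesL List.ofFn_getElem).trans hα)
      have : ∀ i : Fin β.k, ∃ t : PTree (Per.fib f i), t.shape = l[Fin.cast hk i] := fun i =>
        ih _ (List.getElem_mem _) (hs.2 _ (List.getElem_mem _)) (hf i).symm
      choose t ht using this
      refine ⟨.node f (by omega) t, ?_⟩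
      rw [shape]
      congr 1
      refine List.ext_getElem (by simp [hk]) fun i h1 h2 => ?_
      rw [List.getElem_ofFn, ht]
      rfl

end PTree

namespace PerColl
open ForestAlg Tr

variable {𝕜 : Type u} [Field 𝕜] (E : PerColl 𝕜)

section Basis
variable {E} (g : ∀ α, E.obj α)

/-- The pure tensor of the generators `g` in the summand of a tree. -/
noncomputable def zT : ∀ {α : Per} (t : PTree α), E.T t
  | _, .leaf h => E.tl h 1
  | _, .node (β := β) f h t => E.tm f h t (g β) fun i => zT (t i)

/-- The basis of the free operad given by the generators `g`. -/
noncomputable def Z {α : Per} (t : PTree α) : E.F α := E.of t (zT g t)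

theorem Z_leaf {α : Per} (h : α.k = 1) : Z g (.leaf h) = E.one h := by
  rw [Z, zT, one_eq]

theorem Z_node {α β : Per} (f : α ⟶ β) (h : 2 ≤ β.k) (t : ∀ i, PTree (Per.fib f i)) :
    Z g (.node f h t) = E.node f h (g β) fun i => Z g (t i) := by
  simp only [Z]
  rw [node_of, zT]

variable {g}

theorem exists_smul_zT (hspan : ∀ α (e : E.obj α), ∃ c : 𝕜, e = c • g α) {α : Per} (t : PTree α)
    (x : E.T t) : ∃ c : 𝕜, x = c • zT g t := by
  induction t with
  | leaf h =>
    obtain ⟨c, hc⟩ : ∃ c, x = E.tl h c := ⟨x, rfl⟩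
    exact ⟨c, by rw [hc, zT]; exact (mul_one c).symm⟩
  | @node α β f h t ih =>
    refine E.T_node_induction (p := fun x => ∃ c : 𝕜, x = c • zT g (.node f h t)) (fun e x => ?_)
      (fun x y hx hy => ?_) ⟨0, (zero_smul 𝕜 _).symm⟩ x
    · obtain ⟨c, rfl⟩ := hspan β e
      choose r hr using fun i => ih i (x i)
      obtain rfl : x = fun i => r i • zT g (t i) := funext hr
      refine ⟨c * ∏ i, r i, ?_⟩
      rw [zT, tm, tm, map_smul, smul_apply, MultilinearMap.map_smul_univ, mul_smul]
    · obtain ⟨c, hc⟩ := hx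
      obtain ⟨c', hc'⟩ := hy
      exact ⟨c + c', by rw [hc, hc', add_smul]⟩

theorem eq_on_Z (hspan : ∀ α (e : E.obj α), ∃ c : 𝕜, e = c • g α) {α : Per} {V : Type*}
    [AddCommGroup V] [Module 𝕜 V] {φ ψ : E.F α →ₗ[𝕜] V} (h : ∀ t, φ (Z g t) = ψ (Z g t)) :
    φ = ψ := by
  refine LinearMap.ext fun x => ?_
  induction x using E.F_add_induction with
  | hof t x =>
    obtain ⟨c, rfl⟩ := exists_smul_zT hspan t x
    have := h t
    rw [Z] at this
    rw [map_smul, map_smul, map_smul, this]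
  | hadd x y hx hy => rw [map_add, map_add, hx, hy]
  | hzero => rw [map_zero, map_zero]

end Basis

section Shape
variable (co : ∀ α, E.obj α →ₗ[𝕜] 𝕜)

/-- The map to linear combinations of planar trees, on the summand of a tree. -/
noncomputable def ShT : ∀ {α : Per} (t : PTree α), E.T t →ₗ[𝕜] ForestAlg 𝕜
  | _, .leaf _ => (LinearMap.toSpanSingleton 𝕜 (ForestAlg 𝕜) (w [leaf]) : 𝕜 →ₗ[𝕜] ForestAlg 𝕜)
  | _, .node (β := β) f h t => E.liftNode f h t
      (MultilinearMap.compLinearMapₗ (fun i => ShT (t i)) ∘ₗ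
        LinearMap.toSpanSingleton 𝕜 _
          (ndθ.compMultilinearMap (MultilinearMap.mkPiAlgebraFin 𝕜 β.k (ForestAlg 𝕜))) ∘ₗ co β)

/-- The map from the free operad to linear combinations of planar trees which takes the signs of
the desuspensions into account. -/
noncomputable def Sh (α : Per) : E.F α →ₗ[𝕜] ForestAlg 𝕜 := E.lift fun t => E.ShT co t

theorem Sh_of {α : Per} (t : PTree α) (x : E.T t) : E.Sh co α (E.of t x) = E.ShT co t x :=
  E.lift_of _ t x

theorem Sh_one {α : Per} (h : α.k = 1) : E.Sh co α (E.one h) = w [leaf] := by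
  rw [one_eq, Sh_of, ShT]
  exact one_smul 𝕜 _

theorem Sh_node {α β : Per} (f : α ⟶ β) (h : 2 ≤ β.k) (e : E.obj β)
    (y : ∀ i, E.F (Per.fib f i)) :
    E.Sh co α (E.node f h e y) = co β e • ndθ (List.ofFn fun i => E.Sh co _ (y i)).prod := by
  have key : (E.Sh co α).compMultilinearMap (E.node f h e) =
      co β e • (ndθ.compMultilinearMap
        (MultilinearMap.mkPiAlgebraFin 𝕜 β.k (ForestAlg 𝕜))).compLinearMap
        fun i => E.Sh co (Per.fib f i) := by
    refine MultilinearMap.dfinsupp_ext fun t => MultilinearMap.ext fun x => ?_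
    change E.Sh co α (E.node f h e fun i => E.of (t i) (x i)) = co β e •
      ndθ (MultilinearMap.mkPiAlgebraFin 𝕜 β.k (ForestAlg 𝕜)
        fun i => E.Sh co _ (E.of (t i) (x i)))
    rw [node_of, Sh_of, ShT, liftNode_tm]
    simp only [Sh_of]
    rfl
  have := congrArg (fun m : MultilinearMap 𝕜 (fun i => E.F (Per.fib f i)) (ForestAlg 𝕜) => m y) key
  rw [← MultilinearMap.mkPiAlgebraFin_apply (R := 𝕜)]
  exact this

theorem prod_ofFn_smul_w {r : ℕ} (c : Fin r → 𝕜) (s : Fin r → Tr) :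
    (List.ofFn fun i => c i • (w [s i] : ForestAlg 𝕜)).prod =
      (∏ i, c i) • w (List.ofFn s) := by
  induction r with
  | zero => simp
  | succ r ih =>
    rw [List.ofFn_succ, List.prod_cons, ih, Fin.prod_univ_succ, List.ofFn_succ,
      smul_mul_smul_comm, ← w_cons]

theorem Sh_node_smul {α β : Per} (f : α ⟶ β) (h : 2 ≤ β.k) (e : E.obj β)
    (y : ∀ i, E.F (Per.fib f i)) (c : Fin β.k → 𝕜) (s : Fin β.k → Tr)
    (hy : ∀ i, E.Sh co _ (y i) = c i • w [s i]) :
    E.Sh co α (E.node f h e y) =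
      (co β e * (∏ i, c i) * θ 𝕜 (List.ofFn s)) • w [.node (List.ofFn s)] := by
  rw [Sh_node]
  simp only [hy]
  rw [prod_ofFn_smul_w, map_smul, ndθ_w, smul_smul, smul_smul]

end Shape

section Degree
variable {E}

theorem sgL_ofFn {r : ℕ} (s : Fin r → Tr) : sgL 𝕜 (List.ofFn s) = ∏ i, sg 𝕜 (s i) := by
  induction r with
  | zero => simp
  | succ r ih => rw [List.ofFn_succ, sgL_cons, ih, Fin.prod_univ_succ]

theorem negOnePow_sum {ι : Type*} (s : Finset ι) (n : ι → ℤ) :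
    ((∑ i ∈ s, n i).negOnePow : ℤˣ) • (1 : 𝕜) = ∏ i ∈ s, ((n i).negOnePow : ℤˣ) • (1 : 𝕜) := by
  classical
  induction s using Finset.induction_on with
  | empty => simp
  | insert i s hi ih =>
    rw [Finset.sum_insert hi, Finset.prod_insert hi, Int.negOnePow_add, ← ih, smul_mul_smul_comm,
      one_mul]

/-- The parity of the degree of a tree of the free operad on generators of degree `|α| - 2`. -/
theorem negOnePow_deg (hdeg : ∀ α, E.deg α = α.k - 2) {α : Per} (t : PTree α) :
    ((t.deg E.deg).negOnePow : ℤˣ) • (1 : 𝕜) = - sg 𝕜 t.shape := by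
  induction t with
  | leaf h => rw [PTree.deg, PTree.shape]; simp [leaf]
  | @node α β f h t ih =>
    rw [PTree.deg, PTree.shape, sg_node, neg_neg, sgL_ofFn, Int.negOnePow_add, mul_smul,
      negOnePow_sum, Finset.prod_congr rfl fun i _ => ih i, hdeg, Finset.prod_neg, Finset.card_univ,
      Fintype.card_fin, Int.negOnePow_smul_eq (m := β.k)]
    · rw [← mul_assoc, neg_one_pow_mul_self, one_mul]
    · push_cast
      rw [show (2 : ZMod 2) = 0 from rfl, sub_zero]

theorem twist_of_two_sub (hdeg : ∀ α, E.deg α = α.k - 2) {α : Per} (t : PTree α) (x : E.T t)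
    (b : ℕ) : E.twist (b - 2) α (E.of t x) = (- sg 𝕜 t.shape) ^ b • E.of t x := by
  rw [twist_of, ← negOnePow_deg hdeg t]
  generalize t.deg E.deg = n
  have h1 : ∀ (m : ℤ) (v : E.F α), (m.negOnePow : ℤˣ) • v = ((m.negOnePow : ℤˣ) • (1 : 𝕜)) • v := by
    intro m v
    rcases Int.units_eq_one_or m.negOnePow with h | h <;> rw [h] <;> simp
  rw [h1]
  congr 1
  rcases Int.even_or_odd n with hn | hn
  · rw [Int.negOnePow_even _ (hn.mul_left _), Int.negOnePow_even _ hn, one_smul, one_pow]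
  · rw [Int.negOnePow_odd n hn, Int.negOnePow_smul_eq (m := b)]
    · simp
    · obtain ⟨m, rfl⟩ := hn
      push_cast
      rw [show (2 : ZMod 2) = 0 from rfl]; ring

end Degree

end PerColl

/-! ### Comparison of the differentials -/

namespace Per.Elem

theorem neg_one_pow_susp {𝕜 : Type u} [Field 𝕜] {α : Per} (p : α.Elem) :
    (-1 : 𝕜) ^ susp p.tgt.2 = (-1) ^ ((p.i : ℕ) * (p.size + 1)) := by
  refine neg_one_pow_eq_of_zmod ?_
  rw [susp, Nat.cast_sum, Finset.sum_eq_single_of_mem p.i (Finset.mem_univ _)]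
  · rw [p.sum_lt, if_neg (lt_irrefl _)]
  · intro j _ hj
    rw [p.triv j hj, Nat.cast_mul, show ((1 + 1 : ℕ) : ZMod 2) = 0 from rfl, mul_zero]

end Per.Elem

namespace ForestAlg
open Tr
variable {𝕜 : Type u} [Field 𝕜]

theorem sg_ne_zero (t : Tr) : sg 𝕜 t ≠ 0 := fun h => by
  have := sg_mul_self 𝕜 t
  rw [h, mul_zero] at this
  exact zero_ne_one this

theorem θ_ne_zero (l : List Tr) : θ 𝕜 l ≠ 0 := by
  induction l with
  | nil => exact one_ne_zero
  | cons t l ih => exact mul_ne_zero (pow_ne_zero _ (sg_ne_zero t)) ih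

theorem prod_neg_sg (L : List Tr) {r a : ℕ} (ha : a ≤ L.length) (har : a ≤ r) :
    ∏ j : Fin r, (if (j : ℕ) < a then - sg 𝕜 (L.getD j leaf) else 1) =
      (-1) ^ a * sgL 𝕜 (L.take a) := by
  rw [← Finset.prod_range fun j => if j < a then - sg 𝕜 (L.getD j leaf) else 1,
    ← Finset.prod_filter]
  have h1 : (Finset.range r).filter (· < a) = Finset.range a := by
    ext j
    simp only [Finset.mem_filter, Finset.mem_range]
    omega
  rw [h1]
  clear h1 har
  induction a with
  | zero => simp
  | succ a ih =>
    rw [Finset.prod_range_succ, ih (by omega), List.take_succ_eq_append_getElem (by omega),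
      sgL_append, List.getD_eq_getElem _ _ (by omega)]
    simp [pow_succ, mul_assoc]

theorem prod_map_w (l : List Tr) : (l.map fun s => (w [s] : ForestAlg 𝕜)).prod = w l := by
  induction l with
  | nil => simp
  | cons t l ih => rw [List.map_cons, List.prod_cons, ih, ← w_cons]

theorem ofFn_update {X : Type*} {r : ℕ} (y : Fin r → X) (i : Fin r) (x : X) :
    List.ofFn (Function.update y i x) = (List.ofFn y).set i x := by
  refine List.ext_getElem (by simp) fun j h1 h2 => ?_
  rw [List.getElem_ofFn, List.getElem_set, Function.update_apply]
  simp only [Fin.ext_iff, List.getElem_ofFn, eq_comm]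

theorem prod_ofFn_smul {A : Type*} [Ring A] [Algebra 𝕜 A] {r : ℕ} (c : Fin r → 𝕜) (y : Fin r → A) :
    (List.ofFn fun i => c i • y i).prod = (∏ i, c i) • (List.ofFn y).prod := by
  induction r with
  | zero => simp
  | succ r ih =>
    rw [List.ofFn_succ, List.prod_cons, ih, Fin.prod_univ_succ, List.ofFn_succ, List.prod_cons,
      smul_mul_smul_comm]

theorem prod_ofFn_update {r : ℕ} (c : Fin r → 𝕜) (s : Fin r → Tr) (i : Fin r) (x : ForestAlg 𝕜) :
    (List.ofFn (Function.update (fun j => c j • (w [s j] : ForestAlg 𝕜)) i (c i • x))).prod =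
      (∏ j, c j) • (w ((List.ofFn s).take i) * x * w ((List.ofFn s).drop (i + 1))) := by
  have h1 : Function.update (fun j => c j • (w [s j] : ForestAlg 𝕜)) i (c i • x) =
      fun j => c j • Function.update (fun j => (w [s j] : ForestAlg 𝕜)) i x j := by
    funext j
    rcases eq_or_ne j i with rfl | hj
    · simp
    · simp [hj]
  have h2 : List.ofFn (fun j => (w [s j] : ForestAlg 𝕜)) = (List.ofFn s).map fun s => w [s] := by
    rw [List.map_ofFn]; rfl
  rw [h1, prod_ofFn_smul, ofFn_update, List.prod_set, if_pos (by simp), h2, ← List.map_take,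
    ← List.map_drop, prod_map_w, prod_map_w]

end ForestAlg

namespace PerColl
open ForestAlg Tr

variable {𝕜 : Type u} [Field 𝕜] {E : PerColl 𝕜}

/-- The sign relating a tree of the free operad and its underlying planar tree. -/
noncomputable def eps (𝕜 : Type u) [Field 𝕜] : ∀ {α : Per}, PTree α → 𝕜
  | _, .leaf _ => 1
  | _, .node _ _ t => (∏ i, eps 𝕜 (t i)) * θ 𝕜 (List.ofFn fun i => (t i).shape)

theorem eps_ne_zero {α : Per} (t : PTree α) : eps 𝕜 t ≠ 0 := by
  induction t with
  | leaf h => rw [eps]; exact one_ne_zero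
  | node f h t ih =>
    rw [eps]
    exact mul_ne_zero (Finset.prod_ne_zero_iff.2 fun i _ => ih i) (θ_ne_zero _)

variable {g : ∀ α, E.obj α} {co : ∀ α, E.obj α →ₗ[𝕜] 𝕜}

theorem Sh_Z (hco : ∀ α, co α (g α) = 1) {α : Per} (t : PTree α) :
    E.Sh co α (Z g t) = eps 𝕜 t • w [t.shape] := by
  induction t with
  | leaf h => rw [Z_leaf, Sh_one, eps, one_smul, PTree.shape]
  | node f h t ih =>
    rw [Z_node, Sh_node_smul E co f h _ _ _ _ ih, hco, one_mul, eps, PTree.shape]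

/-- Composing the result of an elementary composition of two generators, in terms of planar
trees. -/
theorem Sh_comp_circ (hco : ∀ α, co α (g α) = 1) (hdeg : ∀ α, E.deg α = α.k - 2) {α β : Per}
    (f : α ⟶ β) (p : β.Elem) (t : ∀ i, PTree (Per.fib f i)) :
    E.Sh co α (E.comp f (E.circ p.tgt.2 p.i (E.gen _ (g p.tgt.1))
      (E.gen _ (g (Per.fib p.tgt.2 p.i)))) fun i => Z g (t i)) =
      ((∏ i, eps 𝕜 (t i)) *
        (((-1) ^ p.interval.1 * sgL 𝕜 ((List.ofFn fun i => (t i).shape).take p.interval.1)) ^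
          p.interval.2 * θ 𝕜 (((List.ofFn fun i => (t i).shape).drop p.interval.1).take
            p.interval.2) * θ 𝕜 (contract (List.ofFn fun i => (t i).shape) p.interval))) •
        w [.node (contract (List.ofFn fun i => (t i).shape) p.interval)] := by
  set L := List.ofFn fun i => (t i).shape with hL
  have hlen : L.length = β.k := by simp [hL]
  have hget : ∀ (i : Fin β.k) (n : ℕ) (h : n < L.length), (i : ℕ) = n → (t i).shape = L[n] := by
    rintro i _ h rfl
    simp [hL]
  have hi := p.i.2
  have hcard := p.card
  have hle := p.i_add_size_le
  have hsz := p.two_le_size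
  -- the arguments of the lower generator of the elementary composition
  let U : ∀ j, E.F (Per.fib p.tgt.2 j) :=
    Function.update (fun j => E.oneOrZero (Per.fib p.tgt.2 j)) p.i
      (E.gen _ (g (Per.fib p.tgt.2 p.i)))
  have hU1 : ∀ j (h : j ≠ p.i), U j = E.one (p.triv j h) := fun j h => by
    rw [show U j = E.oneOrZero (Per.fib p.tgt.2 j) from Function.update_of_ne h _ _, oneOrZero,
      dif_pos (p.triv j h)]
  have hU2 : U p.i = E.gen _ (g (Per.fib p.tgt.2 p.i)) := Function.update_self ..
  have hU : ∀ j, ∃ t' x', U j = E.of t' x' ∧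
      t'.deg E.deg = if j = p.i then (p.size : ℤ) - 2 else 0 := by
    intro j
    by_cases hj : j = p.i
    · subst hj
      refine ⟨_, _, hU2.trans (gen_eq E hsz _), ?_⟩
      rw [if_pos rfl, cor, PTree.deg, hdeg, Finset.sum_eq_zero, add_zero]
      intro _ _
      rw [PTree.deg]
    · exact ⟨_, _, (hU1 j hj).trans (one_eq E _), by rw [if_neg hj, PTree.deg]⟩
  choose t' x' hUt hdeg' using hU
  have hcirc : E.circ p.tgt.2 p.i (E.gen _ (g p.tgt.1)) (E.gen _ (g (Per.fib p.tgt.2 p.i))) =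
      E.node p.tgt.2 p.two_le (g p.tgt.1) fun j => E.of (t' j) (x' j) := by
    rw [← funext hUt, circ, LinearMap.mk₂_apply, comp_gen E _ p.two_le]
  have hP : ∀ j, ∑ j' with j < j', (t' j').deg E.deg = if j < p.i then (p.size : ℤ) - 2 else 0 := by
    intro j
    simp only [hdeg']
    rw [Finset.sum_ite_eq']
    simp
  rw [hcirc, comp_node]
  simp only [hP, ← hUt]
  -- the contributions of the fibers of the elementary morphism
  let τ : Fin p.tgt.1.k → 𝕜 := fun j =>
    (if j = p.i then θ 𝕜 ((L.drop p.i).take p.size) else 1) *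
      (if (j : ℕ) < p.i then - sg 𝕜 (L.getD j leaf) else 1) ^ p.size
  let s : Fin p.tgt.1.k → Tr := fun j =>
    if j = p.i then .node ((L.drop p.i).take p.size)
    else (t (Per.emb p.tgt.2 j ⟨0, (Per.fib p.tgt.2 j).pos⟩)).shape
  have hmid : (List.ofFn fun l => (t (Per.emb p.tgt.2 p.i l)).shape) =
      (L.drop p.i).take p.size := by
    refine List.ext_getElem ?_ fun n h1 h2 => ?_
    · rw [List.length_ofFn, List.length_take, List.length_drop]
      change p.size = _
      omega
    · rw [List.getElem_ofFn, List.getElem_take, List.getElem_drop]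
      exact hget _ _ _ (p.emb_self _)
  have hs : List.ofFn s = contract L p.interval := by
    refine List.ext_getElem ?_ fun n h1 h2 => ?_
    · simp only [contract, Per.Elem.interval, List.length_ofFn, List.length_append,
        List.length_cons, List.length_take, List.length_drop]
      omega
    · rw [List.getElem_ofFn]
      rw [List.length_ofFn] at h1
      simp only [contract, Per.Elem.interval, s]
      rcases lt_trichotomy n p.i with h | h | h
      · rw [if_neg (by rw [Fin.ext_iff]; exact h.ne), List.getElem_append_left
          (by rw [List.length_take]; omega), List.getElem_take]
        exact hget _ _ _ (p.emb_of_lt h _)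
      · rw [if_pos (Fin.ext h), List.getElem_append_right (by rw [List.length_take]; omega)]
        simp only [List.length_take]
        rw [List.getElem_cons, dif_pos (by omega)]
      · rw [if_neg (by rw [Fin.ext_iff]; exact h.ne'), List.getElem_append_right
          (by rw [List.length_take]; omega)]
        simp only [List.length_take]
        rw [List.getElem_cons, dif_neg (by omega), List.getElem_drop]
        refine hget _ _ _ ((p.emb_of_gt h _).trans ?_)
        dsimp only
        omega
  have hentry : ∀ j, E.Sh co _ (E.comp (Per.fibMap f p.tgt.2 j) (U j)
      (E.args f p.tgt.2 (fun j => if j < p.i then (p.size : ℤ) - 2 else 0) j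
        fun i => Z g (t i))) =
      (τ j * ∏ l, eps 𝕜 (t (Per.emb p.tgt.2 j l))) • w [s j] := by
    intro j
    by_cases hj : j = p.i
    · subst hj
      rw [hU2, comp_gen E _ hsz, Sh_node_smul E co _ hsz _ _ (fun l =>
        eps 𝕜 (t (Per.emb p.tgt.2 p.i l))) (fun l => (t (Per.emb p.tgt.2 p.i l)).shape), hco,
        one_mul, hmid]
      · simp only [τ, s, if_true, lt_irrefl, if_false, one_pow, mul_one]
        rw [mul_comm (θ 𝕜 _)]
      · intro l
        rw [args_eq, apply_castL (fun α => E.Sh co α), if_neg (lt_irrefl _), twist_zero, Sh_Z hco]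
    · have hfj := p.triv j hj
      have : Subsingleton (Fin (Per.fib p.tgt.2 j).k) := by rw [hfj]; infer_instance
      rw [hU1 j hj, comp_one, apply_castL (fun α => E.Sh co α), args_eq,
        apply_castL (fun α => E.Sh co α),
        Fintype.prod_subsingleton _ (⟨0, (Per.fib p.tgt.2 j).pos⟩ : Fin (Per.fib p.tgt.2 j).k)]
      simp only [τ, s, if_neg hj, one_mul]
      rcases lt_or_gt_of_ne hj with h | h
      · have h' : (j : ℕ) < p.i := h
        rw [if_pos h, if_pos h', Z, twist_of_two_sub hdeg, map_smul, ← Z, Sh_Z hco, smul_smul,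
          List.getD_eq_getElem _ _ (by omega), hget _ _ _ (p.emb_of_lt h _)]
      · have h' : ¬ (j : ℕ) < p.i := not_lt.2 (Fin.le_def.1 h.le)
        rw [if_neg (not_lt.2 h.le), if_neg h', twist_zero, Sh_Z hco, one_pow, one_mul]
  rw [Sh_node_smul E co _ p.two_le _ _ _ _ hentry, hs, hco, one_mul, Finset.prod_mul_distrib,
    prod_emb 𝕜 p.tgt.2 fun i => eps 𝕜 (t i)]
  have hτ : ∏ j, τ j = θ 𝕜 ((L.drop p.i).take p.size) *
      ((-1) ^ (p.i : ℕ) * sgL 𝕜 (L.take p.i)) ^ p.size := by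
    simp only [τ]
    rw [Finset.prod_mul_distrib, Finset.prod_ite_eq', if_pos (Finset.mem_univ _),
      Finset.prod_pow, prod_neg_sg L (by omega) (by omega)]
  rw [hτ]
  congr 1
  simp only [Per.Elem.interval]
  ring

/-- The differential of the free operad given by the elementary compositions of the generators
corresponds, up to the sign, to the differential of planar trees. -/
theorem Sh_der (hco : ∀ α, co α (g α) = 1) (hdeg : ∀ α, E.deg α = α.k - 2)
    {ζ : ∀ α, E.obj α →ₗ[𝕜] E.F α}
    (hζ : ∀ α, ζ α (g α) = ∑ p : α.Elem, ((-1 : 𝕜) ^ (p.tgt.1.k + 1) * (-1) ^ Per.susp p.tgt.2) •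
        E.circ p.tgt.2 p.i (E.gen _ (g p.tgt.1)) (E.gen _ (g (Per.fib p.tgt.2 p.i))))
    {α : Per} (t : PTree α) :
    E.Sh co α (E.der ζ α (Z g t)) = - d (E.Sh co α (Z g t)) := by
  induction t with
  | leaf h => rw [Z_leaf, der_one, map_zero, Sh_one, d_tree, dTree_leaf, neg_zero]
  | @node α β f h t ih =>
    set L := List.ofFn fun i => (t i).shape with hL
    have hlen : L.length = β.k := by simp [hL]
    have hgetL : ∀ i : Fin β.k, L[(i : ℕ)]'(by rw [hlen]; exact i.2) = (t i).shape := fun i => by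
      simp [hL]
    have h1 : E.Sh co α (E.comp f (ζ β (g β)) fun i => Z g (t i)) =
        ((∏ i, eps 𝕜 (t i)) * θ 𝕜 L) • ∑ x ∈ Per.Elem.intervals L.length,
          sgL 𝕜 (L.take x.1) • w [.node (contract L x)] := by
      rw [hζ, map_sum, sum_apply, map_sum, Finset.smul_sum, hlen, ← Per.Elem.sum_elem]
      refine Finset.sum_congr rfl fun p _ => ?_
      have hθ := θ_contract (𝕜 := 𝕜) (L := L) (x := p.interval) (by rw [hlen]; exact p.interval_mem)
      have hk : L.length + 1 - p.interval.2 + 1 = p.tgt.1.k + 1 := by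
        have := p.card
        rw [hlen, Per.Elem.interval]
        dsimp only
        omega
      rw [hk] at hθ
      rw [map_smul, smul_apply, map_smul, Sh_comp_circ hco hdeg, smul_smul, smul_smul,
        Per.Elem.neg_one_pow_susp]
      congr 1
      rw [← hL, mul_assoc (∏ i, eps 𝕜 (t i)), ← hθ]
      simp only [Per.Elem.interval]
      ring
    have h2 : ∀ i : Fin β.k, E.Sh co α
        (((E.deg β + ∑ j with j < i, (t j).deg E.deg).negOnePow : ℤˣ) •
          E.node f h (g β) (Function.update (fun j => Z g (t j)) i (E.der ζ _ (Z g (t i))))) =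
        ((∏ i, eps 𝕜 (t i)) * θ 𝕜 L) • (sgL 𝕜 (L.take i) •
          nd (w (L.take i) * dTree 𝕜 (t i).shape * w (L.drop (i + 1)))) := by
      intro i
      have hsgn : ((E.deg β + ∑ j with j < i, (t j).deg E.deg).negOnePow : ℤˣ) • (1 : 𝕜) =
          (-1) ^ β.k * ((-1) ^ (i : ℕ) * sgL 𝕜 (L.take i)) := by
        rw [Int.negOnePow_add, mul_smul, negOnePow_sum, hdeg, Int.negOnePow_smul_eq (m := β.k),
          Finset.prod_filter]
        · congr 1
          rw [← prod_neg_sg L (r := β.k) (by omega) i.2.le]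
          refine Finset.prod_congr rfl fun j _ => ?_
          rw [negOnePow_deg hdeg, List.getD_eq_getElem _ _ (by omega), hgetL]
          simp only [Fin.lt_def]
        · push_cast
          rw [show (2 : ZMod 2) = 0 from rfl, sub_zero]
      have hsm : ∀ (s : ℤˣ) (z : E.F α), E.Sh co α (s • z) = (s • (1 : 𝕜)) • E.Sh co α z := by
        intro s z
        rcases Int.units_eq_one_or s with rfl | rfl <;> simp
      have hupd : (fun j => E.Sh co _ (Function.update (fun j => Z g (t j)) i
          (E.der ζ _ (Z g (t i))) j)) = Function.update (fun j => eps 𝕜 (t j) • w [(t j).shape]) i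
          (eps 𝕜 (t i) • - dTree 𝕜 (t i).shape) := by
        funext j
        rcases eq_or_ne j i with rfl | hj
        · rw [Function.update_self, Function.update_self, ih, Sh_Z hco, map_smul, d_tree, smul_neg]
        · rw [Function.update_of_ne hj, Function.update_of_ne hj, Sh_Z hco]
      have hnd := ndθ_dTree (𝕜 := 𝕜) (l := L) (i := i)
        (by rw [hlen]; exact i.2)
      rw [hgetL, hlen] at hnd
      rw [hsm, hsgn, Sh_node, hco, one_smul, hupd, prod_ofFn_update, ← hL, mul_neg, neg_mul,
        smul_neg, map_neg, map_smul, hnd, smul_neg, ← neg_smul, smul_smul, smul_smul, smul_smul]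
      have hs : (-1 : 𝕜) ^ β.k * (-1) ^ (i : ℕ) * (-1) ^ (β.k - (i + 1)) = -1 := by
        rw [← pow_add, ← pow_add]
        refine Odd.neg_one_pow ?_
        have := i.2
        exact ⟨β.k - 1, by omega⟩
      congr 1
      linear_combination (- (∏ i, eps 𝕜 (t i)) * θ 𝕜 L * sgL 𝕜 (L.take i)) * hs
    have h3 := neg_dTree_node (𝕜 := 𝕜) (L := L) (by omega)
    rw [Sh_Z hco, map_smul, d_tree, PTree.shape, eps, ← hL, ← smul_neg, h3, smul_add, Z_node]
    have h4 : E.der ζ α (E.node f h (g β) fun i => Z g (t i)) = _ := der_node E ζ f h (g β) t _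
    rw [h4, map_add, map_sum]
    congr 1
    refine (Finset.sum_congr rfl fun i _ => h2 i).trans ?_
    rw [Finset.smul_sum]
    refine Fintype.sum_equiv (finCongr hlen.symm) _ _ fun i => ?_
    simp only [finCongr_apply, Fin.val_cast, Fin.getElem_fin, hgetL]

end PerColl

/-! ### The resolution of the terminal operad -/

namespace PerColl
open ForestAlg Tr

variable {𝕜 : Type u} [Field 𝕜] {E : PerColl 𝕜} {g : ∀ α, E.obj α} {co : ∀ α, E.obj α →ₗ[𝕜] 𝕜}

/-- The image of `Sh` consists of combinations of reduced trees. -/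
theorem Sh_mem (hco : ∀ α, co α (g α) = 1) (hspan : ∀ α (e : E.obj α), ∃ c : 𝕜, e = c • g α)
    {α : Per} (x : E.F α) : E.Sh co α x ∈ fs (𝕜 := 𝕜) (single (Ord α.k)) := by
  induction x using E.F_add_induction with
  | hof t x =>
    obtain ⟨c, rfl⟩ := exists_smul_zT hspan t x
    rw [map_smul, ← Z, map_smul, Sh_Z hco]
    exact Submodule.smul_mem _ _ (Submodule.smul_mem _ _
      (w_mem_single ⟨t.red_shape, t.leaves_shape⟩))
  | hadd x y hx hy => rw [map_add]; exact add_mem hx hy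
  | hzero => rw [map_zero]; exact zero_mem _

open Classical in
variable (g) in
/-- The inverse of `Sh` on the span of the planar trees underlying trees of the free operad; it
vanishes on the other forests. -/
noncomputable def ShInv (α : Per) : ForestAlg 𝕜 →ₗ[𝕜] E.F α :=
  lin fun l => if h : ∃ t : PTree α, [t.shape] = l then (eps 𝕜 h.choose)⁻¹ • Z g h.choose else 0

theorem ShInv_w {α : Per} (t : PTree α) :
    ShInv g α (w [t.shape]) = (eps 𝕜 t)⁻¹ • Z g t := by
  have h : ∃ s : PTree α, [s.shape] = [t.shape] := ⟨t, rfl⟩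
  have ht : h.choose = t := PTree.shape_injective (List.singleton_inj.1 h.choose_spec)
  rw [ShInv, lin_w, dif_pos h, ht]

theorem ShInv_Sh (hco : ∀ α, co α (g α) = 1) (hspan : ∀ α (e : E.obj α), ∃ c : 𝕜, e = c • g α)
    {α : Per} (x : E.F α) : ShInv g α (E.Sh co α x) = x := by
  have : ShInv g α ∘ₗ E.Sh co α = LinearMap.id := eq_on_Z hspan fun t => by
    rw [LinearMap.comp_apply, Sh_Z hco, map_smul, ShInv_w, smul_smul,
      mul_inv_cancel₀ (eps_ne_zero t), one_smul, LinearMap.id_apply]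
  exact LinearMap.congr_fun this x

theorem Sh_ShInv (hco : ∀ α, co α (g α) = 1) {α : Per} {x : ForestAlg 𝕜}
    (hx : x ∈ fs (single (Ord α.k))) : E.Sh co α (ShInv g α x) = x := by
  refine eq_of_fs (E.Sh co α ∘ₗ ShInv g α) LinearMap.id ?_ hx
  rintro _ ⟨s, rfl, hs⟩
  obtain ⟨t, rfl⟩ := PTree.exists_shape hs.1 hs.2
  rw [LinearMap.comp_apply, ShInv_w, map_smul, Sh_Z hco, smul_smul, inv_mul_cancel₀ (eps_ne_zero t),
    one_smul, LinearMap.id_apply]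

/-- The sign in the comparison with planar trees cancels the sign of the augmentation at a
vertex. -/
theorem aug_ofFn {r : ℕ} (hr : 2 ≤ r) (s : Fin r → Tr) :
    θ 𝕜 (List.ofFn s) * aug 𝕜 (.node (List.ofFn s)) = if r = 2 then ∏ i, aug 𝕜 (s i) else 0 := by
  split_ifs with h
  · subst h
    have hl : List.ofFn s = [s 0, s 1] := by simp [List.ofFn_succ]
    rw [hl, aug_two, Fin.prod_univ_two]
    by_cases h0 : aug 𝕜 (s 0) = 0
    · rw [h0]; simp
    · simp [θ, sg_of_aug 𝕜 h0]
  · rw [aug_of_three_le _ (by rw [List.length_ofFn]; omega), mul_zero]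

theorem ev_Z (κ : ∀ α, E.obj α →ₗ[𝕜] (onePer 𝕜).obj α)
    (hκ : ∀ α, 2 ≤ α.k → κ α (g α) = if α.k = 2 then (1 : 𝕜) else (0 : 𝕜)) {α : Per} (t : PTree α) :
    E.ev (onePer 𝕜) κ α (Z g t) = eps 𝕜 t * aug 𝕜 t.shape := by
  induction t with
  | leaf h =>
    rw [Z_leaf, ev_one, eps, PTree.shape, aug_leaf]
    exact (one_mul (1 : 𝕜)).symm
  | @node α β f h t ih =>
    have h1 := ev_node E (onePer 𝕜) κ f h (g β) t fun i => zT g (t i)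
    rw [Z_node, eps, PTree.shape, mul_assoc, aug_ofFn h]
    refine h1.trans ?_
    have h2 : ∀ c : 𝕜, c = (if β.k = 2 then 1 else 0) →
        c * ∏ i, (eps 𝕜 (t i) * aug 𝕜 (t i).shape) =
          (∏ i, eps 𝕜 (t i)) * if β.k = 2 then ∏ i, aug 𝕜 (t i).shape else 0 := by
      rintro _ rfl
      split_ifs
      · rw [one_mul, Finset.prod_mul_distrib]
      · rw [zero_mul, mul_zero]
    exact (congrArg (fun v : Fin β.k → 𝕜 => (show 𝕜 from κ β (g β)) * ∏ i, v i)
      (funext ih)).trans (h2 _ (hκ β h))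

/-- The morphism of operads to the terminal operad which sends the generators of arity two to `1`
and the other ones to `0` corresponds to the augmentation of planar trees. -/
theorem ev_eq_augL (hco : ∀ α, co α (g α) = 1)
    (hspan : ∀ α (e : E.obj α), ∃ c : 𝕜, e = c • g α)
    (κ : ∀ α, E.obj α →ₗ[𝕜] (onePer 𝕜).obj α)
    (hκ : ∀ α, 2 ≤ α.k → κ α (g α) = if α.k = 2 then (1 : 𝕜) else (0 : 𝕜)) {α : Per} (x : E.F α) :
    E.ev (onePer 𝕜) κ α x = augL (E.Sh co α x) := by
  -- The components of the terminal operad are definitionally the ground field.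
  let ev' : E.F α →ₗ[𝕜] 𝕜 := E.ev (onePer 𝕜) κ α
  have h : ev' = augL ∘ₗ E.Sh co α := eq_on_Z hspan fun t => by
    rw [LinearMap.comp_apply, Sh_Z hco, map_smul, augL_tree]
    exact ev_Z κ hκ t
  exact LinearMap.congr_fun h x

/-- A free operad on generators of the form of the dual dg operad of the Koszul dual of the terminal
operad, is a resolution of the terminal operad. -/
theorem isHomologyIso_of_elementary (hco : ∀ α, co α (g α) = 1)
    (hspan : ∀ α (e : E.obj α), ∃ c : 𝕜, e = c • g α) (hdeg : ∀ α, E.deg α = α.k - 2)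
    {ζ : ∀ α, E.obj α →ₗ[𝕜] E.F α}
    (hζ : ∀ α, ζ α (g α) = ∑ p : α.Elem, ((-1 : 𝕜) ^ (p.tgt.1.k + 1) * (-1) ^ Per.susp p.tgt.2) •
        E.circ p.tgt.2 p.i (E.gen _ (g p.tgt.1)) (E.gen _ (g (Per.fib p.tgt.2 p.i))))
    (κ : ∀ α, E.obj α →ₗ[𝕜] (onePer 𝕜).obj α)
    (hκ : ∀ α, 2 ≤ α.k → κ α (g α) = if α.k = 2 then (1 : 𝕜) else (0 : 𝕜)) (α : Per) :
    IsHomologyIso (E.der ζ α) (E.ev (onePer 𝕜) κ α) := by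
  have hD : ∀ x, E.Sh co α (E.der ζ α x) = - d (E.Sh co α x) := fun x =>
    LinearMap.congr_fun (eq_on_Z (φ := E.Sh co α ∘ₗ E.der ζ α) (ψ := - (d ∘ₗ E.Sh co α)) hspan
      fun t => Sh_der hco hdeg hζ t) x
  have hinj : Function.Injective (E.Sh co α) := Function.LeftInverse.injective (ShInv_Sh hco hspan)
  have hmem : ∀ x, E.Sh co α x ∈ fs (𝕜 := 𝕜) (single (Ord α.k)) := Sh_mem hco hspan
  refine ⟨LinearMap.ext fun x => hinj ?_, LinearMap.ext fun x => ?_, fun x hx hax => ?_,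
    fun c => ?_⟩
  · rw [LinearMap.comp_apply, hD, hD, map_neg, neg_neg, d_d (hmem x), LinearMap.zero_apply,
      map_zero]
  · rw [LinearMap.comp_apply, ev_eq_augL hco hspan κ hκ, hD, map_neg, augL_d (hmem x), neg_zero]
    rfl
  · have h1 : d (E.Sh co α x) = 0 := by rw [← neg_eq_zero, ← hD, hx, map_zero]
    have h2 : augL (E.Sh co α x) = 0 := by rw [← ev_eq_augL hco hspan κ hκ]; exact hax
    obtain ⟨y, hy, hyx⟩ := exists_d_eq (hmem x) h1 h2
    refine ⟨- ShInv g α y, hinj ?_⟩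
    rw [hD, map_neg, Sh_ShInv hco hy, map_neg, neg_neg, hyx]
  · have hα := α.pos
    have hc : (w [comb (α.k - 1)] : ForestAlg 𝕜) ∈ fs (single (Ord α.k)) :=
      w_mem_single ⟨red_comb _, by rw [leaves_comb]; omega⟩
    let c' : 𝕜 := c
    refine ⟨(c' / aug 𝕜 (comb (α.k - 1))) • ShInv g α (w [comb (α.k - 1)]), hinj ?_, ?_⟩
    · rw [hD, map_smul, Sh_ShInv hco hc, map_smul, d_tree, dTree_comb, smul_zero, neg_zero,
        map_zero]
    · rw [ev_eq_augL hco hspan κ hκ, map_smul, Sh_ShInv hco hc, map_smul, augL_tree]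
      exact div_mul_cancel₀ c' (aug_comb_ne_zero _)

variable (𝕜) in
/-- The coordinate of a generator of the dual dg operad. -/
noncomputable def cobCo (α : Per) : (cob 𝕜).obj α →ₗ[𝕜] 𝕜 :=
  Module.Dual.eval 𝕜 (Kos 𝕜 α) (kosPhi_surjective (𝕜 := 𝕜) α 1).choose

theorem cobCo_gen (α : Per) : cobCo 𝕜 α (cobGen 𝕜 α) = 1 :=
  (kosPhi_surjective (𝕜 := 𝕜) α 1).choose_spec

instance (α : Per) : Module.Finite 𝕜 ((binColl 𝕜).obj α) :=
  inferInstanceAs (Module.Finite 𝕜 (PLift (α.k = 2) → 𝕜))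

instance (α : Per) : Module.Finite 𝕜 ((terminalPresentation 𝕜).E.obj α) :=
  inferInstanceAs (Module.Finite 𝕜 ((binColl 𝕜).obj α))

instance (α : Per) : Module.Finite 𝕜
    ((terminalPresentation 𝕜).E.KDual (terminalPresentation 𝕜).R α) :=
  inferInstanceAs (Module.Finite 𝕜 (Kos 𝕜 α))

theorem kosPhi_gen {α : Per} (h : 2 ≤ α.k) (e : (binColl 𝕜).susDual.obj α) :
    kosPhi 𝕜 α ((binColl 𝕜).toKDual (binRel 𝕜) α ((binColl 𝕜).susDual.gen α e)) =
      (-1) ^ Per.susp (𝟙 α) * susEv 𝕜 α e := by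
  rw [kosPhi_mk, gen_eq_node _ h, susPhi, phi_node, one_mul]
  simp only [phi_one, Finset.prod_const_one, mul_one]

/-- The twisting morphism maps the binary generators of the dual dg operad to those of the terminal
operad, and the other ones to zero. -/
theorem twisting_cobGen {α : Per} (h : 2 ≤ α.k) :
    (terminalPresentation 𝕜).twisting α (cobGen 𝕜 α) = if α.k = 2 then (1 : 𝕜) else (0 : 𝕜) := by
  let v : (binColl 𝕜).obj α := (Module.evalEquiv 𝕜 ((binColl 𝕜).obj α)).symm
    (((binColl 𝕜).toKDual (binRel 𝕜) α ∘ₗ (binColl 𝕜).susDual.gen α).dualMap (kosPhi 𝕜 α))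
  change binPhi 𝕜 α ((binColl 𝕜).gen α v) = _
  split_ifs with h2
  · have hs : Per.susp (𝟙 α) = 2 := by
      rw [Per.susp_of_two _ h2, Per.fst, Per.fib_id, h2]
    have hv : v = binGen 𝕜 α := by
      refine (LinearEquiv.symm_apply_eq _).2 (LinearMap.ext fun e => ?_)
      refine (kosPhi_gen h e).trans ?_
      rw [hs]
      norm_num
      rfl
    rw [hv, gen_eq_node _ h, binPhi, phi_node, binEv_gen α h2]
    simp [phi_one]
  · have := binary_binColl (𝕜 := 𝕜) α h2
    rw [Subsingleton.elim v 0, map_zero, map_zero]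

end PerColl

theorem theoremB (𝕜 : Type u) [Field 𝕜] [CharZero 𝕜] : IsKoszul (onePer 𝕜) := by
  refine ⟨PerColl.terminalPresentation 𝕜, fun α => inferInstance, fun α => inferInstance,
    fun α => ?_⟩
  exact PerColl.isHomologyIso_of_elementary (E := PerColl.cob 𝕜) (g := PerColl.cobGen 𝕜)
    (co := PerColl.cobCo 𝕜) PerColl.cobCo_gen PerColl.cob_span (fun _ => rfl) PerColl.zeta_cobGen
    (PerColl.terminalPresentation 𝕜).twisting (fun _ h => PerColl.twisting_cobGen h) α
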